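/- Let $n\ge 2$, $\mathfrak g=\mathfrak{su}(1,n)$ with Killing form $B$, $\sigma$ a Cartan involution with decomposition $\mathfrak g=\mathfrak k\oplus\mathfrak p$, $\mathfrak a\subset\mathfrak p$ maximal abelian (so $\dim\mathfrak a=1$), $\alpha$ the positive root such that the positive roots are $\alpha,2\alpha$, and $\mathfrak n=\mathfrak g_\alpha\oplus\mathfrak g_{2\alpha}$, $\mathfrak r=\mathfrak a\oplus\mathfrak n$. Let $R=AN\subset SU(1,n)$ be the corresponding Iwasawa subgroup. Let $Z$ be a central element of $\mathfrak k$ with $(\mathrm{ad}\,Z)^2=-\mathrm{id}$ on $\mathfrak p$, and $\Omega(X,Y)=B(Z,[X,Y])$. Let $A\in\mathfrak a$ with $\alpha(A)=1$. There is a unique $E\in\mathfrak g_{2\alpha}$ with $[x,y]=\Omega(x,y)E$ for all $x,y\in\mathfrak n$. Every element of $\mathfrak r$ is written uniquely as $aA+x+zE$ with $a,z\in\mathbb R$, $x\in\mathfrak g_\alpha$; in these coordinates $(a,x,z)$ one has $\Omega((a,x,z),(a',x',z'))=2(az'-a'z)+\Omega(x,x')$, in particular $\Omega(\xi A,zE)=2\xi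 z$. Put $S^0(p,q,r)=\Omega(p,q)+\Omega(q,r)+\Omega(r,p)$. Fix $\hbar>0$ and a Haar measure $dp=da\,dx\,dz$ on $\mathfrak r$ (any normalization of $dx$). Let $\mathcal S(\mathfrak r)$ and $\mathcal S'(\mathfrak r)$ be the Schwartz functions and the tempered distributions; a bounded continuous function $f$ is identified with the distribution $\psi\mapsto\int\psi f\,dp$. Let $F u(a,x,\xi)=\int_{\mathbb R}e^{-i\Omega(\xi A,zE)}u(a,x,z)\,dz$ be the partial Fourier transform, extended to $\mathcal S'(\mathfrak r)$ by duality, let $\phi_\hbar(a,x,\xi)=\bigl(a,\cosh(\tfrac\hbar2\xi)^{-1}x,\tfrac1\hbar\sinh(\hbar\xi)\bigr)$, and let $$\tau_\hbar=F^{-1}\circ(\phi_\hbar^{-1})^\star\circ F:\mathcal S(\mathfrak r)\to\mathcal S'(\mathfrak r),\qquad \mathcal E_\hbar=\tau_\hbar(\mathcal S(\mathfrak r)).$$ The Weyl product of $f,g\in\mathcal S(\mathfrak r)$ is $(f\star^W_\hbar g)(p_0)=\hbar^{-\dim\mathfrak r}\int_{\mathfrak r\times\mathfrak r}e^{\frac{2i}{\hbar}S^0(p_0,p_1,p_2)}f(p_1)g(p_2)\,dp_1dp_2$.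 Then the Weyl integral converges absolutely and defines a bilinear product on $\mathcal S(\mathfrak r)$; $\tau_\hbar$ is injective; $\mathcal S(\mathfrak r)\subset\mathcal E_\hbar$; the inverse $T_\hbar:\mathcal E_\hbar\to\mathcal S(\mathfrak r)$ of $\tau_\hbar$ is given on $\mathcal S(\mathfrak r)$ by $F^{-1}\circ\phi_\hbar^\star\circ F$; and: (i) The formula $a\star_\hbar b=\tau_\hbar(T_\hbar a\star^W_\hbar T_\hbar b)$ defines an associative (complex) algebra structure on $\mathcal E_\hbar$. (ii) For $u,v\in\mathcal S(\mathfrak r)$ the distribution $u\star_\hbar v$ is the bounded continuous function $$(u\star_\hbar v)(p_0)=\frac1{\hbar^{\dim\mathfrak r}}\int_{\mathfrak r\times\mathfrak r}\cosh(2(a_1-a_2))\,\bigl[\cosh(a_2-a_0)\cosh(a_0-a_1)\bigr]^{\dim\mathfrak r-2}\,e^{\frac{2i}\hbar S(p_0,p_1,p_2)}\,u(p_1)\,v(p_2)\,dp_1\,dp_2,$$ where $p_i=(a_i,x_i,z_i)$ and $$S(p_0,p_1,p_2)=S^0\bigl(\cosh(a_1-a_2)x_0,\cosh(a_2-a_0)x_1,\cosh(a_0-a_1)x_2\bigr)-\frac12\oint_{0,1,2}\Omega\bigl(\sinh(2(a_0-a_1))A,\,z_2E\bigr),$$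 i.e. the last term is $-\oint_{0,1,2}\sinh(2(a_0-a_1))z_2$, with $\oint_{0,1,2}$ the cyclic sum. The integral is understood as an iterated integral: the integral over $(z_1,z_2)$ converges absolutely, and its value is absolutely integrable over $(a_1,x_1,a_2,x_2)$. If $u$ and $v$ have compact support, the integral over $\mathfrak r\times\mathfrak r$ converges absolutely. (iii) The Iwasawa coordinates $(a,x,z)\mapsto\exp(aA)\exp(x+zE)$ are a bijection of $\mathfrak r$ onto $R$, in which the group multiplication reads $$L_{(a,x,z)}(a',x',z')=\Bigl(a+a',\;e^{-a'}x+x',\;e^{-2a'}z+z'+\tfrac12\Omega(x,x')e^{-a'}\Bigr),$$ and both the phase $S$ and the amplitude $\cosh(2(a_1-a_2))[\cosh(a_2-a_0)\cosh(a_0-a_1)]^{\dim\mathfrak r-2}$ are invariant under $p_i\mapsto L_gp_i$ ($i=0,1,2$), for every $g$. -/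

import Mathlib

open Matrix MeasureTheory Complex
open scoped SchwartzMap

attribute [local instance] LieRing.ofAssociativeRing Matrix.normedAddCommGroup Matrix.normedSpace

namespace ANQuant

/-! ### The Lie algebra `su(1,n)` and its Iwasawa decompositions -/

/-- Complex matrices of size `n + 1`. -/
abbrev Mat (n : ℕ) := Matrix (Fin (n + 1)) (Fin (n + 1)) ℂ

/-- The Hermitian form `diag(1, -1, …, -1)`. -/
def hermJ (n : ℕ) : Mat n := Matrix.diagonal (Fin.cons 1 (fun _ => -1))

/-- The real Lie algebra `su(1,n)`. -/
def su (n : ℕ) : LieSubalgebra ℝ (Mat n) where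
  carrier := {X | Xᴴ * hermJ n + hermJ n * X = 0 ∧ X.trace = 0}
  add_mem' := by
    rintro X Y ⟨hX, hX'⟩ ⟨hY, hY'⟩
    refine ⟨?_, by simp [hX', hY']⟩
    rw [conjTranspose_add, add_mul, mul_add, add_add_add_comm, hX, hY, add_zero]
  zero_mem' := by simp
  smul_mem' := by
    rintro c X ⟨hX, hX'⟩
    refine ⟨?_, by simp [trace_smul, hX']⟩
    rw [conjTranspose_smul, star_trivial, smul_mul_assoc, mul_smul_comm, ← smul_add, hX, smul_zero]
  lie_mem' := by
    rintro X Y ⟨hX, hX'⟩ ⟨hY, hY'⟩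
    refine ⟨?_, ?_⟩
    · have hX1 := eq_neg_of_add_eq_zero_left hX
      have hY1 := eq_neg_of_add_eq_zero_left hY
      rw [Ring.lie_def, conjTranspose_sub, conjTranspose_mul, conjTranspose_mul, sub_mul,
        Matrix.mul_assoc, Matrix.mul_assoc, hX1, hY1]
      rw [mul_neg, mul_neg, ← Matrix.mul_assoc, ← Matrix.mul_assoc, hX1, hY1]
      noncomm_ring
    · rw [Ring.lie_def, trace_sub, Matrix.trace_mul_comm, sub_self]

/-- The group `SU(1,n)`. -/
def SU (n : ℕ) : Subgroup (GL (Fin (n + 1)) ℂ) where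
  carrier := {g | (g : Mat n)ᴴ * hermJ n * (g : Mat n) = hermJ n ∧ (g : Mat n).det = 1}
  one_mem' := by simp
  mul_mem' := by
    rintro g h ⟨hg, hg'⟩ ⟨hh, hh'⟩
    refine ⟨?_, by simp [hg', hh']⟩
    calc _ = (h : Mat n)ᴴ * ((g : Mat n)ᴴ * hermJ n * (g : Mat n)) * (h : Mat n) := by
          simp [Matrix.mul_assoc]
      _ = _ := by rw [hg, hh]
  inv_mem' := by
    rintro g ⟨hg, hg'⟩
    have h1 : (g : Mat n) * ((g⁻¹ : GL (Fin (n + 1)) ℂ) : Mat n) = 1 := by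
      rw [← Units.val_mul, mul_inv_cancel, Units.val_one]
    have h2 : ((g⁻¹ : GL (Fin (n + 1)) ℂ) : Mat n)ᴴ * (g : Mat n)ᴴ = 1 := by
      rw [← conjTranspose_mul, h1, conjTranspose_one]
    refine ⟨?_, ?_⟩
    · calc _ = ((g⁻¹ : GL (Fin (n + 1)) ℂ) : Mat n)ᴴ *
            ((g : Mat n)ᴴ * hermJ n * (g : Mat n)) * ((g⁻¹ : GL (Fin (n + 1)) ℂ) : Mat n) := by
            rw [hg]
        _ = (((g⁻¹ : GL (Fin (n + 1)) ℂ) : Mat n)ᴴ * (g : Mat n)ᴴ) * hermJ n *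
            ((g : Mat n) * ((g⁻¹ : GL (Fin (n + 1)) ℂ) : Mat n)) := by
            simp only [Matrix.mul_assoc]
        _ = _ := by rw [h1, h2, one_mul, mul_one]
    · have := congrArg Matrix.det h1
      rwa [det_mul, hg', one_mul, det_one] at this

/-- The Cartan involutions of `su(1,n)`: the standard one `X ↦ -Xᴴ` and its conjugates under
`SU(1,n)`. -/
def IsCartanInvolution {n : ℕ} (σ : su n →ₗ⁅ℝ⁆ su n) : Prop :=
  ∃ g ∈ SU n, ∀ X : su n, (σ X : Mat n) =
    -((g : Mat n) * (((g⁻¹ : GL (Fin (n + 1)) ℂ) : Mat n) * (X : Mat n) * (g : Mat n))ᴴ *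
      ((g⁻¹ : GL (Fin (n + 1)) ℂ) : Mat n))

/-- The space `{X | [H, X] = β(H) X for all H ∈ 𝔞}` of weight `β`. -/
def weightSpace {n : ℕ} (𝔞 : Submodule ℝ (su n)) (β : 𝔞 →ₗ[ℝ] ℝ) : Submodule ℝ (su n) where
  carrier := {X | ∀ H : 𝔞, ⁅(H : su n), X⁆ = β H • X}
  add_mem' := by
    intro X Y hX hY H
    rw [lie_add, hX, hY, smul_add]
  zero_mem' := by
    intro H
    simp
  smul_mem' := by
    intro c X hX H
    rw [lie_smul, hX, smul_comm]

/-- The choices that define an Iwasawa subgroup `AN` of `SU(1,n)` with its symplectic structure: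
a Cartan involution `σ` with decomposition `su(1,n) = 𝔨 ⊕ 𝔭`, a maximal abelian subspace `𝔞` of
`𝔭`, the positive root `α` such that `2α` is a root as well, the element `A` of `𝔞` with
`α(A) = 1`, and a central element `Z` of `𝔨` such that `J = ad(Z)|_𝔭` is a complex structure. -/
structure IwasawaData (n : ℕ) where
  σ : su n →ₗ⁅ℝ⁆ su n
  cartan : IsCartanInvolution σ
  𝔞 : Submodule ℝ (su n)
  a_le_p : ∀ X ∈ 𝔞, σ X = -X
  a_abelian : ∀ X ∈ 𝔞, ∀ Y ∈ 𝔞, ⁅X, Y⁆ = 0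
  a_maximal : ∀ X : su n, σ X = -X → (∀ Y ∈ 𝔞, ⁅X, Y⁆ = 0) → X ∈ 𝔞
  α : 𝔞 →ₗ[ℝ] ℝ
  root_α : weightSpace 𝔞 α ≠ ⊥
  root_two_α : weightSpace 𝔞 ((2 : ℝ) • α) ≠ ⊥
  A : 𝔞
  α_A : α A = 1
  Z : su n
  Z_mem_k : σ Z = Z
  Z_central : ∀ X : su n, σ X = X → ⁅Z, X⁆ = 0
  Z_complex : ∀ X : su n, σ X = -X → ⁅Z, ⁅Z, X⁆⁆ = -X

namespace IwasawaData

variable {n : ℕ} (D : IwasawaData n)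

/-- The root space `𝔤_α`, as a type. -/
def gα : Type := weightSpace D.𝔞 D.α

noncomputable instance : AddCommGroup D.gα := inferInstanceAs (AddCommGroup (weightSpace D.𝔞 D.α))

noncomputable instance : Module ℝ D.gα := inferInstanceAs (Module ℝ (weightSpace D.𝔞 D.α))

/-- The inclusion of `𝔤_α`. -/
noncomputable def incl : D.gα →ₗ[ℝ] su n := (weightSpace D.𝔞 D.α).subtype

/-- The inclusion of `𝔤_α` in the space of matrices. -/
noncomputable def inclMat : D.gα →ₗ[ℝ] Mat n := (su n).toSubmodule.subtype ∘ₗ D.incl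

theorem inclMat_injective : Function.Injective D.inclMat :=
  (Subtype.val_injective (p := fun X => X ∈ su n)).comp
    (Subtype.val_injective (p := fun X => X ∈ weightSpace D.𝔞 D.α))

/-! The norm of `𝔤_α` (all norms are equivalent) and its Borel sets. -/

noncomputable instance : NormedAddCommGroup D.gα :=
  NormedAddCommGroup.induced D.gα (Mat n) D.inclMat D.inclMat_injective

noncomputable instance : NormedSpace ℝ D.gα := NormedSpace.induced ℝ D.gα (Mat n) D.inclMat

instance : FiniteDimensional ℝ D.gα := FiniteDimensional.of_injective D.inclMat D.inclMat_injective

noncomputable instance : MeasurableSpace D.gα := borel _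

instance : BorelSpace D.gα := ⟨rfl⟩

/-- The nilpotent factor `𝔫`, the sum of the positive root spaces. -/
noncomputable def 𝔫 : Submodule ℝ (su n) := ⨆ t : {t : ℝ // 0 < t}, weightSpace D.𝔞 ((t : ℝ) • D.α)

/-- The two-form `Ω(X, Y) = B(Z, [X, Y])`, where `B` is the Killing form; on `𝔭` it is
`B(JX, Y)`, and it vanishes on `𝔨 × 𝔤`. -/
noncomputable def Ω (X Y : su n) : ℝ := killingForm ℝ (su n) D.Z ⁅X, Y⁆

/-- The restriction of `Ω` to `𝔤_α`. -/
noncomputable def ω (x y : D.gα) : ℝ := D.Ω (D.incl x) (D.incl y)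

/-- `E` is an element of `𝔤_{2α}` such that the bracket of `𝔫` reads `[x, y] = Ω(x, y) E`. -/
def IsGenerator (E : su n) : Prop :=
  E ∈ weightSpace D.𝔞 ((2 : ℝ) • D.α) ∧ ∀ x ∈ D.𝔫, ∀ y ∈ D.𝔫, ⁅x, y⁆ = D.Ω x y • E

end IwasawaData

/-- The coordinates `(a, x, z)` of a point `a A + x + z E` of `𝔯 = 𝔞 ⊕ 𝔤_α ⊕ ℝ E`; here `V`
stands for `𝔤_α`. -/
abbrev Coord (V : Type) := ℝ × V × ℝ

/-- The exponential of a matrix of `su(1,n)`. -/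
noncomputable def expGL {n : ℕ} (X : su n) : GL (Fin (n + 1)) ℂ :=
  (Matrix.isUnit_exp (X : Mat n)).unit

namespace IwasawaData

variable {n : ℕ} (D : IwasawaData n)

/-- The vector `a A + x + z E` with coordinates `(a, x, z)`. -/
noncomputable def vec (E : su n) (p : Coord D.gα) : su n := p.1 • (D.A : su n) + D.incl p.2.1 + p.2.2 • E

/-- The Iwasawa coordinates `(a, x, z) ↦ exp(a A) exp(x + z E)`. -/
noncomputable def iw (E : su n) (p : Coord D.gα) : GL (Fin (n + 1)) ℂ :=
  expGL (p.1 • (D.A : su n)) * expGL (D.incl p.2.1 + p.2.2 • E)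

/-- The group `R = AN`, generated by the connected subgroups `A` and `N` with Lie algebras `𝔞`
and `𝔫`. -/
noncomputable def R : Subgroup (GL (Fin (n + 1)) ℂ) :=
  Subgroup.closure (expGL '' (D.𝔞 : Set (su n))) ⊔ Subgroup.closure (expGL '' (D.𝔫 : Set (su n)))

end IwasawaData

/-! ### The partial Fourier transform -/

/-- `Ω(ξ A, z E) = 2 ξ z`. -/
def pairAE (ξ z : ℝ) : ℝ := 2 * ξ * z

section PartialFourier

variable {V : Type} [NormedAddCommGroup V] [NormedSpace ℝ V]
variable {G : Type} [NormedAddCommGroup G] [NormedSpace ℂ G]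

/-- `(a, x, ξ) ↦ ∫ exp (-i Ω(ξ A, z E)) f(a, x, z) dz`. -/
noncomputable def partialFourierFun (f : Coord V → G) (q : Coord V) : G :=
  ∫ z : ℝ, cexp (-(I * (pairAE q.2.2 z : ℂ))) • f (q.1, q.2.1, z)

theorem norm_pf_kernel (ξ z : ℝ) : ‖cexp (-(I * (pairAE ξ z : ℂ)))‖ = 1 := by
  rw [show -(I * (pairAE ξ z : ℂ)) = ((-pairAE ξ z : ℝ) : ℂ) * I by push_cast; ring]
  exact norm_exp_ofReal_mul_I _

theorem schwartz_slice_bound (u : 𝓢(Coord V, G)) (k : ℕ) (q : Coord V) (z : ℝ) :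
    ‖((q.1, q.2.1, (0 : ℝ)) : Coord V)‖ ^ k * ‖u (q.1, q.2.1, z)‖ ≤
      (SchwartzMap.seminorm ℂ k 0 u + SchwartzMap.seminorm ℂ (k + 2) 0 u) * (1 + z ^ 2)⁻¹ := by
  have h1 := SchwartzMap.norm_pow_mul_le_seminorm ℂ u k (q.1, q.2.1, z)
  have h2 := SchwartzMap.norm_pow_mul_le_seminorm ℂ u (k + 2) (q.1, q.2.1, z)
  have hz : |z| ≤ ‖((q.1, q.2.1, z) : Coord V)‖ := by
    simp [Prod.norm_def]
  have hq : ‖((q.1, q.2.1, (0 : ℝ)) : Coord V)‖ ≤ ‖((q.1, q.2.1, z) : Coord V)‖ := by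
    simp only [Prod.norm_def, norm_zero]
    gcongr
    exact norm_nonneg _
  have hz2 : z ^ 2 ≤ ‖((q.1, q.2.1, z) : Coord V)‖ ^ 2 := by
    rw [← sq_abs]; gcongr
  rw [← div_eq_mul_inv, le_div_iff₀ (by positivity)]
  calc _ ≤ ‖((q.1, q.2.1, z) : Coord V)‖ ^ k * ‖u (q.1, q.2.1, z)‖ *
        (1 + ‖((q.1, q.2.1, z) : Coord V)‖ ^ 2) := by gcongr
    _ = ‖((q.1, q.2.1, z) : Coord V)‖ ^ k * ‖u (q.1, q.2.1, z)‖ +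
        ‖((q.1, q.2.1, z) : Coord V)‖ ^ (k + 2) * ‖u (q.1, q.2.1, z)‖ := by ring
    _ ≤ _ := add_le_add h1 h2

theorem schwartz_slice_norm_le (u : 𝓢(Coord V, G)) (q : Coord V) (z : ℝ) :
    ‖u (q.1, q.2.1, z)‖ ≤
      (SchwartzMap.seminorm ℂ 0 0 u + SchwartzMap.seminorm ℂ 2 0 u) * (1 + z ^ 2)⁻¹ := by
  simpa using schwartz_slice_bound u 0 q z

theorem pf_integrable (u : 𝓢(Coord V, G)) (q : Coord V) :
    Integrable (fun z : ℝ => cexp (-(I * (pairAE q.2.2 z : ℂ))) • u (q.1, q.2.1, z)) := by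
  refine (integrable_inv_one_add_sq.const_mul
    (SchwartzMap.seminorm ℂ 0 0 u + SchwartzMap.seminorm ℂ 2 0 u)).mono' ?_ ?_
  · have := u.continuous
    refine Continuous.aestronglyMeasurable ?_
    unfold pairAE
    fun_prop
  · refine Filter.Eventually.of_forall fun z => ?_
    rw [norm_smul, norm_pf_kernel, one_mul]
    exact schwartz_slice_norm_le u q z

theorem pf_bound_zero (u : 𝓢(Coord V, G)) (k : ℕ) (q : Coord V) :
    ‖((q.1, q.2.1, (0 : ℝ)) : Coord V)‖ ^ k * ‖partialFourierFun u q‖ ≤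
      (SchwartzMap.seminorm ℂ k 0 u + SchwartzMap.seminorm ℂ (k + 2) 0 u) * Real.pi := by
  rw [← integral_univ_inv_one_add_sq, ← integral_const_mul,
    ← Real.norm_of_nonneg (pow_nonneg (norm_nonneg ((q.1, q.2.1, (0 : ℝ)) : Coord V)) k),
    ← norm_smul, partialFourierFun, ← integral_smul]
  refine norm_integral_le_of_norm_le (integrable_inv_one_add_sq.const_mul _) ?_
  refine Filter.Eventually.of_forall fun z => ?_
  rw [norm_smul, norm_smul, norm_pf_kernel, one_mul, norm_pow, norm_norm]
  exact schwartz_slice_bound u k q z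

/-- The partial derivative in the last variable. -/
noncomputable def zDeriv : 𝓢(Coord V, G) →L[ℂ] 𝓢(Coord V, G) :=
  (SchwartzMap.evalCLM ℂ (Coord V) G ((0, 0, 1) : Coord V)) ∘L
    (SchwartzMap.fderivCLM ℂ (Coord V) G)

theorem pf_zDeriv (u : 𝓢(Coord V, G)) (q : Coord V) :
    partialFourierFun (zDeriv u) q = (2 * q.2.2 * I : ℂ) • partialFourierFun u q := by
  have hv : ∀ z : ℝ, HasDerivAt (fun z : ℝ => u (q.1, q.2.1, z)) (zDeriv u (q.1, q.2.1, z)) z := by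
    intro z
    have h1 : HasDerivAt (fun z : ℝ => ((q.1, q.2.1, z) : Coord V)) (0, 0, 1) z :=
      (hasDerivAt_const z q.1).prodMk ((hasDerivAt_const z q.2.1).prodMk (hasDerivAt_id z))
    exact (u.hasFDerivAt (q.1, q.2.1, z)).comp_hasDerivAt z h1
  have hu : ∀ z : ℝ, HasDerivAt (fun z : ℝ => cexp (-(I * (pairAE q.2.2 z : ℂ))))
      (-(2 * q.2.2 * I) * cexp (-(I * (pairAE q.2.2 z : ℂ)))) z := by
    intro z
    have h1 : HasDerivAt (fun z : ℝ => -(I * (pairAE q.2.2 z : ℂ))) (-(2 * q.2.2 * I)) z := by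
      have := ((hasDerivAt_id z).ofReal_comp).const_mul (-(2 * q.2.2 * I) : ℂ)
      refine (this.congr_deriv (by simp)).congr_of_eventuallyEq ?_
      refine Filter.Eventually.of_forall fun y => ?_
      simp only [pairAE, id]
      push_cast
      ring
    have := h1.cexp
    rwa [mul_comm] at this
  have key := integral_bilinear_hasDerivAt_right_eq_neg_left_of_integrable
    (L := ContinuousLinearMap.lsmul ℝ ℂ (E := G))
    (fun z _ => hu z) (fun z _ => hv z) (by simpa using pf_integrable (zDeriv u) q)
    (by
      have := (pf_integrable u q).smul (-(2 * q.2.2 * I) : ℂ)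
      simpa [Pi.smul_def, smul_smul] using this)
    (by simpa using pf_integrable u q)
  simp only [ContinuousLinearMap.lsmul_apply] at key
  rw [partialFourierFun, key, partialFourierFun, ← integral_smul, ← integral_neg]
  congr 1
  ext z
  rw [smul_smul, ← neg_smul]
  congr 1
  ring

theorem pf_zDeriv_iter (k : ℕ) (u : 𝓢(Coord V, G)) (q : Coord V) :
    |q.2.2| ^ k * ‖partialFourierFun u q‖ ≤ ‖partialFourierFun ((zDeriv^[k]) u) q‖ := by
  induction k generalizing u with
  | zero => simp
  | succ k ih =>
    rw [Function.iterate_succ_apply]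
    refine le_trans ?_ (ih (zDeriv u))
    rw [pf_zDeriv, norm_smul]
    have : ‖(2 * q.2.2 * I : ℂ)‖ = 2 * |q.2.2| := by simp
    rw [this, pow_succ]
    have h : 0 ≤ |q.2.2| ^ k * (|q.2.2| * ‖partialFourierFun u q‖) := by positivity
    nlinarith

/-- `q ↦ (q.1, q.2.1, 0)` as a continuous linear map. -/
def flatCLM : Coord V →L[ℝ] Coord V :=
  (ContinuousLinearMap.fst ℝ ℝ (V × ℝ)).prod
    (((ContinuousLinearMap.fst ℝ V ℝ).comp (ContinuousLinearMap.snd ℝ ℝ (V × ℝ))).prod 0)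

/-- The last coordinate as a continuous linear form. -/
def zCLM : Coord V →L[ℝ] ℝ :=
  (ContinuousLinearMap.snd ℝ V ℝ).comp (ContinuousLinearMap.snd ℝ ℝ (V × ℝ))

/-- `B ↦ B ∘ flatCLM`. -/
noncomputable def precompFlat :
    (Coord V →L[ℝ] G) →L[ℂ] (Coord V →L[ℝ] G) :=
  LinearMap.mkContinuous
    { toFun := fun B => B.comp flatCLM
      map_add' := fun B C => by ext <;> simp
      map_smul' := fun c B => by ext <;> simp } ‖(flatCLM : Coord V →L[ℝ] Coord V)‖
    (fun B => by
      rw [mul_comm]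
      exact ContinuousLinearMap.opNorm_comp_le B flatCLM)

/-- The Schwartz function whose partial Fourier transform is the derivative of that of `u`. -/
noncomputable def pfDeriv : 𝓢(Coord V, G) →L[ℂ] 𝓢(Coord V, Coord V →L[ℝ] G) :=
  (SchwartzMap.postcompCLM precompFlat) ∘L (SchwartzMap.fderivCLM ℂ (Coord V) G) +
    (-(2 * I) : ℂ) • SchwartzMap.smulRightCLM ℂ G ((zCLM : Coord V →L[ℝ] ℝ).smulRight zCLM)

theorem pf_hasFDerivAt (u : 𝓢(Coord V, G)) (q : Coord V) :
    HasFDerivAt (partialFourierFun u) (partialFourierFun (pfDeriv u) q) q := by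
  refine hasFDerivAt_integral_of_dominated_of_fderiv_le (𝕜 := ℝ)
    (bound := fun z => (SchwartzMap.seminorm ℂ 0 0 (pfDeriv u) +
      SchwartzMap.seminorm ℂ 2 0 (pfDeriv u)) * (1 + z ^ 2)⁻¹)
    (F' := fun q z => cexp (-(I * (pairAE q.2.2 z : ℂ))) • pfDeriv u (q.1, q.2.1, z))
    Filter.univ_mem ?_ (pf_integrable u q) (pf_integrable (pfDeriv u) q).aestronglyMeasurable ?_
    (integrable_inv_one_add_sq.const_mul _) ?_
  · exact Filter.Eventually.of_forall fun q => (pf_integrable u q).aestronglyMeasurable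
  · refine Filter.Eventually.of_forall fun z q _ => ?_
    rw [norm_smul, norm_pf_kernel, one_mul]
    exact schwartz_slice_norm_le _ q z
  · refine Filter.Eventually.of_forall fun z q _ => ?_
    have h1 : HasFDerivAt (fun q : Coord V => ((q.1, q.2.1, z) : Coord V)) flatCLM q := by
      have := (flatCLM : Coord V →L[ℝ] Coord V).hasFDerivAt (x := q) |>.add_const (0, 0, z)
      refine this.congr_of_eventuallyEq (Filter.Eventually.of_forall fun p => ?_)
      simp [flatCLM]
    have h2 := (u.hasFDerivAt (q.1, q.2.1, z)).comp q h1
    have h3 : HasFDerivAt (fun q : Coord V => -(I * (pairAE q.2.2 z : ℂ)))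
        ((zCLM : Coord V →L[ℝ] ℝ).smulRight (-(2 * I * z) : ℂ)) q := by
      have := ((zCLM : Coord V →L[ℝ] ℝ).smulRight (-(2 * I * z) : ℂ)).hasFDerivAt (x := q)
      refine this.congr_of_eventuallyEq (Filter.Eventually.of_forall fun p => ?_)
      simp [zCLM, pairAE]
      ring
    refine (h3.cexp.smul h2).congr_fderiv ?_
    ext h
    all_goals
      simp [pfDeriv, precompFlat, zCLM, flatCLM, smul_smul]
      try module

theorem pf_contDiff (n : ℕ) : ∀ (G : Type) [NormedAddCommGroup G] [NormedSpace ℂ G]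
    (u : 𝓢(Coord V, G)), ContDiff ℝ n (partialFourierFun u) := by
  induction n with
  | zero =>
    intro G _ _ u
    exact contDiff_zero.2
      (Differentiable.continuous (𝕜 := ℝ) fun q => (pf_hasFDerivAt u q).differentiableAt)
  | succ n ih =>
    intro G _ _ u
    push_cast
    rw [contDiff_succ_iff_fderiv]
    refine ⟨fun q => (pf_hasFDerivAt u q).differentiableAt, by simp, ?_⟩
    have : fderiv ℝ (partialFourierFun u) = partialFourierFun (pfDeriv u) :=
      funext fun q => (pf_hasFDerivAt u q).fderiv
    rw [this]
    exact ih _ (pfDeriv u)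

theorem pf_decay (n k : ℕ) : ∀ (G : Type) [NormedAddCommGroup G] [NormedSpace ℂ G],
    ∃ p : Seminorm ℂ 𝓢(Coord V, G), Continuous p ∧ ∀ (u : 𝓢(Coord V, G)) (q : Coord V),
      ‖q‖ ^ k * ‖iteratedFDeriv ℝ n (partialFourierFun u) q‖ ≤ p u := by
  induction n with
  | zero =>
    intro G _ _
    have hc : ∀ m : ℕ, Continuous (SchwartzMap.seminorm ℂ m 0 : Seminorm ℂ 𝓢(Coord V, G)) :=
      fun m => (schwartz_withSeminorms ℂ (Coord V) G).continuous_seminorm (m, 0)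
    let b : ℕ → Seminorm ℂ 𝓢(Coord V, G) := fun k =>
      Real.pi.toNNReal • (SchwartzMap.seminorm ℂ k 0 + SchwartzMap.seminorm ℂ (k + 2) 0)
    have hb : ∀ k u, b k u =
        (SchwartzMap.seminorm ℂ k 0 u + SchwartzMap.seminorm ℂ (k + 2) 0 u) * Real.pi := by
      intro k u
      simp [b, NNReal.smul_def, Real.pi_pos.le]
      ring
    have hbc : ∀ k, Continuous (b k) := by
      intro k
      have : (b k : 𝓢(Coord V, G) → ℝ) = fun u =>
        (SchwartzMap.seminorm ℂ k 0 u + SchwartzMap.seminorm ℂ (k + 2) 0 u) * Real.pi :=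
        funext (hb k)
      rw [this]
      exact ((hc k).add (hc (k + 2))).mul continuous_const
    refine ⟨b k + (b 0).comp ((zDeriv ^ k : 𝓢(Coord V, G) →L[ℂ] 𝓢(Coord V, G)) :
      𝓢(Coord V, G) →ₗ[ℂ] 𝓢(Coord V, G)), ?_, ?_⟩
    · exact (hbc k).add ((hbc 0).comp (zDeriv ^ k : 𝓢(Coord V, G) →L[ℂ] 𝓢(Coord V, G)).continuous)
    · intro u q
      rw [norm_iteratedFDeriv_zero]
      have h1 := pf_bound_zero u k q
      have h2 := (pf_zDeriv_iter k u q).trans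
        (by simpa using pf_bound_zero (zDeriv^[k] u) 0 q)
      rw [← hb] at h1
      have h3 : ‖q‖ ^ k ≤ ‖((q.1, q.2.1, (0 : ℝ)) : Coord V)‖ ^ k + |q.2.2| ^ k := by
        have : ‖q‖ = max ‖((q.1, q.2.1, (0 : ℝ)) : Coord V)‖ |q.2.2| := by
          simp [Prod.norm_def, max_assoc]
        rw [this]
        rcases max_cases ‖((q.1, q.2.1, (0 : ℝ)) : Coord V)‖ |q.2.2| with ⟨h, _⟩ | ⟨h, _⟩ <;>
          rw [h] <;> simp
      refine (mul_le_mul_of_nonneg_right h3 (norm_nonneg _)).trans ?_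
      rw [add_mul]
      refine add_le_add h1 (h2.trans (le_of_eq ?_))
      rw [Seminorm.comp_apply, hb]
      simp [Module.End.pow_apply]
  | succ n ih =>
    intro G _ _
    obtain ⟨p, hp, h⟩ := ih (Coord V →L[ℝ] G)
    refine ⟨p.comp ((pfDeriv : 𝓢(Coord V, G) →L[ℂ] 𝓢(Coord V, Coord V →L[ℝ] G)) :
      𝓢(Coord V, G) →ₗ[ℂ] 𝓢(Coord V, Coord V →L[ℝ] G)),
      hp.comp (pfDeriv : 𝓢(Coord V, G) →L[ℂ] 𝓢(Coord V, Coord V →L[ℝ] G)).continuous, ?_⟩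
    intro u q
    have : fderiv ℝ (partialFourierFun u) = partialFourierFun (pfDeriv u) :=
      funext fun q => (pf_hasFDerivAt u q).fderiv
    rw [← norm_iteratedFDeriv_fderiv, this]
    exact h _ q

/-- The partial Fourier transform
`(F u)(a, x, ξ) = ∫ exp (-i Ω(ξ A, z E)) u(a, x, z) dz` on Schwartz functions. -/
noncomputable def partialFourier : 𝓢(Coord V, ℂ) →L[ℂ] 𝓢(Coord V, ℂ) :=
  SchwartzMap.mkCLM (fun f => partialFourierFun f)
    (fun f g q => by
      simp only [partialFourierFun]
      rw [← integral_add (pf_integrable f q) (pf_integrable g q)]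
      simp [mul_add])
    (fun c f q => by
      simp only [partialFourierFun]
      rw [RingHom.id_apply, ← integral_smul]
      congr 1; ext z
      simp; ring)
    (fun f => contDiff_infty.2 fun n => pf_contDiff n ℂ f)
    (fun m => by
      obtain ⟨p, hp, h⟩ := pf_decay (V := V) m.2 m.1 ℂ
      obtain ⟨s, C, _, hC⟩ :=
        Seminorm.bound_of_continuous (schwartz_withSeminorms ℂ (Coord V) ℂ) p hp
      exact ⟨s, C, C.2, fun f x => (h f x).trans (hC f)⟩)

theorem partialFourier_apply (f : 𝓢(Coord V, ℂ)) (q : Coord V) :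
    partialFourier f q = ∫ z : ℝ, cexp (-(I * (pairAE q.2.2 z : ℂ))) * f (q.1, q.2.1, z) := rfl

/-- `(a, x, ξ) ↦ (a, x, -ξ)`. -/
def negLast : Coord V ≃L[ℝ] Coord V :=
  (ContinuousLinearEquiv.refl ℝ ℝ).prodCongr
    ((ContinuousLinearEquiv.refl ℝ V).prodCongr (ContinuousLinearEquiv.neg ℝ))

/-- The inverse partial Fourier transform; since `Ω(ξ A, z E) = 2 ξ z`, its normalization is
`2 / (2 π) = 1 / π`. -/
noncomputable def partialFourierInv : 𝓢(Coord V, ℂ) →L[ℂ] 𝓢(Coord V, ℂ) :=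
  (Real.pi⁻¹ : ℂ) • (SchwartzMap.compCLMOfContinuousLinearEquiv ℂ negLast ∘L partialFourier)

theorem partialFourierInv_apply (f : 𝓢(Coord V, ℂ)) (q : Coord V) :
    partialFourierInv f q =
      (Real.pi⁻¹ : ℂ) * ∫ ξ : ℝ, cexp (I * (pairAE ξ q.2.2 : ℂ)) * f (q.1, q.2.1, ξ) := by
  have : partialFourierInv f q = (Real.pi⁻¹ : ℂ) * partialFourier f (q.1, q.2.1, -q.2.2) := rfl
  rw [this, partialFourier_apply]
  congr 3
  ext ξ
  simp only [pairAE]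
  congr 2
  push_cast
  ring

end PartialFourier

noncomputable section

variable {V : Type} [NormedAddCommGroup V] [NormedSpace ℝ V]

/-! ### The map `τ_ħ` and the space `𝓔_ħ` -/

/-- `φ_ħ(a, x, ξ) = (a, x / cosh (ħ ξ / 2), sinh (ħ ξ) / ħ)`. -/
def phi (ħ : ℝ) (q : Coord V) : Coord V :=
  (q.1, (Real.cosh (ħ / 2 * q.2.2))⁻¹ • q.2.1, ħ⁻¹ * Real.sinh (ħ * q.2.2))

/-- The inverse diffeomorphism of `φ_ħ` (see `phiInv_phi` and `phi_phiInv`). -/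
def phiInv (ħ : ℝ) (q : Coord V) : Coord V :=
  (q.1, Real.cosh (Real.arsinh (ħ * q.2.2) / 2) • q.2.1, ħ⁻¹ * Real.arsinh (ħ * q.2.2))

theorem phiInv_phi {ħ : ℝ} (hħ : ħ ≠ 0) (q : Coord V) : phiInv ħ (phi ħ q) = q := by
  obtain ⟨a, x, ξ⟩ := q
  have h1 : ħ * (ħ⁻¹ * Real.sinh (ħ * ξ)) = Real.sinh (ħ * ξ) := by field_simp
  have h2 : ħ * ξ / 2 = ħ / 2 * ξ := by ring
  have h3 : ħ⁻¹ * (ħ * ξ) = ξ := by field_simp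
  simp only [phiInv, phi, h1, Real.arsinh_sinh, h2, h3, smul_smul,
    mul_inv_cancel₀ (Real.cosh_pos _).ne', one_smul]

theorem phi_phiInv {ħ : ℝ} (hħ : ħ ≠ 0) (q : Coord V) : phi ħ (phiInv ħ q) = q := by
  obtain ⟨a, x, ξ⟩ := q
  have h1 : ħ * (ħ⁻¹ * Real.arsinh (ħ * ξ)) = Real.arsinh (ħ * ξ) := by field_simp
  have h2 : ħ / 2 * (ħ⁻¹ * Real.arsinh (ħ * ξ)) = Real.arsinh (ħ * ξ) / 2 := by field_simp
  have h3 : ħ⁻¹ * (ħ * ξ) = ξ := by field_simp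
  simp only [phiInv, phi, h1, Real.sinh_arsinh, h2, h3, smul_smul,
    inv_mul_cancel₀ (Real.cosh_pos _).ne', one_smul]

theorem phiInv_continuous (ħ : ℝ) : Continuous (phiInv ħ : Coord V → Coord V) := by
  have h := Real.continuous_arsinh
  have h1 : Continuous fun q : Coord V => Real.arsinh (ħ * q.2.2) :=
    h.comp (continuous_const.mul continuous_snd.snd)
  exact continuous_fst.prodMk (((Real.continuous_cosh.comp (h1.div_const 2)).smul
    continuous_snd.fst).prodMk (continuous_const.mul h1))

/-- The map `T_ħ = F⁻¹ ∘ φ_ħ^* ∘ F` on Schwartz functions, pointwise. -/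
def transportFun (ħ : ℝ) (u : 𝓢(Coord V, ℂ)) (p : Coord V) : ℂ :=
  (Real.pi⁻¹ : ℂ) * ∫ ξ : ℝ, cexp (I * (pairAE ξ p.2.2 : ℂ)) *
    partialFourier u (phi ħ (p.1, p.2.1, ξ))

section Measure

variable [MeasurableSpace V]

/-- The measure `da dx dz` on `𝔯`, for a given Haar measure `dx` on `𝔤_α`. -/
def coordMeasure (μ : Measure V) : Measure (Coord V) := volume.prod (μ.prod volume)

variable [FiniteDimensional ℝ V] [BorelSpace V] (μ : Measure V) [μ.IsAddHaarMeasure]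

instance : (coordMeasure μ).IsAddHaarMeasure := Measure.prod.instIsAddHaarMeasure _ _

theorem pullback_integrable (ħ : ℝ) (f ψ : 𝓢(Coord V, ℂ)) :
    Integrable (fun q => ψ q * f (phiInv ħ q)) (coordMeasure μ) := by
  refine (ψ.integrable (μ := coordMeasure μ)).mul_bdd (c := SchwartzMap.seminorm ℝ 0 0 f) ?_ ?_
  · exact (f.continuous.comp (phiInv_continuous ħ)).aestronglyMeasurable
  · exact Filter.Eventually.of_forall fun q => SchwartzMap.norm_le_seminorm ℝ f _

/-- `ψ ↦ ∫ ψ(q) f(φ_ħ⁻¹(q)) dq`. -/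
def pullbackCLM (ħ : ℝ) (f : 𝓢(Coord V, ℂ)) : 𝓢(Coord V, ℂ) →L[ℂ] ℂ :=
  SchwartzMap.mkCLMtoNormedSpace
    (fun ψ => ∫ q, ψ q * f (phiInv ħ q) ∂(coordMeasure μ))
    (fun ψ χ => by
      rw [← integral_add (pullback_integrable μ ħ f ψ) (pullback_integrable μ ħ f χ)]
      simp [add_mul])
    (fun c ψ => by
      rw [RingHom.id_apply, ← integral_smul]
      simp [mul_assoc])
    (by
      set ν := coordMeasure μ
      refine ⟨{(0, 0), (ν.integrablePower, 0)},
        2 * (2 ^ ν.integrablePower * (∫ x, (1 + ‖x‖) ^ (-(ν.integrablePower : ℝ)) ∂ν) *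
          SchwartzMap.seminorm ℝ 0 0 f), by positivity, fun ψ => ?_⟩
      have h0 := SchwartzMap.integral_pow_mul_iteratedFDeriv_le ℂ ν ψ 0 0
      simp only [pow_zero, one_mul, norm_iteratedFDeriv_zero, zero_add] at h0
      have h1 : ‖∫ q, ψ q * f (phiInv ħ q) ∂ν‖ ≤
          ∫ q, ‖ψ q‖ * SchwartzMap.seminorm ℝ 0 0 f ∂ν := by
        refine norm_integral_le_of_norm_le (ψ.integrable.norm.mul_const _) ?_
        refine Filter.Eventually.of_forall fun q => ?_
        rw [norm_mul]
        gcongr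
        exact SchwartzMap.norm_le_seminorm ℝ f _
      rw [integral_mul_const] at h1
      have h2 : ∀ m ∈ ({(0, 0), (ν.integrablePower, 0)} : Finset (ℕ × ℕ)),
          SchwartzMap.seminorm ℂ m.1 m.2 ψ ≤
            (({(0, 0), (ν.integrablePower, 0)} : Finset (ℕ × ℕ)).sup
              (schwartzSeminormFamily ℂ (Coord V) ℂ)) ψ := fun m hm =>
        Seminorm.le_def.1 (Finset.le_sup (f := schwartzSeminormFamily ℂ (Coord V) ℂ) hm) ψ
      have h3 := h2 (0, 0) (by simp)
      have h4 := h2 (ν.integrablePower, 0) (by simp)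
      refine h1.trans ?_
      calc _ ≤ (2 ^ ν.integrablePower * (∫ x, (1 + ‖x‖) ^ (-(ν.integrablePower : ℝ)) ∂ν) *
            (SchwartzMap.seminorm ℂ 0 0 ψ + SchwartzMap.seminorm ℂ ν.integrablePower 0 ψ)) *
              SchwartzMap.seminorm ℝ 0 0 f := by gcongr
        _ ≤ (2 ^ ν.integrablePower * (∫ x, (1 + ‖x‖) ^ (-(ν.integrablePower : ℝ)) ∂ν) *
            (({(0, 0), (ν.integrablePower, 0)} : Finset (ℕ × ℕ)).sup
              (schwartzSeminormFamily ℂ (Coord V) ℂ) ψ +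
            ({(0, 0), (ν.integrablePower, 0)} : Finset (ℕ × ℕ)).sup
              (schwartzSeminormFamily ℂ (Coord V) ℂ) ψ)) *
              SchwartzMap.seminorm ℝ 0 0 f := by gcongr
        _ = _ := by ring)

/-- The linear map `τ_ħ = F⁻¹ ∘ (φ_ħ⁻¹)^* ∘ F` from Schwartz functions to tempered distributions:
the bounded continuous function `(F u) ∘ φ_ħ⁻¹` is regarded as a tempered distribution, and `F⁻¹`
acts on tempered distributions by duality, `⟨F⁻¹ T, ψ⟩ = ⟨T, F⁻¹ ψ⟩`. -/
def tau (ħ : ℝ) : 𝓢(Coord V, ℂ) →ₗ[ℂ] 𝓢'(Coord V, ℂ) where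
  toFun u := PointwiseConvergenceCLM.precomp ℂ partialFourierInv
    (ContinuousLinearMap.toPointwiseConvergenceCLM ℂ (RingHom.id ℂ) 𝓢(Coord V, ℂ) ℂ
      (pullbackCLM μ ħ (partialFourier u)))
  map_add' u v := by
    ext ψ
    have h := integral_add (pullback_integrable μ ħ (partialFourier u) (partialFourierInv ψ))
      (pullback_integrable μ ħ (partialFourier v) (partialFourierInv ψ))
    refine Eq.trans (integral_congr_ae (Filter.Eventually.of_forall fun q => ?_)) h
    simp [mul_add]
  map_smul' c u := by
    ext ψ
    have h := integral_smul (μ := coordMeasure μ) c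
      (fun q => partialFourierInv ψ q * partialFourier u (phiInv ħ q))
    refine Eq.trans (integral_congr_ae (Filter.Eventually.of_forall fun q => ?_)) h
    simp
    ring

theorem tau_apply (ħ : ℝ) (u ψ : 𝓢(Coord V, ℂ)) :
    tau μ ħ u ψ =
      ∫ q, partialFourierInv ψ q * partialFourier u (phiInv ħ q) ∂(coordMeasure μ) := rfl

/-- The space `𝓔_ħ`, the image of `τ_ħ`. -/
def Espace (ħ : ℝ) : Submodule ℂ 𝓢'(Coord V, ℂ) := LinearMap.range (tau μ ħ)

/-- The element `τ_ħ(u)` of `𝓔_ħ`. -/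
def tauE (ħ : ℝ) (u : 𝓢(Coord V, ℂ)) : Espace μ ħ := ⟨tau μ ħ u, LinearMap.mem_range_self _ u⟩

/-- The tempered distribution `ψ ↦ ∫ ψ(q) u(q) dq` defined by a Schwartz function. -/
def toDist (u : 𝓢(Coord V, ℂ)) : 𝓢'(Coord V, ℂ) :=
  SchwartzMap.toTemperedDistributionCLM (Coord V) ℂ (coordMeasure μ) u

end Measure

/-! ### The Weyl product and the three-point kernel -/

/-- `S⁰(x, y, z) = Ω(x, y) + Ω(y, z) + Ω(z, x)`. -/
def S0 {W : Type} (Ω : W → W → ℝ) (x y z : W) : ℝ := Ω x y + Ω y z + Ω z x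

variable (ω : V → V → ℝ)

/-- The two-form `Ω` on `𝔯` in coordinates. -/
def omegaCoord (p q : Coord V) : ℝ :=
  pairAE p.1 q.2.2 - pairAE q.1 p.2.2 + ω p.2.1 q.2.1

/-- The integrand of the Weyl product. -/
def weylIntegrand (ħ : ℝ) (f g : Coord V → ℂ) (p₀ p₁ p₂ : Coord V) : ℂ :=
  cexp (2 * I / ħ * (S0 (omegaCoord ω) p₀ p₁ p₂ : ℂ)) * f p₁ * g p₂

/-- The amplitude of the three-point kernel. -/
def amplitude (p₀ p₁ p₂ : Coord V) : ℝ :=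
  Real.cosh (2 * (p₁.1 - p₂.1)) *
    (Real.cosh (p₂.1 - p₀.1) * Real.cosh (p₀.1 - p₁.1)) ^ Module.finrank ℝ V

/-- The phase of the three-point kernel. -/
def phase (p₀ p₁ p₂ : Coord V) : ℝ :=
  S0 ω (Real.cosh (p₁.1 - p₂.1) • p₀.2.1) (Real.cosh (p₂.1 - p₀.1) • p₁.2.1)
      (Real.cosh (p₀.1 - p₁.1) • p₂.2.1) -
    1 / 2 * (pairAE (Real.sinh (2 * (p₀.1 - p₁.1))) p₂.2.2 +
      pairAE (Real.sinh (2 * (p₁.1 - p₂.1))) p₀.2.2 +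
      pairAE (Real.sinh (2 * (p₂.1 - p₀.1))) p₁.2.2)

/-- The integrand of the deformed product. -/
def productIntegrand (ħ : ℝ) (u v : Coord V → ℂ) (p₀ p₁ p₂ : Coord V) : ℂ :=
  (amplitude p₀ p₁ p₂ : ℂ) * cexp (2 * I / ħ * (phase ω p₀ p₁ p₂ : ℂ)) * u p₁ * v p₂

/-- The partial integral of the deformed product over `z₁, z₂`, as a function of
`((a₁, x₁), (a₂, x₂))`. -/
def innerIntegral (ħ : ℝ) (u v : Coord V → ℂ) (p₀ : Coord V) (y : (ℝ × V) × (ℝ × V)) : ℂ :=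
  ∫ s : ℝ × ℝ, productIntegrand ω ħ u v p₀ (y.1.1, y.1.2, s.1) (y.2.1, y.2.2, s.2)

/-- The oscillatory integral defining the deformed product, the `z`-integrals being performed
first: for Schwartz functions the integrand need not be absolutely integrable in all
variables. -/
def productFun [MeasurableSpace V] (μ : Measure V) (ħ : ℝ) (u v : Coord V → ℂ)
    (p₀ : Coord V) : ℂ :=
  ((ħ ^ (Module.finrank ℝ V + 2) : ℝ) : ℂ)⁻¹ *
    ∫ y, innerIntegral ω ħ u v p₀ y ∂((volume.prod μ).prod (volume.prod μ))

/-- The group law of `R` in Iwasawa coordinates. -/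
def leftMul (p q : Coord V) : Coord V :=
  (p.1 + q.1, Real.exp (-q.1) • p.2.1 + q.2.1,
    Real.exp (-2 * q.1) * p.2.2 + q.2.2 + 1 / 2 * ω p.2.1 q.2.1 * Real.exp (-q.1))

end

end ANQuant

open ANQuant

/-! The statement splits into analysis on `Coord V`, for an arbitrary finite-dimensional `V` with a
nondegenerate antisymmetric form (`exists_deformedProduct`), and matrix algebra showing that `𝔤_α`
is such a space and that `R` has the stated group law.

Analysis. Pullback by `φ_ħ` preserves Schwartz functions: the derivative of `φ_ħ`, written as a
function of the image point, has temperate coefficients, and `‖q‖` is bounded by a polynomial in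
`‖φ_ħ q‖`. Hence `T_ħ` maps Schwartz functions to Schwartz functions, and `τ_ħ` undoes it
(`tau_transport`). In terms of symplectic Fourier transforms the Weyl product is a convolution
twisted by a bilinear cocycle, hence associative (`weylProduct_assoc`); transport of structure gives
(i).

For (ii), the Weyl phase is affine in each `z_i`. Integrating `z₁, z₂` in the product of `T_ħ u` and
`T_ħ v` evaluates `F u` and `F v` at `φ_ħ` of points with last coordinates `2(a₂ - a₀)/ħ` and `2(a₀
- a₁)/ħ`. At `ξ = 2b/ħ` the map `φ_ħ` divides `x` by `cosh b` and replaces `ξ` by `sinh(2b)/ħ`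
(`phi_scale`), so rescaling `x₁, x₂` creates the powers of `cosh` in the amplitude and the `sinh` in
the phase. Applying `τ_ħ`, tested against `ψ`, does the same to `p₀`: the frequency is `2(a₂ -
a₁)/ħ`, and the Jacobian of `φ_ħ` leaves the factor `cosh(2(a₁ - a₂))` after `x₀` is rescaled
(`tau_weyl_transport`). Fubini applies because `F u` at last coordinate `sinh(2b)/ħ` decays faster
than any power of `cosh(2b)`, which beats the amplitude.

Algebra. A Cartan involution is conjugation by `J = 2P - 1` with `P` a projection of rank one
(`CartanFrame`). Since `A` anticommutes with `J`, rank one forces `A³ = cA`, and the presence of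
both weights 1 and 2 forces `c = 1`. So `A` has eigenvalues in `{-1, 0, 1}`, and vectors of weight 1
and 2 raise them by one and two steps. This short ladder shows that 1 and 2 are the only positive
weights and that products of three vectors of `𝔫` vanish, so exponentials on `𝔫` are quadratic
polynomials and the group law is a finite computation. Rank one again makes `𝔤_{2α}` a line, spanned
by a vector built from `[A, Z]`. Nondegeneracy of `Ω` on `𝔤_α` reduces to two facts: a nonzero root
vector has nonzero square, and the Killing form does not vanish on `(A, A)`. Invariance of the
kernel is a rational identity in the `exp(a_i)`. -/

namespace ANQuant

/-! ### The partial Fourier transform: inversion and duality -/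

section PartialFourierInversion

variable {V : Type} [NormedAddCommGroup V] [NormedSpace ℝ V]

theorem norm_cexp_I_mul (t : ℝ) : ‖cexp (I * (t : ℂ))‖ = 1 := by
  rw [mul_comm]; exact norm_exp_ofReal_mul_I t

theorem slice_integrable (f : 𝓢(Coord V, ℂ)) (a : ℝ) (x : V) :
    Integrable fun z : ℝ => f (a, x, z) := by
  simpa [pairAE] using pf_integrable f (a, x, 0)

/-- The standard kernel is `exp(-2πi w z)` and the kernel here is `exp(-2i ξ z)`, so the frequencies
correspond by `ξ = π w`. -/
theorem fourier_slice (f : 𝓢(Coord V, ℂ)) (a : ℝ) (x : V) (w : ℝ) :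
    FourierTransform.fourier (fun z : ℝ => f (a, x, z)) w =
      partialFourier f (a, x, Real.pi * w) := by
  rw [Real.fourier_eq', partialFourier_apply]
  refine integral_congr_ae (.of_forall fun z => ?_)
  simp only [smul_eq_mul, pairAE]
  congr 2
  simp
  ring

theorem partialFourierInv_partialFourier (f : 𝓢(Coord V, ℂ)) :
    partialFourierInv (partialFourier f) = f := by
  ext ⟨a, x, z⟩
  have hpi : (Real.pi : ℝ) ≠ 0 := Real.pi_ne_zero
  have hF : FourierTransform.fourier (fun z : ℝ => f (a, x, z)) =
      fun w => partialFourier f (a, x, Real.pi * w) := funext (fourier_slice f a x)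
  have hc : Continuous fun z : ℝ => f (a, x, z) := f.continuous.comp (by fun_prop)
  have h_int : Integrable fun w : ℝ => partialFourier f (a, x, Real.pi * w) :=
    (slice_integrable (partialFourier f) a x).comp_mul_left' hpi
  have key := congrFun (hc.fourierInv_fourier_eq (slice_integrable f a x)
    (by rw [hF]; exact h_int)) z
  rw [hF, Real.fourierInv_eq'] at key
  rw [partialFourierInv_apply, ← key]
  -- The substitution `ξ = π w` accounts for the normalization `1/π` of the inverse transform.
  have h := Measure.integral_comp_mul_left
    (fun ξ : ℝ => cexp (I * (pairAE ξ z : ℂ)) * partialFourier f (a, x, ξ)) Real.pi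
  rw [abs_of_pos (inv_pos.2 Real.pi_pos)] at h
  simp only [real_smul, ofReal_inv] at h
  rw [← h]
  refine integral_congr_ae (.of_forall fun w => ?_)
  simp only [smul_eq_mul, pairAE]
  congr 2
  simp
  ring

/-- The inverse transform is, up to `1/π`, the transform followed by a reflection of the last
coordinate, so composing in the other order gives the same double integral after `ξ ↦ -ξ`. -/
theorem partialFourier_partialFourierInv (f : 𝓢(Coord V, ℂ)) :
    partialFourier (partialFourierInv f) = f := by
  ext ⟨a, x, z⟩
  conv_rhs => rw [← partialFourierInv_partialFourier f]
  rw [partialFourierInv_apply, partialFourier_apply]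
  have h1 : ∀ ξ : ℝ, partialFourierInv f (a, x, ξ) =
      (Real.pi⁻¹ : ℂ) * partialFourier f (a, x, -ξ) := fun ξ => rfl
  simp only [h1]
  rw [← integral_const_mul, ← integral_neg_eq_self]
  refine integral_congr_ae (.of_forall fun w => ?_)
  simp only [pairAE, neg_neg]
  rw [show -(I * ((2 * z * -w : ℝ) : ℂ)) = I * ((2 * w * z : ℝ) : ℂ) by push_cast; ring]
  ring

theorem continuous_slice_kernel :
    Continuous fun p : ℝ × ℝ => cexp (-(I * (pairAE p.1 p.2 : ℂ))) := by
  unfold pairAE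
  fun_prop

/-- Fubini: the kernel has modulus one and is symmetric in its two variables. -/
theorem integral_fourier_mul_swap {f g : ℝ → ℂ} (hf : Integrable f) (hg : Integrable g) :
    ∫ ξ, (∫ z, cexp (-(I * (pairAE ξ z : ℂ))) * f z) * g ξ =
      ∫ z, f z * ∫ ξ, cexp (-(I * (pairAE z ξ : ℂ))) * g ξ := by
  simp only [← integral_mul_const, ← integral_const_mul]
  rw [integral_integral_swap]
  · refine integral_congr_ae (.of_forall fun z => integral_congr_ae (.of_forall fun ξ => ?_))
    simp only [pairAE]
    rw [show (2 * ξ * z : ℝ) = 2 * z * ξ by ring]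
    ring
  · have h := (hg.mul_prod hf).bdd_mul (c := 1)
      continuous_slice_kernel.aestronglyMeasurable
      (.of_forall fun p => (norm_pf_kernel p.1 p.2).le)
    refine h.congr (.of_forall fun p => ?_)
    simp only [Function.uncurry]
    ring

/-! ### Self-duality of the partial Fourier transform under integration. -/

section Measure

variable [MeasurableSpace V] [FiniteDimensional ℝ V] [BorelSpace V]
  (μ : Measure V) [μ.IsAddHaarMeasure]

theorem measurePreserving_coord :
    MeasurePreserving (MeasurableEquiv.prodAssoc : (ℝ × V) × ℝ ≃ᵐ Coord V)
      (((volume : Measure ℝ).prod μ).prod volume) (coordMeasure μ) :=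
  ⟨MeasurableEquiv.prodAssoc.measurable, Measure.prodAssoc_prod⟩

theorem integral_coordMeasure {G : Type*} [NormedAddCommGroup G] [NormedSpace ℝ G]
    (F : Coord V → G) :
    ∫ p, F p ∂(coordMeasure μ) =
      ∫ p : (ℝ × V) × ℝ, F (p.1.1, p.1.2, p.2) ∂(((volume : Measure ℝ).prod μ).prod volume) :=
  ((measurePreserving_coord μ).integral_comp' F).symm

theorem integrable_coordMeasure_iff {G : Type*} [NormedAddCommGroup G]
    {F : Coord V → G} :
    Integrable F (coordMeasure μ) ↔ Integrable (fun p : (ℝ × V) × ℝ => F (p.1.1, p.1.2, p.2))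
      (((volume : Measure ℝ).prod μ).prod volume) :=
  ((measurePreserving_coord μ).integrable_comp_emb
    MeasurableEquiv.prodAssoc.measurableEmbedding).symm

theorem schwartz_mul_integrable (f g : 𝓢(Coord V, ℂ)) :
    Integrable (fun q => f q * g q) (coordMeasure μ) :=
  (f.integrable (μ := coordMeasure μ)).mul_bdd (c := SchwartzMap.seminorm ℝ 0 0 g)
    g.continuous.aestronglyMeasurable
    (.of_forall fun q => SchwartzMap.norm_le_seminorm ℝ g q)

theorem integral_partialFourier_mul (f g : 𝓢(Coord V, ℂ)) :
    ∫ q, partialFourier f q * g q ∂(coordMeasure μ) =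
      ∫ q, f q * partialFourier g q ∂(coordMeasure μ) := by
  rw [integral_coordMeasure, integral_coordMeasure,
    integral_prod _ ((integrable_coordMeasure_iff μ).1 (schwartz_mul_integrable μ _ _)),
    integral_prod _ ((integrable_coordMeasure_iff μ).1 (schwartz_mul_integrable μ _ _))]
  refine integral_congr_ae (.of_forall fun w => ?_)
  exact integral_fourier_mul_swap (slice_integrable f w.1 w.2) (slice_integrable g w.1 w.2)

theorem integral_partialFourierInv_mul (f g : 𝓢(Coord V, ℂ)) :
    ∫ q, partialFourierInv f q * g q ∂(coordMeasure μ) =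
      ∫ q, f q * partialFourierInv g q ∂(coordMeasure μ) := by
  have h := integral_partialFourier_mul μ (partialFourierInv f) (partialFourierInv g)
  rw [partialFourier_partialFourierInv, partialFourier_partialFourierInv] at h
  exact h.symm

end Measure

end PartialFourierInversion

end ANQuant

namespace ANQuant

/-! ### Tensor products and Fourier transforms of Schwartz functions -/

section SchwartzTools

variable {X Y : Type*} [NormedAddCommGroup X] [NormedSpace ℝ X] [NormedAddCommGroup Y]
  [NormedSpace ℝ Y]

theorem norm_iteratedFDeriv_comp_fst_le (f : 𝓢(X, ℂ)) (i : ℕ) (p : X × Y) :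
    ‖iteratedFDeriv ℝ i (fun p : X × Y => f p.1) p‖ ≤ ‖iteratedFDeriv ℝ i f p.1‖ := by
  have h := (ContinuousLinearMap.fst ℝ X Y).iteratedFDeriv_comp_right (f.smooth i) p le_rfl
  change ‖iteratedFDeriv ℝ i (f ∘ ContinuousLinearMap.fst ℝ X Y) p‖ ≤ _
  rw [h]
  refine (ContinuousMultilinearMap.norm_compContinuousLinearMap_le _ _).trans ?_
  refine mul_le_of_le_one_right (norm_nonneg _) ?_
  exact Finset.prod_le_one (fun _ _ => norm_nonneg _) fun _ _ => ContinuousLinearMap.norm_fst_le ..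

theorem norm_iteratedFDeriv_comp_snd_le (f : 𝓢(Y, ℂ)) (i : ℕ) (p : X × Y) :
    ‖iteratedFDeriv ℝ i (fun p : X × Y => f p.2) p‖ ≤ ‖iteratedFDeriv ℝ i f p.2‖ := by
  have h := (ContinuousLinearMap.snd ℝ X Y).iteratedFDeriv_comp_right (f.smooth i) p le_rfl
  change ‖iteratedFDeriv ℝ i (f ∘ ContinuousLinearMap.snd ℝ X Y) p‖ ≤ _
  rw [h]
  refine (ContinuousMultilinearMap.norm_compContinuousLinearMap_le _ _).trans ?_
  refine mul_le_of_le_one_right (norm_nonneg _) ?_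
  exact Finset.prod_le_one (fun _ _ => norm_nonneg _) fun _ _ => ContinuousLinearMap.norm_snd_le ..

/-- The Schwartz function `(x, y) ↦ f x * g y`. -/
noncomputable def schwartzTensor (f : 𝓢(X, ℂ)) (g : 𝓢(Y, ℂ)) : 𝓢(X × Y, ℂ) where
  toFun p := f p.1 * g p.2
  smooth' := ((f.smooth ⊤).comp contDiff_fst).mul ((g.smooth ⊤).comp contDiff_snd)
  decay' := by
    intro k n
    let s : ℕ → ℕ → 𝓢(X, ℂ) → ℝ := fun k i f => SchwartzMap.seminorm ℝ k i f
    let t : ℕ → ℕ → 𝓢(Y, ℂ) → ℝ := fun k i f => SchwartzMap.seminorm ℝ k i f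
    refine ⟨∑ i ∈ Finset.range (n + 1), (n.choose i : ℝ) *
      (s k i f * t 0 (n - i) g + s 0 i f * t k (n - i) g), fun p => ?_⟩
    have h1 := norm_iteratedFDeriv_mul_le (𝕜 := ℝ) (n := n) (N := ((⊤ : ℕ∞) : WithTop ℕ∞))
      (f := fun p : X × Y => f p.1) (g := fun p : X × Y => g p.2)
      ((f.smooth ⊤).comp contDiff_fst) ((g.smooth ⊤).comp contDiff_snd) p (mod_cast le_top)
    refine (mul_le_mul_of_nonneg_left h1 (by positivity)).trans ?_
    rw [Finset.mul_sum]
    refine Finset.sum_le_sum fun i _ => ?_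
    have h2 := norm_iteratedFDeriv_comp_fst_le f i p
    have h3 := norm_iteratedFDeriv_comp_snd_le g (n - i) p
    have hp : ‖p‖ ^ k ≤ ‖p.1‖ ^ k + ‖p.2‖ ^ k := by
      rw [Prod.norm_def]
      rcases max_cases ‖p.1‖ ‖p.2‖ with ⟨h, _⟩ | ⟨h, _⟩ <;> rw [h] <;> simp
    have e1 : ‖p.1‖ ^ k * ‖iteratedFDeriv ℝ i f p.1‖ ≤ s k i f := f.le_seminorm ℝ k i p.1
    have e2 : ‖p.2‖ ^ k * ‖iteratedFDeriv ℝ (n - i) g p.2‖ ≤ t k (n - i) g :=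
      g.le_seminorm ℝ k (n - i) p.2
    have e3 : ‖iteratedFDeriv ℝ i f p.1‖ ≤ s 0 i f := by simpa using f.le_seminorm ℝ 0 i p.1
    have e4 : ‖iteratedFDeriv ℝ (n - i) g p.2‖ ≤ t 0 (n - i) g := by
      simpa using g.le_seminorm ℝ 0 (n - i) p.2
    calc _ ≤ (‖p.1‖ ^ k + ‖p.2‖ ^ k) * ((n.choose i : ℝ) * ‖iteratedFDeriv ℝ i f p.1‖ *
          ‖iteratedFDeriv ℝ (n - i) g p.2‖) := by gcongr
      _ = (n.choose i : ℝ) * ((‖p.1‖ ^ k * ‖iteratedFDeriv ℝ i f p.1‖) *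
          ‖iteratedFDeriv ℝ (n - i) g p.2‖ + ‖iteratedFDeriv ℝ i f p.1‖ *
          (‖p.2‖ ^ k * ‖iteratedFDeriv ℝ (n - i) g p.2‖)) := by ring
      _ ≤ _ := by
        have : 0 ≤ s k i f := apply_nonneg _ _
        have : 0 ≤ s 0 i f := apply_nonneg _ _
        gcongr

@[simp]
theorem schwartzTensor_apply (f : 𝓢(X, ℂ)) (g : 𝓢(Y, ℂ)) (p : X × Y) :
    schwartzTensor f g p = f p.1 * g p.2 := rfl

theorem hasTemperateGrowth_cexp_I_mul :
    Function.HasTemperateGrowth fun t : ℝ => cexp (I * (t : ℂ)) := by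
  have hd : ∀ n : ℕ, iteratedDeriv n (fun t : ℝ => cexp (I * (t : ℂ))) =
      fun t : ℝ => I ^ n * cexp (I * (t : ℂ)) := by
    intro n
    induction n with
    | zero => simp
    | succ n ih =>
      rw [iteratedDeriv_succ, ih]
      ext t
      have h1 : HasDerivAt (fun t : ℝ => I * (t : ℂ)) I t := by
        simpa using ((hasDerivAt_id t).ofReal_comp).const_mul I
      rw [((h1.cexp).const_mul (I ^ n)).deriv]
      ring
  refine ⟨?_, fun n => ⟨0, 1, fun t => ?_⟩⟩
  · exact Complex.contDiff_exp.comp (contDiff_const.mul Complex.ofRealCLM.contDiff)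
  · rw [norm_iteratedFDeriv_eq_norm_iteratedDeriv, hd]
    simp

/-! ### Fourier transforms with respect to bilinear forms and Haar measures. -/

section Fourier

variable [FiniteDimensional ℝ Y] [MeasurableSpace Y] [BorelSpace Y]

/-- Uniqueness of Haar measure reduces Fourier analysis on `Y` to Euclidean space at the cost of a
constant; inversion needs the constant to be nonzero. -/
theorem exists_integral_eq_euclidean (e : Y ≃L[ℝ] EuclideanSpace ℝ (Fin (Module.finrank ℝ Y)))
    (ν : Measure Y) [ν.IsAddHaarMeasure] :
    ∃ c : ℝ, c ≠ 0 ∧ ∀ h : EuclideanSpace ℝ (Fin (Module.finrank ℝ Y)) → ℂ,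
      ∫ y, h (e y) ∂ν = c * ∫ w, h w := by
  have : (ν.map e).IsAddHaarMeasure := e.isAddHaarMeasure_map ν
  have h1 := Measure.isAddLeftInvariant_eq_smul (ν.map e)
    (volume : Measure (EuclideanSpace ℝ (Fin (Module.finrank ℝ Y))))
  refine ⟨(ν.map e).addHaarScalarFactor volume, ?_, fun h => ?_⟩
  · exact_mod_cast (Measure.addHaarScalarFactor_pos_of_isAddHaarMeasure (ν.map e) volume).ne'
  · have h2 := (e.toHomeomorph.measurableEmbedding).integral_map (μ := ν) h
    have h3 : ∫ y, h (e y) ∂ν = ∫ w, h w ∂(ν.map e) := h2.symm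
    rw [h3]
    conv_lhs => rw [h1]
    rw [integral_smul_nnreal_measure, NNReal.smul_def, real_smul]

/-- The vector `b` such that `-2π ⟪w, b⟫ = l (e⁻¹ w)`. -/
noncomputable def rieszVec (e : Y ≃L[ℝ] EuclideanSpace ℝ (Fin (Module.finrank ℝ Y))) :
    (Y →ₗ[ℝ] ℝ) →ₗ[ℝ] EuclideanSpace ℝ (Fin (Module.finrank ℝ Y)) where
  toFun l := -(2 * Real.pi)⁻¹ • (InnerProductSpace.toDual ℝ _).symm
    (LinearMap.toContinuousLinearMap (l ∘ₗ (e.symm : _ →ₗ[ℝ] Y)))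
  map_add' l m := by
    rw [← smul_add, ← map_add, ← map_add]
    rfl
  map_smul' c l := by
    have h : LinearMap.toContinuousLinearMap ((c • l) ∘ₗ
        (e.symm : EuclideanSpace ℝ (Fin (Module.finrank ℝ Y)) →ₗ[ℝ] Y)) = c •
        LinearMap.toContinuousLinearMap
          (l ∘ₗ (e.symm : EuclideanSpace ℝ (Fin (Module.finrank ℝ Y)) →ₗ[ℝ] Y)) := rfl
    rw [RingHom.id_apply, smul_comm c, h, LinearIsometryEquiv.map_smulₛₗ]
    rfl

theorem inner_rieszVec (e : Y ≃L[ℝ] EuclideanSpace ℝ (Fin (Module.finrank ℝ Y)))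
    (l : Y →ₗ[ℝ] ℝ) (y : Y) : -2 * Real.pi * inner ℝ (e y) (rieszVec e l) = l y := by
  have h : inner ℝ ((InnerProductSpace.toDual ℝ _).symm
    (LinearMap.toContinuousLinearMap (l ∘ₗ (e.symm : _ →ₗ[ℝ] Y)))) (e y) = l y := by
    rw [InnerProductSpace.toDual_symm_apply]
    simp
  rw [rieszVec, LinearMap.coe_mk, AddHom.coe_mk, inner_smul_right, real_inner_comm, h]
  field_simp [Real.pi_ne_zero]

theorem rieszVec_injective (e : Y ≃L[ℝ] EuclideanSpace ℝ (Fin (Module.finrank ℝ Y))) :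
    Function.Injective (rieszVec e) := by
  intro l m h
  ext y
  rw [← inner_rieszVec e l, ← inner_rieszVec e m, h]

theorem integral_cexp_eq_fourier (e : Y ≃L[ℝ] EuclideanSpace ℝ (Fin (Module.finrank ℝ Y)))
    {ν : Measure Y} {c : ℝ}
    (hc : ∀ h : EuclideanSpace ℝ (Fin (Module.finrank ℝ Y)) → ℂ, ∫ y, h (e y) ∂ν = c * ∫ w, h w)
    (F : 𝓢(Y, ℂ)) (l : Y →ₗ[ℝ] ℝ) :
    ∫ y, cexp (I * (l y : ℂ)) * F y ∂ν =
      c * FourierTransform.fourier (SchwartzMap.compCLMOfContinuousLinearEquiv ℂ e.symm F)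
        (rieszVec e l) := by
  rw [SchwartzMap.fourier_coe, Real.fourier_eq', ← hc]
  refine integral_congr_ae (.of_forall fun y => ?_)
  simp only [SchwartzMap.compCLMOfContinuousLinearEquiv_apply, smul_eq_mul, Function.comp_apply,
    ContinuousLinearEquiv.symm_apply_apply, inner_rieszVec]
  rw [mul_comm I]

variable [FiniteDimensional ℝ X]

/-- The Fourier transform of a Schwartz function, as a function of a vector that parametrizes
linear forms injectively, is a Schwartz function. -/
theorem exists_schwartz_fourier (ν : Measure Y) [ν.IsAddHaarMeasure] (A : X →ₗ[ℝ] Y →ₗ[ℝ] ℝ)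
    (hA : Function.Injective A) (F : 𝓢(Y, ℂ)) :
    ∃ G : 𝓢(X, ℂ), ∀ q, G q = ∫ y, cexp (I * (A q y : ℂ)) * F y ∂ν := by
  let e : Y ≃L[ℝ] EuclideanSpace ℝ (Fin (Module.finrank ℝ Y)) := toEuclidean
  obtain ⟨c, -, hc⟩ := exists_integral_eq_euclidean e ν
  let B : X →L[ℝ] EuclideanSpace ℝ (Fin (Module.finrank ℝ Y)) :=
    LinearMap.toContinuousLinearMap (rieszVec e ∘ₗ A)
  have hB : Function.Injective B := (rieszVec_injective e).comp hA
  -- An injective linear map is bounded below in finite dimension, so restricting along it keeps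
  -- Schwartz decay even if `X` has smaller dimension than `Y`.
  obtain ⟨K, -, hK⟩ := (rieszVec e ∘ₗ A).exists_antilipschitzWith (LinearMap.ker_eq_bot.2 hB)
  refine ⟨(c : ℂ) • SchwartzMap.compCLMOfAntilipschitz ℂ B.hasTemperateGrowth (K := K) hK
    (FourierTransform.fourier (SchwartzMap.compCLMOfContinuousLinearEquiv ℂ e.symm F)),
    fun q => ?_⟩
  rw [integral_cexp_eq_fourier e hc]
  rfl

/-- Fourier inversion with respect to a nondegenerate bilinear form. -/
theorem exists_fourier_inversion (ν : Measure Y) [ν.IsAddHaarMeasure] (A : Y →ₗ[ℝ] Y →ₗ[ℝ] ℝ)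
    (hA : Function.Injective A) :
    ∃ c : ℂ, ∀ (f : 𝓢(Y, ℂ)) (p : Y),
      f p = c * ∫ q, cexp (-(I * (A q p : ℂ))) * ∫ y, cexp (I * (A q y : ℂ)) * f y ∂ν ∂ν := by
  let e : Y ≃L[ℝ] EuclideanSpace ℝ (Fin (Module.finrank ℝ Y)) := toEuclidean
  obtain ⟨c, hc0, hc⟩ := exists_integral_eq_euclidean e ν
  have hB : Function.Injective (rieszVec e ∘ₗ A) := (rieszVec_injective e).comp hA
  let B : Y ≃L[ℝ] EuclideanSpace ℝ (Fin (Module.finrank ℝ Y)) :=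
    (LinearEquiv.ofInjectiveOfFinrankEq (rieszVec e ∘ₗ A) hB (by simp)).toContinuousLinearEquiv
  have hBA : ∀ q, B q = rieszVec e (A q) := fun q => rfl
  obtain ⟨b, hb0, hb⟩ := exists_integral_eq_euclidean B ν
  -- `c` compares the Haar measure of the inner variable with Lebesgue measure, and `b` does so for
  -- the outer variable after the change of coordinates `B`.
  refine ⟨((b * c : ℝ) : ℂ)⁻¹, fun f p => ?_⟩
  set g := SchwartzMap.compCLMOfContinuousLinearEquiv ℂ e.symm f with hg
  have h1 : ∀ q, cexp (-(I * (A q p : ℂ))) * ∫ y, cexp (I * (A q y : ℂ)) * f y ∂ν =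
      (fun w => c * (cexp (2 * Real.pi * inner ℝ w (e p) * I) * FourierTransform.fourier g w))
        (B q) := by
    intro q
    rw [integral_cexp_eq_fourier e hc, ← hg, hBA, ← inner_rieszVec e (A q) p,
      real_inner_comm]
    simp only
    rw [mul_left_comm]
    congr 3
    push_cast
    ring
  rw [integral_congr_ae (.of_forall h1),
    hb fun w => c * (cexp (2 * Real.pi * inner ℝ w (e p) * I) * FourierTransform.fourier g w),
    integral_const_mul, ← mul_assoc (b : ℂ), ← ofReal_mul, inv_mul_cancel_left₀]
  · have h2 : f p = g (e p) := by simp [hg]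
    rw [h2]
    have h3 : FourierTransformInv.fourierInv (FourierTransform.fourier g) = g :=
      FourierTransform.fourierInv_fourier_eq g
    conv_lhs => rw [← h3]
    rw [SchwartzMap.fourierInv_coe, Real.fourierInv_eq']
    refine integral_congr_ae (.of_forall fun w => ?_)
    simp
  · exact_mod_cast mul_ne_zero hb0 hc0

end Fourier

end SchwartzTools

end ANQuant

namespace ANQuant

/-! ### Pulling back Schwartz functions by `φ_ħ` -/

/-- If derivatives of the generators stay in the algebra, the Leibniz rule makes the algebra stable
under differentiation. Polynomial bounds pass to sums and products, so every derivative of every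
element has one. -/
theorem hasTemperateGrowth_of_mem_adjoin {S : Set (ℝ → ℝ)}
    (hd : ∀ f ∈ S, Differentiable ℝ f ∧ deriv f ∈ Algebra.adjoin ℝ S)
    (hb : ∀ f ∈ S, ∃ (k : ℕ) (C : ℝ), ∀ x, |f x| ≤ C * (1 + |x|) ^ k)
    {f : ℝ → ℝ} (hf : f ∈ Algebra.adjoin ℝ S) : f.HasTemperateGrowth := by
  have hd' : ∀ f ∈ Algebra.adjoin ℝ S, Differentiable ℝ f ∧ deriv f ∈ Algebra.adjoin ℝ S := by
    intro f hf
    induction hf using Algebra.adjoin_induction with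
    | mem f hf => exact hd f hf
    | algebraMap c =>
      refine ⟨differentiable_const c, ?_⟩
      have : deriv (algebraMap ℝ (ℝ → ℝ) c) = 0 := deriv_const' c
      rw [this]
      exact zero_mem _
    | add f g _ _ hf hg =>
      refine ⟨hf.1.add hg.1, ?_⟩
      rw [show deriv (f + g) = deriv f + deriv g from funext fun x => deriv_add (hf.1 x) (hg.1 x)]
      exact add_mem hf.2 hg.2
    | mul f g hf' hg' hf hg =>
      refine ⟨hf.1.mul hg.1, ?_⟩
      rw [show deriv (f * g) = deriv f * g + f * deriv g from
        funext fun x => deriv_mul (hf.1 x) (hg.1 x)]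
      exact add_mem (mul_mem hf.2 hg') (mul_mem hf' hg.2)
  have hb' : ∀ f ∈ Algebra.adjoin ℝ S, ∃ (k : ℕ) (C : ℝ), ∀ x, |f x| ≤ C * (1 + |x|) ^ k := by
    intro f hf
    induction hf using Algebra.adjoin_induction with
    | mem f hf => exact hb f hf
    | algebraMap c => exact ⟨0, |c|, fun x => by simp⟩
    | add f g _ _ hf hg =>
      obtain ⟨k, C, hC⟩ := hf
      obtain ⟨l, D, hD⟩ := hg
      refine ⟨k + l, |C| + |D|, fun x => ?_⟩
      have hx : 1 ≤ 1 + |x| := by linarith [abs_nonneg x]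
      calc |f x + g x| ≤ |f x| + |g x| := abs_add_le _ _
        _ ≤ |C| * (1 + |x|) ^ k + |D| * (1 + |x|) ^ l := by
          refine add_le_add ((hC x).trans ?_) ((hD x).trans ?_) <;> gcongr <;> exact le_abs_self _
        _ ≤ |C| * (1 + |x|) ^ (k + l) + |D| * (1 + |x|) ^ (k + l) := by
          gcongr <;> first | exact hx | omega
        _ = _ := by ring
    | mul f g _ _ hf hg =>
      obtain ⟨k, C, hC⟩ := hf
      obtain ⟨l, D, hD⟩ := hg
      refine ⟨k + l, C * D, fun x => ?_⟩
      rw [Pi.mul_apply, abs_mul]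
      calc |f x| * |g x| ≤ (C * (1 + |x|) ^ k) * (D * (1 + |x|) ^ l) := by
            gcongr
            · exact (abs_nonneg _).trans (hC x)
            · exact hC x
            · exact hD x
        _ = _ := by ring
  have hi : ∀ n : ℕ, ∀ f ∈ Algebra.adjoin ℝ S, iteratedDeriv n f ∈ Algebra.adjoin ℝ S := by
    intro n
    induction n with
    | zero => intro f hf; simpa using hf
    | succ n ih => intro f hf; rw [iteratedDeriv_succ']; exact ih _ (hd' f hf).2
  refine ⟨contDiff_of_differentiable_iteratedDeriv fun m _ => (hd' _ (hi m f hf)).1, fun n => ?_⟩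
  obtain ⟨k, C, hC⟩ := hb' _ (hi n f hf)
  refine ⟨k, C, fun x => ?_⟩
  rw [norm_iteratedFDeriv_eq_norm_iteratedDeriv]
  exact hC x

/-! ### Temperate growth of hyperbolic functions of `arsinh (ħ η)`. -/

noncomputable section

/-- `cosh θ` for `sinh θ = ħ η`. -/
def coshAr (ħ η : ℝ) : ℝ := Real.cosh (Real.arsinh (ħ * η))

/-- `1 / cosh (θ / 2)` for `sinh θ = ħ η`. -/
def sechHalfAr (ħ η : ℝ) : ℝ := (Real.cosh (Real.arsinh (ħ * η) / 2))⁻¹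

/-- `tanh (θ / 2)` for `sinh θ = ħ η`. -/
def tanhHalfAr (ħ η : ℝ) : ℝ :=
  Real.sinh (Real.arsinh (ħ * η) / 2) / Real.cosh (Real.arsinh (ħ * η) / 2)

theorem hasDerivAt_arsinh_mul (ħ η : ℝ) :
    HasDerivAt (fun η => Real.arsinh (ħ * η)) (ħ * (coshAr ħ η)⁻¹) η := by
  have h := ((hasDerivAt_id η).const_mul ħ).arsinh
  refine h.congr_deriv ?_
  rw [coshAr, Real.cosh_arsinh]
  simp
  ring

/-- The functions `sinh θ`, `cosh θ`, `1 / cosh θ`, `tanh (θ / 2)` and `1 / cosh (θ / 2)` of `η`,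
where `sinh θ = ħ η`. -/
def hyperbolicSet (ħ : ℝ) : Set (ℝ → ℝ) :=
  {fun η => ħ * η, coshAr ħ, fun η => (coshAr ħ η)⁻¹, tanhHalfAr ħ, sechHalfAr ħ}

/-- With `sinh θ = ħ η` one has `dθ/dη = ħ / cosh θ`. The functions `1 / cosh θ` and `tanh (θ / 2)`
are in the family so that the derivatives of all five are polynomials in the five. -/
theorem hyperbolicSet_temperate (ħ : ℝ) {f : ℝ → ℝ} (hf : f ∈ hyperbolicSet ħ) :
    f.HasTemperateGrowth := by
  have hmem : ∀ g ∈ hyperbolicSet ħ, g ∈ Algebra.adjoin ℝ (hyperbolicSet ħ) :=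
    fun g hg => Algebra.subset_adjoin hg
  have m1 := hmem (fun η => ħ * η) (by simp [hyperbolicSet])
  have m2 := hmem (coshAr ħ) (by simp [hyperbolicSet])
  have m3 := hmem (fun η => (coshAr ħ η)⁻¹) (by simp [hyperbolicSet])
  have m4 := hmem (tanhHalfAr ħ) (by simp [hyperbolicSet])
  have m5 := hmem (sechHalfAr ħ) (by simp [hyperbolicSet])
  have hs : ∀ (c : ℝ) (g : ℝ → ℝ), g ∈ Algebra.adjoin ℝ (hyperbolicSet ħ) →
    c • g ∈ Algebra.adjoin ℝ (hyperbolicSet ħ) := fun c g hg => Subalgebra.smul_mem _ hg c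
  have hθ := hasDerivAt_arsinh_mul ħ
  have hθ2 := fun η => (hθ η).div_const 2
  have hC := fun η => Real.cosh_pos (Real.arsinh (ħ * η))
  have hC2 := fun η => Real.cosh_pos (Real.arsinh (ħ * η) / 2)
  have key : ∀ (g g' : ℝ → ℝ), (∀ η, HasDerivAt g (g' η) η) →
      g' ∈ Algebra.adjoin ℝ (hyperbolicSet ħ) →
      Differentiable ℝ g ∧ deriv g ∈ Algebra.adjoin ℝ (hyperbolicSet ħ) := by
    intro g g' h1 h2
    refine ⟨fun η => (h1 η).differentiableAt, ?_⟩
    rwa [funext fun η => (h1 η).deriv]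
  refine hasTemperateGrowth_of_mem_adjoin ?_ ?_ (hmem f hf)
  · rintro g (rfl | rfl | rfl | rfl | rfl)
    · refine key _ (fun _ => ħ) (fun η => by simpa using (hasDerivAt_id η).const_mul ħ) ?_
      exact Subalgebra.algebraMap_mem _ ħ
    · refine key _ (ħ • ((fun η => ħ * η) * fun η => (coshAr ħ η)⁻¹))
        (fun η => (hθ η).cosh.congr_deriv ?_) (hs _ _ (mul_mem m1 m3))
      simp only [Real.sinh_arsinh, Pi.smul_apply, Pi.mul_apply, smul_eq_mul]
      ring
    · refine key _ ((-ħ) • ((fun η => ħ * η) * ((fun η => (coshAr ħ η)⁻¹) *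
        ((fun η => (coshAr ħ η)⁻¹) * (fun η => (coshAr ħ η)⁻¹)))))
        (fun η => ((hθ η).cosh.inv (hC η).ne').congr_deriv ?_)
        (hs _ _ (mul_mem m1 (mul_mem m3 (mul_mem m3 m3))))
      simp only [Real.sinh_arsinh, Pi.smul_apply, Pi.mul_apply, smul_eq_mul, coshAr]
      field_simp
    · refine key _ ((ħ / 2) • ((sechHalfAr ħ * sechHalfAr ħ) * (fun η => (coshAr ħ η)⁻¹)))
        (fun η => (((hθ2 η).sinh.div (hθ2 η).cosh (hC2 η).ne')).congr_deriv ?_)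
        (hs _ _ (mul_mem (mul_mem m5 m5) m3))
      have h1 := Real.cosh_sq (Real.arsinh (ħ * η) / 2)
      have h2 := (hC2 η).ne'
      have h3 := (hC η).ne'
      simp only [Pi.smul_apply, Pi.mul_apply, smul_eq_mul, coshAr, sechHalfAr]
      field_simp
      rw [h1]
      ring
    · refine key _ ((-ħ / 2) • ((tanhHalfAr ħ * sechHalfAr ħ) * (fun η => (coshAr ħ η)⁻¹)))
        (fun η => ((hθ2 η).cosh.inv (hC2 η).ne').congr_deriv ?_)
        (hs _ _ (mul_mem (mul_mem m4 m5) m3))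
      have h2 := (hC2 η).ne'
      have h3 := (hC η).ne'
      simp only [Pi.smul_apply, Pi.mul_apply, smul_eq_mul, coshAr, sechHalfAr, tanhHalfAr]
      field_simp
  · have one_le_cosh : ∀ t, 1 ≤ Real.cosh t := Real.one_le_cosh
    rintro g (rfl | rfl | rfl | rfl | rfl)
    · refine ⟨1, |ħ|, fun η => ?_⟩
      rw [abs_mul, pow_one]
      gcongr
      linarith
    · refine ⟨1, 1 + |ħ|, fun η => ?_⟩
      rw [coshAr, Real.cosh_arsinh, abs_of_nonneg (Real.sqrt_nonneg _), pow_one]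
      refine Real.sqrt_le_iff.2 ⟨by positivity, ?_⟩
      have h1 : (ħ * η) ^ 2 = (|ħ| * |η|) ^ 2 := by rw [← abs_mul, sq_abs]
      rw [h1]
      nlinarith [abs_nonneg ħ, abs_nonneg η, mul_nonneg (abs_nonneg ħ) (abs_nonneg η)]
    · refine ⟨0, 1, fun η => ?_⟩
      simp only [coshAr]
      rw [abs_of_pos (inv_pos.2 (hC η)), pow_zero, mul_one]
      exact inv_le_one_of_one_le₀ (one_le_cosh _)
    · refine ⟨0, 1, fun η => ?_⟩
      rw [tanhHalfAr, abs_div, abs_of_pos (hC2 η), pow_zero, mul_one, div_le_one (hC2 η)]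
      refine abs_le_of_sq_le_sq ?_ (hC2 η).le
      nlinarith [Real.cosh_sq (Real.arsinh (ħ * η) / 2)]
    · refine ⟨0, 1, fun η => ?_⟩
      rw [sechHalfAr, abs_of_pos (inv_pos.2 (hC2 η)), pow_zero, mul_one]
      exact inv_le_one_of_one_le₀ (one_le_cosh _)

theorem coshAr_temperate (ħ : ℝ) : (coshAr ħ).HasTemperateGrowth :=
  hyperbolicSet_temperate ħ (by simp [hyperbolicSet])

theorem sechHalfAr_temperate (ħ : ℝ) : (sechHalfAr ħ).HasTemperateGrowth :=
  hyperbolicSet_temperate ħ (by simp [hyperbolicSet])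

theorem tanhHalfAr_temperate (ħ : ℝ) : (tanhHalfAr ħ).HasTemperateGrowth :=
  hyperbolicSet_temperate ħ (by simp [hyperbolicSet])

/-! ### Stability of the Schwartz space under pullback by `φ_ħ`. -/

section Pullback

variable {V : Type} [NormedAddCommGroup V] [NormedSpace ℝ V]

/-- The projection of the coordinate space to `V`. -/
def xCLM : Coord V →L[ℝ] V :=
  (ContinuousLinearMap.fst ℝ V ℝ).comp (ContinuousLinearMap.snd ℝ ℝ (V × ℝ))

/-- The inclusion of `V` in the coordinate space. -/
def inXCLM : V →L[ℝ] Coord V :=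
  (ContinuousLinearMap.inr ℝ ℝ (V × ℝ)).comp (ContinuousLinearMap.inl ℝ V ℝ)

/-- The projection of the coordinate space to the first coordinate axis. -/
def aProj : Coord V →L[ℝ] Coord V :=
  (ContinuousLinearMap.inl ℝ ℝ (V × ℝ)).comp (ContinuousLinearMap.fst ℝ ℝ (V × ℝ))

/-- The projection of the coordinate space to the last coordinate axis. -/
def zProj : Coord V →L[ℝ] Coord V :=
  ((ContinuousLinearMap.inr ℝ ℝ (V × ℝ)).comp (ContinuousLinearMap.inr ℝ V ℝ)).comp zCLM

/-- The derivative of `φ_ħ` at `φ_ħ⁻¹ p`, as a function of `p`. -/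
def phiDeriv (ħ : ℝ) (p : Coord V) : Coord V →L[ℝ] Coord V :=
  aProj + sechHalfAr ħ (zCLM p) • (inXCLM.comp xCLM) +
    (-(ħ / 2) * tanhHalfAr ħ (zCLM p)) • (zCLM : Coord V →L[ℝ] ℝ).smulRight (inXCLM (xCLM p)) +
    coshAr ħ (zCLM p) • zProj

theorem phiDeriv_temperate (ħ : ℝ) : (phiDeriv ħ : Coord V → _).HasTemperateGrowth := by
  have hz : ((zCLM : Coord V →L[ℝ] ℝ) : Coord V → ℝ).HasTemperateGrowth :=
    ContinuousLinearMap.hasTemperateGrowth (zCLM : Coord V →L[ℝ] ℝ)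
  have h1 := (sechHalfAr_temperate ħ).comp hz
  have h2 := (tanhHalfAr_temperate ħ).comp hz
  have h3 := (coshAr_temperate ħ).comp hz
  have h4 : (fun p : Coord V => (zCLM : Coord V →L[ℝ] ℝ).smulRight
      (inXCLM (xCLM p))).HasTemperateGrowth :=
    (((ContinuousLinearMap.smulRightL ℝ (Coord V) (Coord V) zCLM).comp
      (inXCLM.comp xCLM)).hasTemperateGrowth)
  exact (((Function.HasTemperateGrowth.const _).add (h1.smul (.const _))).add
    (((Function.HasTemperateGrowth.const (-(ħ / 2))).mul h2).smul h4)).add (h3.smul (.const _))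

theorem phi_hasFDerivAt {ħ : ℝ} (hħ : ħ ≠ 0) (q : Coord V) :
    HasFDerivAt (phi ħ) (phiDeriv ħ (phi ħ q)) q := by
  have hz : HasFDerivAt (fun q : Coord V => q.2.2) (zCLM : Coord V →L[ℝ] ℝ) q :=
    (zCLM : Coord V →L[ℝ] ℝ).hasFDerivAt
  have hx : HasFDerivAt (fun q : Coord V => q.2.1) (xCLM : Coord V →L[ℝ] V) q :=
    (xCLM : Coord V →L[ℝ] V).hasFDerivAt
  have ha : HasFDerivAt (fun q : Coord V => q.1) (ContinuousLinearMap.fst ℝ ℝ (V × ℝ)) q :=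
    (ContinuousLinearMap.fst ℝ ℝ (V × ℝ)).hasFDerivAt
  have hc : HasDerivAt (fun t : ℝ => (Real.cosh (ħ / 2 * t))⁻¹) (-(Real.sinh (ħ / 2 * q.2.2) *
      (ħ / 2)) / Real.cosh (ħ / 2 * q.2.2) ^ 2) q.2.2 := by
    have := (((hasDerivAt_id q.2.2).const_mul (ħ / 2)).cosh).inv (Real.cosh_pos _).ne'
    refine this.congr_deriv ?_
    simp
  have hs : HasDerivAt (fun t : ℝ => ħ⁻¹ * Real.sinh (ħ * t)) (Real.cosh (ħ * q.2.2)) q.2.2 := by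
    have := (((hasDerivAt_id q.2.2).const_mul ħ).sinh).const_mul ħ⁻¹
    refine this.congr_deriv ?_
    simp
    field_simp
  have h := ha.prodMk (((hc.comp_hasFDerivAt q hz).smul hx).prodMk (hs.comp_hasFDerivAt q hz))
  refine h.congr_fderiv ?_
  have e1 : Real.arsinh (ħ * (ħ⁻¹ * Real.sinh (ħ * q.2.2))) = ħ * q.2.2 := by
    rw [mul_inv_cancel_left₀ hħ, Real.arsinh_sinh]
  have e2 : ħ * q.2.2 / 2 = ħ / 2 * q.2.2 := by ring
  have hc0 := (Real.cosh_pos (ħ / 2 * q.2.2)).ne'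
  refine ContinuousLinearMap.ext fun v => ?_
  refine Prod.ext ?_ (Prod.ext ?_ ?_)
  · simp [phiDeriv, aProj, zProj, inXCLM, xCLM, zCLM]
  · simp only [phiDeriv, aProj, zProj, inXCLM, xCLM, zCLM, phi, coshAr, sechHalfAr, tanhHalfAr]
    simp [e1, e2, smul_smul]
    rw [← neg_smul]
    congr 1
    field_simp
  · simp only [phiDeriv, aProj, zProj, inXCLM, xCLM, zCLM, phi, coshAr, sechHalfAr, tanhHalfAr]
    simp [e1]

/-- The Schwartz function whose pullback by `φ_ħ` is the derivative of the pullback of `f`. -/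
def pullbackDeriv (ħ : ℝ) {G : Type} [NormedAddCommGroup G] [NormedSpace ℝ G]
    (f : 𝓢(Coord V, G)) : 𝓢(Coord V, Coord V →L[ℝ] G) :=
  SchwartzMap.bilinLeftCLM (ContinuousLinearMap.compL ℝ (Coord V) (Coord V) G)
    (phiDeriv_temperate ħ) (SchwartzMap.fderivCLM ℝ (Coord V) G f)

/-- The derivative of a pullback is again the pullback of a Schwartz function, because the
coefficients of the derivative of `φ_ħ` are temperate at the image point. Induction then reaches all
orders; the target `G` must vary, since each derivative takes values in a new space of linear maps.
-/
theorem comp_phi_hasFDerivAt {ħ : ℝ} (hħ : ħ ≠ 0) {G : Type} [NormedAddCommGroup G]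
    [NormedSpace ℝ G] (f : 𝓢(Coord V, G)) (q : Coord V) :
    HasFDerivAt (fun q => f (phi ħ q)) (pullbackDeriv ħ f (phi ħ q)) q :=
  (f.hasFDerivAt (phi ħ q)).comp q (phi_hasFDerivAt hħ q)

theorem comp_phi_contDiff {ħ : ℝ} (hħ : ħ ≠ 0) (n : ℕ) : ∀ (G : Type) [NormedAddCommGroup G]
    [NormedSpace ℝ G] (f : 𝓢(Coord V, G)), ContDiff ℝ n fun q => f (phi ħ q) := by
  induction n with
  | zero =>
    intro G _ _ f
    exact contDiff_zero.2 (Differentiable.continuous (𝕜 := ℝ) fun q =>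
      (comp_phi_hasFDerivAt hħ f q).differentiableAt)
  | succ n ih =>
    intro G _ _ f
    push_cast
    rw [contDiff_succ_iff_fderiv]
    refine ⟨fun q => (comp_phi_hasFDerivAt hħ f q).differentiableAt, by simp, ?_⟩
    rw [funext fun q => (comp_phi_hasFDerivAt hħ f q).fderiv]
    exact ih _ (pullbackDeriv ħ f)

theorem cosh_le_one_add_abs_sinh (t : ℝ) : Real.cosh t ≤ 1 + |Real.sinh t| := by
  refine abs_le_of_sq_le_sq' ?_ (by positivity) |>.2
  nlinarith [Real.cosh_sq t, sq_abs (Real.sinh t), abs_nonneg (Real.sinh t)]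

theorem cosh_half_le_cosh (t : ℝ) : Real.cosh (t / 2) ≤ Real.cosh t := by
  rw [Real.cosh_le_cosh, abs_div, abs_two]
  linarith [abs_nonneg t]

theorem abs_le_abs_sinh (t : ℝ) : |t| ≤ |Real.sinh t| := by
  rcases le_total 0 t with h | h
  · rw [abs_of_nonneg h, abs_of_nonneg (Real.sinh_nonneg_iff.2 h)]
    exact Real.self_le_sinh_iff.2 h
  · rw [abs_of_nonpos h, abs_of_nonpos (Real.sinh_nonpos_iff.2 h)]
    exact neg_le_neg (Real.sinh_le_self_iff.2 h)

/-- Recovering `x` costs a factor `cosh (ħ ξ / 2)`, which is at most linear in the norm of the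
image; hence a quadratic bound. The coordinate `ξ` is controlled by `|t| ≤ |sinh t|`. -/
theorem norm_le_norm_phi {ħ : ℝ} (hħ : 0 < ħ) (q : Coord V) :
    ‖q‖ ≤ (1 + ħ) * (1 + ‖phi ħ q‖) ^ 2 := by
  obtain ⟨a, x, ξ⟩ := q
  set p := phi ħ (a, x, ξ) with hp
  have h1 : |a| ≤ ‖p‖ := norm_fst_le p
  have h2 : ‖(Real.cosh (ħ / 2 * ξ))⁻¹ • x‖ ≤ ‖p‖ := (norm_fst_le p.2).trans (norm_snd_le p)
  have h3 : |ħ⁻¹ * Real.sinh (ħ * ξ)| ≤ ‖p‖ := (norm_snd_le p.2).trans (norm_snd_le p)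
  have hc := Real.cosh_pos (ħ / 2 * ξ)
  rw [norm_smul, norm_inv, Real.norm_of_nonneg hc.le, inv_mul_le_iff₀ hc] at h2
  rw [abs_mul, abs_inv, abs_of_pos hħ, inv_mul_le_iff₀ hħ] at h3
  have h4 := abs_le_abs_sinh (ħ * ξ)
  rw [abs_mul, abs_of_pos hħ] at h4
  have h5 : |ξ| ≤ ‖p‖ := le_of_mul_le_mul_left (h4.trans h3) hħ
  have h6 : Real.cosh (ħ / 2 * ξ) ≤ 1 + ħ * ‖p‖ := by
    have := (cosh_half_le_cosh (ħ * ξ)).trans (cosh_le_one_add_abs_sinh _)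
    rw [show ħ * ξ / 2 = ħ / 2 * ξ by ring] at this
    linarith
  have hp0 := norm_nonneg p
  have h7 : ‖x‖ ≤ (1 + ħ * ‖p‖) * ‖p‖ := h2.trans (by gcongr)
  have hpp := mul_nonneg hħ.le hp0
  rw [Prod.norm_def, Prod.norm_def]
  refine max_le (h1.trans ?_) (max_le (h7.trans ?_) (h5.trans ?_)) <;>
    nlinarith [mul_nonneg hpp hp0]

theorem comp_phi_decay {ħ : ℝ} (hħ : 0 < ħ) (n k : ℕ) : ∀ (G : Type) [NormedAddCommGroup G]
    [NormedSpace ℝ G] (f : 𝓢(Coord V, G)), ∃ C : ℝ, ∀ q : Coord V,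
      ‖q‖ ^ k * ‖iteratedFDeriv ℝ n (fun q => f (phi ħ q)) q‖ ≤ C := by
  induction n with
  | zero =>
    intro G _ _ f
    -- The weight `‖q‖ ^ k` consumes decay of order `2k` of `f`, by the quadratic bound of
    -- `norm_le_norm_phi`.
    refine ⟨(1 + ħ) ^ k * (2 ^ (2 * k) * (Finset.Iic (2 * k, 0)).sup
      (fun m => SchwartzMap.seminorm ℝ m.1 m.2) f), fun q => ?_⟩
    have h := SchwartzMap.one_add_le_sup_seminorm_apply (𝕜 := ℝ) (m := (2 * k, 0)) le_rfl le_rfl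
      f (phi ħ q)
    rw [norm_iteratedFDeriv_zero] at h ⊢
    calc _ ≤ ((1 + ħ) * (1 + ‖phi ħ q‖) ^ 2) ^ k * ‖f (phi ħ q)‖ := by
          gcongr; exact norm_le_norm_phi hħ q
      _ = (1 + ħ) ^ k * ((1 + ‖phi ħ q‖) ^ (2 * k) * ‖f (phi ħ q)‖) := by
          rw [mul_pow, ← pow_mul, mul_assoc]
      _ ≤ _ := by gcongr
  | succ n ih =>
    intro G _ _ f
    obtain ⟨C, hC⟩ := ih _ (pullbackDeriv ħ f)
    refine ⟨C, fun q => ?_⟩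
    rw [← norm_iteratedFDeriv_fderiv,
      funext fun q => (comp_phi_hasFDerivAt hħ.ne' f q).fderiv]
    exact hC q

/-- The pullback of a Schwartz function by `φ_ħ`. -/
def pullbackPhi {ħ : ℝ} (hħ : 0 < ħ) (f : 𝓢(Coord V, ℂ)) : 𝓢(Coord V, ℂ) where
  toFun q := f (phi ħ q)
  smooth' := contDiff_infty.2 fun n => comp_phi_contDiff hħ.ne' n ℂ f
  decay' k n := comp_phi_decay hħ n k ℂ f

@[simp]
theorem pullbackPhi_apply {ħ : ℝ} (hħ : 0 < ħ) (f : 𝓢(Coord V, ℂ)) (q : Coord V) :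
    pullbackPhi hħ f q = f (phi ħ q) := rfl

/-- The map `T_ħ = F⁻¹ ∘ φ_ħ^* ∘ F` on Schwartz functions. -/
def transport {ħ : ℝ} (hħ : 0 < ħ) (u : 𝓢(Coord V, ℂ)) : 𝓢(Coord V, ℂ) :=
  partialFourierInv (pullbackPhi hħ (partialFourier u))

theorem transport_apply {ħ : ℝ} (hħ : 0 < ħ) (u : 𝓢(Coord V, ℂ)) (p : Coord V) :
    transport hħ u p = transportFun ħ u p :=
  partialFourierInv_apply _ p

theorem partialFourier_transport {ħ : ℝ} (hħ : 0 < ħ) (u : 𝓢(Coord V, ℂ)) (q : Coord V) :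
    partialFourier (transport hħ u) q = partialFourier u (phi ħ q) := by
  rw [transport, partialFourier_partialFourierInv, pullbackPhi_apply]

end Pullback

end

end ANQuant

namespace ANQuant

/-! ### Changes of variables, and the inverse of `τ_ħ` -/

noncomputable section

variable {V : Type} [NormedAddCommGroup V] [NormedSpace ℝ V] [MeasurableSpace V]
  [FiniteDimensional ℝ V] [BorelSpace V] (μ : Measure V) [μ.IsAddHaarMeasure]

theorem map_scale {c : ℝ} (hc : 0 < c) :
    Measure.map (fun w : ℝ × V => (w.1, c • w.2)) ((volume : Measure ℝ).prod μ) =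
      ENNReal.ofReal ((c ^ Module.finrank ℝ V)⁻¹) • (volume : Measure ℝ).prod μ := by
  have h1 := Measure.map_prod_map (volume : Measure ℝ) μ (measurable_id (α := ℝ))
    (measurable_const_smul c (α := V))
  rw [Measure.map_id, Measure.map_addHaar_smul μ hc.ne', abs_of_pos (by positivity)] at h1
  have h2 : Prod.map id (fun x : V => c • x) = fun w : ℝ × V => (w.1, c • w.2) := rfl
  rw [← h2, ← h1, Measure.prod_smul_right]

theorem integral_scale_smul {G : Type*} [NormedAddCommGroup G] [NormedSpace ℝ G] {c : ℝ}
    (hc : 0 < c) (g : ℝ × V → G) :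
    (c ^ Module.finrank ℝ V) • ∫ w, g (w.1, c • w.2) ∂((volume : Measure ℝ).prod μ) =
      ∫ w, g w ∂((volume : Measure ℝ).prod μ) := by
  have he : MeasurableEmbedding fun w : ℝ × V => (w.1, c • w.2) :=
    ((Homeomorph.refl ℝ).prodCongr (Homeomorph.smulOfNeZero c hc.ne')).measurableEmbedding
  have h := he.integral_map (μ := (volume : Measure ℝ).prod μ) g
  rw [map_scale μ hc, integral_smul_measure, ENNReal.toReal_ofReal (by positivity)] at h
  rw [← h, smul_smul, mul_inv_cancel₀ (by positivity), one_smul]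

theorem integral_scale {c : ℝ} (hc : 0 < c) (g : ℝ × V → ℂ) :
    ((c ^ Module.finrank ℝ V : ℝ) : ℂ) * ∫ w, g (w.1, c • w.2) ∂((volume : Measure ℝ).prod μ) =
      ∫ w, g w ∂((volume : Measure ℝ).prod μ) := by
  rw [← integral_scale_smul μ hc g, real_smul]

theorem integrable_scale {c : ℝ} (hc : 0 < c) {g : ℝ × V → ℂ}
    (hg : Integrable g ((volume : Measure ℝ).prod μ)) :
    Integrable (fun w => g (w.1, c • w.2)) ((volume : Measure ℝ).prod μ) := by
  have he : MeasurableEmbedding fun w : ℝ × V => (w.1, c • w.2) :=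
    ((Homeomorph.refl ℝ).prodCongr (Homeomorph.smulOfNeZero c hc.ne')).measurableEmbedding
  have := he.integrable_map_iff (μ := (volume : Measure ℝ).prod μ) (g := g)
  rw [map_scale μ hc] at this
  exact this.1 (hg.smul_measure (by simp))

theorem integral_sinh_subst {ħ : ℝ} (hħ : 0 < ħ) (H : ℝ → ℂ) :
    ∫ η, H η = ∫ ξ, (Real.cosh (ħ * ξ) : ℂ) * H (ħ⁻¹ * Real.sinh (ħ * ξ)) := by
  have hd : ∀ ξ ∈ (Set.univ : Set ℝ), HasDerivWithinAt (fun ξ : ℝ => ħ⁻¹ * Real.sinh (ħ * ξ))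
      (Real.cosh (ħ * ξ)) Set.univ ξ := by
    intro ξ _
    have := (((hasDerivAt_id ξ).const_mul ħ).sinh).const_mul ħ⁻¹
    refine (this.congr_deriv ?_).hasDerivWithinAt
    simp
    field_simp
  have hinj : Function.Injective fun ξ : ℝ => ħ⁻¹ * Real.sinh (ħ * ξ) := fun ξ ξ' h =>
    mul_left_cancel₀ hħ.ne' (Real.sinh_injective (mul_left_cancel₀ (inv_ne_zero hħ.ne') h))
  have hsurj : Function.Surjective fun ξ : ℝ => ħ⁻¹ * Real.sinh (ħ * ξ) := fun η =>
    ⟨ħ⁻¹ * Real.arsinh (ħ * η), by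
      simp only [mul_inv_cancel_left₀ hħ.ne', Real.sinh_arsinh, inv_mul_cancel_left₀ hħ.ne']⟩
  have h := integral_image_eq_integral_abs_deriv_smul MeasurableSet.univ hd hinj.injOn H
  rw [Set.image_univ, hsurj.range_eq, Measure.restrict_univ] at h
  rw [h]
  refine integral_congr_ae (.of_forall fun ξ => ?_)
  simp only [abs_of_pos (Real.cosh_pos (ħ * ξ)), real_smul]

/-- The Jacobian of `φ_ħ`. -/
def phiJac (ħ : ℝ) (q : Coord V) : ℝ :=
  Real.cosh (ħ * q.2.2) * ((Real.cosh (ħ / 2 * q.2.2))⁻¹) ^ Module.finrank ℝ V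

/-- `φ_ħ` is triangular: substitute `η = sinh (ħ ξ) / ħ` in the last coordinate, then scale `x` at
fixed `ξ`. The two integrability hypotheses serve Fubini on the two sides. -/
theorem integral_comp_phi {ħ : ℝ} (hħ : 0 < ħ) {F : Coord V → ℂ}
    (hF : Integrable F (coordMeasure μ))
    (hF' : Integrable (fun q => (phiJac ħ q : ℂ) * F (phi ħ q)) (coordMeasure μ)) :
    ∫ q, F q ∂(coordMeasure μ) = ∫ q, (phiJac ħ q : ℂ) * F (phi ħ q) ∂(coordMeasure μ) := by
  rw [integral_coordMeasure, integral_coordMeasure,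
    integral_prod_symm _ ((integrable_coordMeasure_iff μ).1 hF),
    integral_prod_symm _ ((integrable_coordMeasure_iff μ).1 hF'), integral_sinh_subst hħ]
  refine integral_congr_ae (.of_forall fun ξ => ?_)
  simp only
  rw [← integral_scale μ (inv_pos.2 (Real.cosh_pos (ħ / 2 * ξ))), ← mul_assoc,
    ← integral_const_mul]
  refine integral_congr_ae (.of_forall fun w => ?_)
  simp [phiJac, phi]

/-- The Schwartz function whose pullback by `φ_ħ` is the pullback of `f`, multiplied by the
Jacobian. -/
def mulJac (ħ : ℝ) : 𝓢(Coord V, ℂ) →L[ℂ] 𝓢(Coord V, ℂ) :=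
  SchwartzMap.smulLeftCLM ℂ fun q : Coord V =>
    ((coshAr ħ (zCLM q) * sechHalfAr ħ (zCLM q) ^ Module.finrank ℝ V : ℝ) : ℂ)

/-- As a function of the image point the Jacobian is a product of temperate functions. It is
therefore multiplied in before the pullback; as a function of `ξ` the factor `cosh (ħ ξ)` grows
exponentially. -/
theorem mulJac_apply_phi {ħ : ℝ} (hħ : 0 < ħ) (f : 𝓢(Coord V, ℂ)) (q : Coord V) :
    mulJac ħ f (phi ħ q) = phiJac ħ q * f (phi ħ q) := by
  have hz : ((zCLM : Coord V →L[ℝ] ℝ) : Coord V → ℝ).HasTemperateGrowth :=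
    ContinuousLinearMap.hasTemperateGrowth (zCLM : Coord V →L[ℝ] ℝ)
  have ht : (fun q : Coord V => ((coshAr ħ (zCLM q) *
      sechHalfAr ħ (zCLM q) ^ Module.finrank ℝ V : ℝ) : ℂ)).HasTemperateGrowth :=
    (ContinuousLinearMap.hasTemperateGrowth Complex.ofRealCLM).comp
      (((coshAr_temperate ħ).comp hz).mul
      (((sechHalfAr_temperate ħ).comp hz).pow _))
  rw [mulJac, SchwartzMap.smulLeftCLM_apply_apply ht, smul_eq_mul]
  congr 2
  have e1 : Real.arsinh (ħ * (ħ⁻¹ * Real.sinh (ħ * q.2.2))) = ħ * q.2.2 := by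
    rw [mul_inv_cancel_left₀ hħ.ne', Real.arsinh_sinh]
  have e2 : ħ * q.2.2 / 2 = ħ / 2 * q.2.2 := by ring
  simp [phiJac, coshAr, sechHalfAr, zCLM, phi, e1, e2]

/-! ### Duality, injectivity of `τ_ħ` and its inverse. -/

/-- Duality for the pullback by `φ_ħ⁻¹`. -/
theorem integral_mul_comp_phiInv {ħ : ℝ} (hħ : 0 < ħ) (f g : 𝓢(Coord V, ℂ)) :
    ∫ q, g q * f (phiInv ħ q) ∂(coordMeasure μ) =
      ∫ q, pullbackPhi hħ (mulJac ħ g) q * f q ∂(coordMeasure μ) := by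
  have h : ∀ q, (phiJac ħ q : ℂ) * (g (phi ħ q) * f (phiInv ħ (phi ħ q))) =
      pullbackPhi hħ (mulJac ħ g) q * f q := by
    intro q
    rw [pullbackPhi_apply, mulJac_apply_phi hħ, phiInv_phi hħ.ne', mul_assoc]
  rw [integral_comp_phi μ hħ (pullback_integrable μ ħ f g)
    ((schwartz_mul_integrable μ _ f).congr (.of_forall fun q => (h q).symm))]
  exact integral_congr_ae (.of_forall h)

/-- Every Schwartz function is some `F⁻¹ ψ`, so `τ_ħ u = 0` makes the continuous function `(F u) ∘
φ_ħ⁻¹` orthogonal to all compactly supported smooth functions. It vanishes, and `φ_ħ⁻¹` is onto. -/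
theorem tau_injective {ħ : ℝ} (hħ : 0 < ħ) : Function.Injective (tau μ ħ) := by
  rw [injective_iff_map_eq_zero]
  intro u hu
  have h0 : ∀ θ : 𝓢(Coord V, ℂ),
      ∫ q, θ q * partialFourier u (phiInv ħ q) ∂(coordMeasure μ) = 0 := by
    intro θ
    have := tau_apply μ ħ u (partialFourier θ)
    rw [partialFourierInv_partialFourier, hu] at this
    exact this.symm
  have hc : Continuous fun q : Coord V => partialFourier u (phiInv ħ q) :=
    (partialFourier u).continuous.comp (phiInv_continuous ħ)
  have h1 : ∀ᵐ q ∂(coordMeasure μ), partialFourier u (phiInv ħ q) = 0 := by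
    refine ae_eq_zero_of_integral_contDiff_smul_eq_zero hc.locallyIntegrable fun g hg hg' => ?_
    have hs : HasCompactSupport fun q => (g q : ℂ) := hg'.comp_left ofReal_zero
    have := h0 (hs.toSchwartzMap (Complex.ofRealCLM.contDiff.comp hg))
    simp only [real_smul]
    exact this
  have h2 : (fun q : Coord V => partialFourier u (phiInv ħ q)) = fun _ => 0 :=
    (hc.ae_eq_iff_eq (coordMeasure μ) continuous_const).1 h1
  have h3 : partialFourier u = 0 := by
    ext q
    have := congrFun h2 (phi ħ q)
    simpa [phiInv_phi hħ.ne'] using this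
  rw [← partialFourierInv_partialFourier u, h3, map_zero]

/-- The two pullbacks cancel, and what remains is the duality between `F` and `F⁻¹`. This places
Schwartz functions in `𝓔_ħ` and identifies `T_ħ` on them. -/
theorem tau_transport {ħ : ℝ} (hħ : 0 < ħ) (u : 𝓢(Coord V, ℂ)) :
    tau μ ħ (transport hħ u) = toDist μ u := by
  ext ψ
  have h : toDist μ u ψ = ∫ q, ψ q • u q ∂(coordMeasure μ) :=
    SchwartzMap.toTemperedDistributionCLM_apply_apply (coordMeasure μ) u ψ
  rw [tau_apply, h]
  simp only [partialFourier_transport, phi_phiInv hħ.ne', smul_eq_mul]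
  rw [integral_partialFourierInv_mul, partialFourierInv_partialFourier]

theorem toDist_mem_Espace {ħ : ℝ} (hħ : 0 < ħ) (u : 𝓢(Coord V, ℂ)) : toDist μ u ∈ Espace μ ħ :=
  ⟨transport hħ u, tau_transport μ hħ u⟩

/-- The inverse of `τ_ħ`. -/
def tauInv {ħ : ℝ} (hħ : 0 < ħ) : Espace μ ħ ≃ₗ[ℂ] 𝓢(Coord V, ℂ) :=
  (LinearEquiv.ofInjective (tau μ ħ) (tau_injective μ hħ)).symm

theorem tauInv_tauE {ħ : ℝ} (hħ : 0 < ħ) (u : 𝓢(Coord V, ℂ)) : tauInv μ hħ (tauE μ ħ u) = u :=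
  (LinearEquiv.ofInjective (tau μ ħ) (tau_injective μ hħ)).symm_apply_apply u

theorem tauInv_toDist {ħ : ℝ} (hħ : 0 < ħ) (u : 𝓢(Coord V, ℂ)) (hu : toDist μ u ∈ Espace μ ħ) :
    tauInv μ hħ ⟨toDist μ u, hu⟩ = transport hħ u := by
  rw [← tauInv_tauE μ hħ (transport hħ u)]
  congr 1
  exact Subtype.ext (tau_transport μ hħ u).symm

end

end ANQuant

namespace ANQuant

/-! ### The Weyl product of a symplectic vector space -/

noncomputable section

/-- The phase factor `exp (i t)`. -/
def ph (t : ℝ) : ℂ := cexp (I * (t : ℂ))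

theorem norm_ph (t : ℝ) : ‖ph t‖ = 1 := norm_cexp_I_mul t

theorem ph_add (s t : ℝ) : ph (s + t) = ph s * ph t := by
  rw [ph, ph, ph, ← Complex.exp_add]
  push_cast
  ring_nf

@[fun_prop]
theorem continuous_ph : Continuous ph := by
  unfold ph
  fun_prop

theorem Integrable.ph_mul {α : Type*} [TopologicalSpace α] [MeasurableSpace α]
    [OpensMeasurableSpace α] {m : Measure α} {θ : α → ℝ}
    (hθ : Continuous θ) {f : α → ℂ} (hf : Integrable f m) :
    Integrable (fun x => ph (θ x) * f x) m :=
  hf.bdd_mul (c := 1) (continuous_ph.comp hθ).measurable.aestronglyMeasurable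
    (.of_forall fun x => (norm_ph (θ x)).le)

section Weyl

variable {X : Type} [NormedAddCommGroup X] [NormedSpace ℝ X] [FiniteDimensional ℝ X]

theorem continuous_bilin (B : X →ₗ[ℝ] X →ₗ[ℝ] ℝ) : Continuous fun p : X × X => B p.1 p.2 :=
  ((LinearMap.toContinuousLinearMap (E := X) (F' := X →L[ℝ] ℝ)
    (LinearMap.toContinuousLinearMap.toLinearMap ∘ₗ B)).isBoundedBilinearMap).continuous

@[fun_prop]
theorem Continuous.bilin {Y : Type*} [TopologicalSpace Y] (B : X →ₗ[ℝ] X →ₗ[ℝ] ℝ) {f g : Y → X}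
    (hf : Continuous f) (hg : Continuous g) : Continuous fun y => B (f y) (g y) :=
  (continuous_bilin B).comp (hf.prodMk hg)

theorem bilin_temperate (B : X →ₗ[ℝ] X →ₗ[ℝ] ℝ) :
    (fun p : X × X => B p.1 p.2).HasTemperateGrowth :=
  (LinearMap.toContinuousLinearMap (E := X) (F' := X →L[ℝ] ℝ)
    (LinearMap.toContinuousLinearMap.toLinearMap ∘ₗ B)).bilinear_hasTemperateGrowth
      (ContinuousLinearMap.fst ℝ X X).hasTemperateGrowth
      (ContinuousLinearMap.snd ℝ X X).hasTemperateGrowth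

variable [MeasurableSpace X] [BorelSpace X] (ν : Measure X) [ν.IsAddHaarMeasure]
  (B : X →ₗ[ℝ] X →ₗ[ℝ] ℝ)

/-- The integral `∫∫ exp (i S⁰(p₀, p₁, p₂)) f(p₁) g(p₂) dp₁ dp₂`. -/
def weylIntegral (f g : 𝓢(X, ℂ)) (p₀ : X) : ℂ :=
  ∫ p : X × X, ph (S0 (fun x y => B x y) p₀ p.1 p.2) * (f p.1 * g p.2) ∂(ν.prod ν)

theorem weylIntegrand_integrable (f g : 𝓢(X, ℂ)) (p₀ : X) :
    Integrable (fun p : X × X => ph (S0 (fun x y => B x y) p₀ p.1 p.2) * (f p.1 * g p.2))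
      (ν.prod ν) := by
  refine Integrable.ph_mul ?_ (f.integrable.mul_prod g.integrable)
  unfold S0
  fun_prop

/-- The phase is `B(p, p₁ - p₂) + B(p₁, p₂)`. So the integral is the Fourier transform of the
Schwartz function `exp(i B(p₁, p₂)) f(p₁) g(p₂)`, restricted to the frequencies `B(p, p₁ - p₂)`,
which depend injectively on `p`. -/
theorem exists_weyl_schwartz (hB : Function.Injective B) (hB' : ∀ x y, B x y = -B y x)
    (f g : 𝓢(X, ℂ)) : ∃ h : 𝓢(X, ℂ), ∀ p, h p = weylIntegral ν B f g p := by
  let A : X →ₗ[ℝ] (X × X) →ₗ[ℝ] ℝ :=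
    LinearMap.lcomp ℝ ℝ (LinearMap.fst ℝ X X - LinearMap.snd ℝ X X) ∘ₗ B
  have hA : Function.Injective A := by
    intro p q h
    refine hB (LinearMap.ext fun x => ?_)
    simpa [A] using LinearMap.congr_fun h (x, 0)
  have ht : (fun p : X × X => ph (B p.1 p.2)).HasTemperateGrowth :=
    hasTemperateGrowth_cexp_I_mul.comp (bilin_temperate B)
  obtain ⟨h, hh⟩ := exists_schwartz_fourier (ν.prod ν) A hA
    (SchwartzMap.smulLeftCLM ℂ (fun p : X × X => ph (B p.1 p.2)) (schwartzTensor f g))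
  refine ⟨h, fun p => ?_⟩
  rw [hh, weylIntegral]
  refine integral_congr_ae (.of_forall fun y => ?_)
  simp only [SchwartzMap.smulLeftCLM_apply_apply ht, schwartzTensor_apply, smul_eq_mul]
  rw [← ph, ← mul_assoc, ← ph_add]
  congr 2
  simp only [A, S0, LinearMap.comp_apply, LinearMap.lcomp_apply, LinearMap.sub_apply,
    LinearMap.fst_apply, LinearMap.snd_apply, map_sub, hB' y.2 p]
  ring

/-- The product `(f, g) ↦ c ∫∫ exp (i S⁰(·, p₁, p₂)) f(p₁) g(p₂) dp₁ dp₂` of Schwartz functions. -/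
def weylProduct (hB : Function.Injective B) (hB' : ∀ x y, B x y = -B y x) (c : ℂ) :
    𝓢(X, ℂ) →ₗ[ℂ] 𝓢(X, ℂ) →ₗ[ℂ] 𝓢(X, ℂ) :=
  LinearMap.mk₂ ℂ (fun f g => c • (exists_weyl_schwartz ν B hB hB' f g).choose)
    (fun f f' g => by
      ext p
      simp only [_root_.add_apply, _root_.smul_apply,
        (exists_weyl_schwartz ν B hB hB' _ _).choose_spec, ← smul_add]
      rw [weylIntegral, weylIntegral, weylIntegral, ← integral_add
        (weylIntegrand_integrable ν B _ _ p) (weylIntegrand_integrable ν B _ _ p)]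
      simp only [_root_.add_apply, add_mul, mul_add])
    (fun a f g => by
      ext p
      simp only [_root_.smul_apply, (exists_weyl_schwartz ν B hB hB' _ _).choose_spec]
      rw [weylIntegral, weylIntegral, smul_comm a, ← integral_smul a]
      congr 1
      refine integral_congr_ae (.of_forall fun q => ?_)
      simp only [_root_.smul_apply, smul_eq_mul]
      ring)
    (fun f g g' => by
      ext p
      simp only [_root_.add_apply, _root_.smul_apply,
        (exists_weyl_schwartz ν B hB hB' _ _).choose_spec, ← smul_add]
      rw [weylIntegral, weylIntegral, weylIntegral, ← integral_add
        (weylIntegrand_integrable ν B _ _ p) (weylIntegrand_integrable ν B _ _ p)]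
      simp only [_root_.add_apply, mul_add])
    (fun a f g => by
      ext p
      simp only [_root_.smul_apply, (exists_weyl_schwartz ν B hB hB' _ _).choose_spec]
      rw [weylIntegral, weylIntegral, smul_comm a, ← integral_smul a]
      congr 1
      refine integral_congr_ae (.of_forall fun q => ?_)
      simp only [_root_.smul_apply, smul_eq_mul]
      ring)

theorem weylProduct_apply (hB : Function.Injective B) (hB' : ∀ x y, B x y = -B y x) (c : ℂ)
    (f g : 𝓢(X, ℂ)) (p : X) :
    weylProduct ν B hB hB' c f g p = c * weylIntegral ν B f g p := by
  rw [← (exists_weyl_schwartz ν B hB hB' f g).choose_spec]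
  rfl

/-- The symplectic Fourier transform. -/
def sympFourier (hB : Function.Injective B) (f : 𝓢(X, ℂ)) : 𝓢(X, ℂ) :=
  (exists_schwartz_fourier ν B hB f).choose

theorem sympFourier_apply (hB : Function.Injective B) (f : 𝓢(X, ℂ)) (q : X) :
    sympFourier ν B hB f q = ∫ y, ph (B q y) * f y ∂ν :=
  (exists_schwartz_fourier ν B hB f).choose_spec q

/-- Substituting `p₂ = p - q` turns the phase into `B(p, q) + B(q, p₁)`, and the integral over `p₁`
is a symplectic Fourier transform. -/
theorem weylIntegral_eq_left (hB : Function.Injective B) (hB' : ∀ x y, B x y = -B y x)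
    (f g : 𝓢(X, ℂ)) (p : X) :
    weylIntegral ν B f g p =
      ∫ q, ph (B p q) * (sympFourier ν B hB f q * g (p - q)) ∂ν := by
  have h0 : ∀ x, B x x = 0 := fun x => by linarith [hB' x x]
  rw [weylIntegral, integral_prod_symm _ (weylIntegrand_integrable ν B f g p),
    ← integral_sub_left_eq_self (fun q => ∫ x, ph (S0 (fun x y => B x y) p x q) *
      (f x * g q) ∂ν) ν p]
  refine integral_congr_ae (.of_forall fun q => ?_)
  simp only
  rw [sympFourier_apply, ← mul_assoc, ← integral_const_mul, ← integral_mul_const]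
  refine integral_congr_ae (.of_forall fun x => ?_)
  simp only
  rw [← mul_assoc, ← mul_assoc, ← ph_add]
  congr 3
  simp only [S0, map_sub, LinearMap.sub_apply, h0, hB' x p, hB' q p, hB' x q]
  ring

/-- The mirror image of `weylIntegral_eq_left`, with `p₁ = p + q` and the transform falling on `g`.
-/
theorem weylIntegral_eq_right (hB : Function.Injective B) (hB' : ∀ x y, B x y = -B y x)
    (f g : 𝓢(X, ℂ)) (p : X) :
    weylIntegral ν B f g p =
      ∫ q, ph (B p q) * (f (p + q) * sympFourier ν B hB g q) ∂ν := by
  have h0 : ∀ x, B x x = 0 := fun x => by linarith [hB' x x]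
  rw [weylIntegral, integral_prod _ (weylIntegrand_integrable ν B f g p),
    ← integral_add_left_eq_self (fun q => ∫ x, ph (S0 (fun x y => B x y) p q x) *
      (f q * g x) ∂ν) p]
  refine integral_congr_ae (.of_forall fun q => ?_)
  simp only
  rw [sympFourier_apply, ← mul_assoc, ← integral_const_mul]
  refine integral_congr_ae (.of_forall fun x => ?_)
  simp only
  rw [show ph (B p q) * f (p + q) * (ph (B q x) * g x) =
    ph (B p q) * ph (B q x) * (f (p + q) * g x) by ring, ← ph_add]
  congr 2
  simp only [S0, map_add, LinearMap.add_apply, h0, hB' x p]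
  ring

/-- Fourier inversion for the shifted factor shows that the product is a twisted convolution of the
transforms, with cocycle `exp(i B(r, q))`. The value of `k` is irrelevant for associativity. -/
theorem exists_weylIntegral_eq (hB : Function.Injective B) (hB' : ∀ x y, B x y = -B y x) :
    ∃ k : ℂ, ∀ (f g : 𝓢(X, ℂ)) (p : X), weylIntegral ν B f g p =
      k * ∫ r, ∫ q, ph (B p (q + r) + B r q) *
        (sympFourier ν B hB f q * sympFourier ν B hB g r) ∂ν ∂ν := by
  obtain ⟨k, hk⟩ := exists_fourier_inversion ν B hB
  refine ⟨k, fun f g p => ?_⟩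
  rw [weylIntegral_eq_right ν B hB hB', ← integral_const_mul]
  refine integral_congr_ae (.of_forall fun r => ?_)
  simp only
  rw [hk f, show ∀ a b d : ℂ, a * (k * b * d) = k * (a * (b * d)) by intros; ring,
    ← integral_mul_const, ← integral_const_mul, ← integral_const_mul, ← integral_const_mul]
  refine integral_congr_ae (.of_forall fun q => ?_)
  simp only
  rw [show cexp (-(I * (B q (p + r) : ℂ))) = ph (-B q (p + r)) by rw [ph]; push_cast; ring_nf]
  change k * (ph _ * (ph _ * (∫ y, ph (B q y) * f y ∂ν) * _)) = _
  rw [← sympFourier_apply ν B hB f q]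
  rw [show ∀ a b c d : ℂ, k * (a * (b * c * d)) = k * (a * b * (c * d)) by intros; ring, ← ph_add]
  congr 3
  simp only [map_add, hB' q p, hB' q r]
  ring

/-- The Weyl product is associative. -/
theorem weylProduct_assoc (hB : Function.Injective B) (hB' : ∀ x y, B x y = -B y x) (c : ℂ)
    (f g h : 𝓢(X, ℂ)) :
    weylProduct ν B hB hB' c (weylProduct ν B hB hB' c f g) h =
      weylProduct ν B hB hB' c f (weylProduct ν B hB hB' c g h) := by
  obtain ⟨k, hk⟩ := exists_weylIntegral_eq ν B hB hB'
  ext p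
  set F := sympFourier ν B hB f
  set G := sympFourier ν B hB g
  set H := sympFourier ν B hB h
  -- Both bracketings reduce to the integral of this one function: the cocycle terms run over the
  -- pairs from `h` to `g`, `h` to `f` and `g` to `f`. One side integrates the variable `q` of `f`
  -- first, the other last.
  let Θ : X × X → X → ℂ := fun s q =>
    ph (B p (q + s.2 + s.1) + B s.1 q + B s.1 s.2 + B s.2 q) * (H s.1 * G s.2 * F q)
  have h_int : Integrable (Function.uncurry Θ) ((ν.prod ν).prod ν) := by
    refine Integrable.ph_mul ?_ ((H.integrable.mul_prod G.integrable).mul_prod F.integrable)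
    fun_prop
  have h_int' : ∀ q, Integrable (fun s => Θ s q) (ν.prod ν) := by
    intro q
    refine Integrable.ph_mul ?_ ((H.integrable.mul_prod G.integrable).mul_const (F q))
    fun_prop
  have h1 : weylIntegral ν B (weylProduct ν B hB hB' c f g) h p =
      c * k * ∫ s, ∫ q, Θ s q ∂ν ∂(ν.prod ν) := by
    rw [weylIntegral_eq_right ν B hB hB',
      integral_prod (fun s => ∫ q, Θ s q ∂ν) h_int.integral_prod_left,
      ← integral_const_mul]
    refine integral_congr_ae (.of_forall fun r => ?_)
    simp only [weylProduct_apply]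
    rw [hk, show ∀ a b d : ℂ, a * (c * (k * b) * d) = c * k * (a * (b * d)) by intros; ring,
      ← integral_mul_const, ← integral_const_mul]
    congr 1
    refine integral_congr_ae (.of_forall fun s => ?_)
    simp only
    rw [← integral_mul_const, ← integral_const_mul]
    refine integral_congr_ae (.of_forall fun q => ?_)
    simp only [Θ]
    rw [show ∀ a b d e i : ℂ, a * (b * (d * e) * i) = a * b * (i * e * d) by intros; ring,
      ← ph_add]
    congr 2
    simp only [map_add, LinearMap.add_apply]
    ring
  have h2 : weylIntegral ν B f (weylProduct ν B hB hB' c g h) p =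
      c * k * ∫ q, ∫ s, Θ s q ∂(ν.prod ν) ∂ν := by
    rw [weylIntegral_eq_left ν B hB hB', ← integral_const_mul]
    refine integral_congr_ae (.of_forall fun q => ?_)
    simp only [weylProduct_apply]
    rw [hk, integral_prod _ (h_int' q),
      show ∀ a b d : ℂ, a * (d * (c * (k * b))) = c * k * (a * (d * b)) by intros; ring,
      ← integral_const_mul, ← integral_const_mul]
    congr 1
    refine integral_congr_ae (.of_forall fun r => ?_)
    simp only
    rw [← integral_const_mul, ← integral_const_mul]
    refine integral_congr_ae (.of_forall fun s => ?_)
    simp only [Θ]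
    rw [show ∀ a b d e i : ℂ, a * (b * (d * (e * i))) = a * d * (i * e * b) by intros; ring,
      ← ph_add]
    congr 2
    simp only [map_add, map_sub, LinearMap.sub_apply, hB' q s, hB' q r]
    ring
  rw [weylProduct_apply, weylProduct_apply, h1, h2, integral_integral_swap h_int]

end Weyl

end

end ANQuant

namespace ANQuant

/-! ### Integrals over pairs of points -/

theorem measurePreserving_prodProdProdComm {α β γ δ : Type*} [MeasurableSpace α]
    [MeasurableSpace β] [MeasurableSpace γ] [MeasurableSpace δ] (ma : Measure α) (mb : Measure β)
    (mc : Measure γ) (md : Measure δ) [SFinite ma] [SFinite mb] [SFinite mc] [SFinite md] :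
    MeasurePreserving (fun p : (α × β) × (γ × δ) => ((p.1.1, p.2.1), (p.1.2, p.2.2)))
      ((ma.prod mb).prod (mc.prod md)) ((ma.prod mc).prod (mb.prod md)) := by
  have h1 : MeasurePreserving (MeasurableEquiv.prodAssoc : (α × β) × (γ × δ) ≃ᵐ _)
    ((ma.prod mb).prod (mc.prod md)) (ma.prod (mb.prod (mc.prod md))) :=
    ⟨MeasurableEquiv.prodAssoc.measurable, Measure.prodAssoc_prod⟩
  have h2 : MeasurePreserving (MeasurableEquiv.prodAssoc : (α × γ) × (β × δ) ≃ᵐ _)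
    ((ma.prod mc).prod (mb.prod md)) (ma.prod (mc.prod (mb.prod md))) :=
    ⟨MeasurableEquiv.prodAssoc.measurable, Measure.prodAssoc_prod⟩
  have h3 : MeasurePreserving (MeasurableEquiv.prodAssoc : (β × γ) × δ ≃ᵐ _)
    ((mb.prod mc).prod md) (mb.prod (mc.prod md)) :=
    ⟨MeasurableEquiv.prodAssoc.measurable, Measure.prodAssoc_prod⟩
  have h4 : MeasurePreserving (MeasurableEquiv.prodAssoc : (γ × β) × δ ≃ᵐ _)
    ((mc.prod mb).prod md) (mc.prod (mb.prod md)) :=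
    ⟨MeasurableEquiv.prodAssoc.measurable, Measure.prodAssoc_prod⟩
  have h5 := h4.comp (((Measure.measurePreserving_swap (μ := mb) (ν := mc)).prod
    (MeasurePreserving.id md)).comp (h3.symm _))
  exact (h2.symm _).comp (((MeasurePreserving.id ma).prod h5).comp h1)

section Pairs

variable {V : Type} [NormedAddCommGroup V] [NormedSpace ℝ V] [MeasurableSpace V]
  [FiniteDimensional ℝ V] [BorelSpace V] (μ : Measure V) [μ.IsAddHaarMeasure]

/-- The pairs of points of the coordinate space, with the last coordinates split off. -/
noncomputable def pairHomeo : ((ℝ × V) × (ℝ × V)) × (ℝ × ℝ) ≃ₜ Coord V × Coord V where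
  toFun r := ((r.1.1.1, r.1.1.2, r.2.1), (r.1.2.1, r.1.2.2, r.2.2))
  invFun q := (((q.1.1, q.1.2.1), (q.2.1, q.2.2.1)), (q.1.2.2, q.2.2.2))
  left_inv _ := rfl
  right_inv _ := rfl
  continuous_toFun := by fun_prop
  continuous_invFun := by fun_prop

theorem measurePreserving_pairHomeo :
    MeasurePreserving (pairHomeo (V := V))
      ((((volume : Measure ℝ).prod μ).prod ((volume : Measure ℝ).prod μ)).prod
        (volume : Measure (ℝ × ℝ))) ((coordMeasure μ).prod (coordMeasure μ)) :=
  ((measurePreserving_coord μ).prod (measurePreserving_coord μ)).comp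
    (measurePreserving_prodProdProdComm _ _ _ _)

theorem integral_pair (F : Coord V × Coord V → ℂ) :
    ∫ q, F q ∂((coordMeasure μ).prod (coordMeasure μ)) =
      ∫ r, F (pairHomeo r) ∂((((volume : Measure ℝ).prod μ).prod
        ((volume : Measure ℝ).prod μ)).prod (volume : Measure (ℝ × ℝ))) :=
  ((measurePreserving_pairHomeo μ).integral_comp pairHomeo.measurableEmbedding F).symm

theorem integrable_pair_iff {F : Coord V × Coord V → ℂ} :
    Integrable F ((coordMeasure μ).prod (coordMeasure μ)) ↔
      Integrable (fun r => F (pairHomeo r)) ((((volume : Measure ℝ).prod μ).prod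
        ((volume : Measure ℝ).prod μ)).prod (volume : Measure (ℝ × ℝ))) :=
  ((measurePreserving_pairHomeo μ).integrable_comp_emb pairHomeo.measurableEmbedding).symm

/-- Scaling `x` by a factor that depends on further variables. -/
theorem integral_scale_param {Y : Type*} [TopologicalSpace Y] [SecondCountableTopology Y]
    [MeasurableSpace Y] [BorelSpace Y] (n : Measure Y) [SFinite n] {c : Y → ℝ}
    (hc : Continuous c) (hc0 : ∀ y, 0 < c y) {H : (ℝ × V) × Y → ℂ} (hH : Continuous H)
    (h_int : Integrable H (((volume : Measure ℝ).prod μ).prod n)) :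
    Integrable (fun r : (ℝ × V) × Y => ((c r.2 ^ Module.finrank ℝ V : ℝ) : ℂ) *
      H ((r.1.1, c r.2 • r.1.2), r.2)) (((volume : Measure ℝ).prod μ).prod n) ∧
    ∫ r : (ℝ × V) × Y, ((c r.2 ^ Module.finrank ℝ V : ℝ) : ℂ) *
      H ((r.1.1, c r.2 • r.1.2), r.2) ∂(((volume : Measure ℝ).prod μ).prod n) =
      ∫ r, H r ∂(((volume : Measure ℝ).prod μ).prod n) := by
  have hcont : Continuous fun r : (ℝ × V) × Y => ((c r.2 ^ Module.finrank ℝ V : ℝ) : ℂ) *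
      H ((r.1.1, c r.2 • r.1.2), r.2) := by fun_prop
  have h1 := (integrable_prod_iff' hH.aestronglyMeasurable).1 h_int
  have hi : Integrable (fun r : (ℝ × V) × Y => ((c r.2 ^ Module.finrank ℝ V : ℝ) : ℂ) *
      H ((r.1.1, c r.2 • r.1.2), r.2)) (((volume : Measure ℝ).prod μ).prod n) := by
    rw [integrable_prod_iff' hcont.aestronglyMeasurable]
    refine ⟨?_, ?_⟩
    · filter_upwards [h1.1] with y hy
      exact (integrable_scale μ (hc0 y) hy).const_mul _
    · refine h1.2.congr (.of_forall fun y => ?_)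
      simp only
      rw [← integral_scale_smul μ (hc0 y), smul_eq_mul, ← integral_const_mul]
      refine integral_congr_ae (.of_forall fun w => ?_)
      simp only [norm_mul, norm_real]
      rw [Real.norm_of_nonneg (pow_nonneg (hc0 y).le _)]
  refine ⟨hi, ?_⟩
  rw [integral_prod_symm _ hi, integral_prod_symm _ h_int]
  refine integral_congr_ae (.of_forall fun y => ?_)
  simp only
  rw [← integral_scale μ (hc0 y) fun x => H (x, y), ← integral_const_mul]

end Pairs

end ANQuant

namespace ANQuant

/-! ### The three-point kernel -/

noncomputable section

section Kernel

variable {V : Type} [NormedAddCommGroup V] [NormedSpace ℝ V]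

/-- An integrable weight on `ℝ`. -/
def wtA (b : ℝ) : ℝ := (1 + b ^ 2)⁻¹

variable (V) in
/-- An integrable weight on `V`. -/
def wtX (x : V) : ℝ := ((1 + ‖x‖) ^ (Module.finrank ℝ V + 1))⁻¹

/-- An integrable weight on `(ℝ × V) × (ℝ × V)`. -/
def wtPair (a₀ : ℝ) (y : (ℝ × V) × (ℝ × V)) : ℝ :=
  (wtA (a₀ - y.1.1) * wtX V y.1.2) * (wtA (y.2.1 - a₀) * wtX V y.2.2)

theorem wtA_nonneg (b : ℝ) : 0 ≤ wtA b := by unfold wtA; positivity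

theorem wtX_nonneg (x : V) : 0 ≤ wtX V x := by unfold wtX; positivity

theorem wtA_le_one (b : ℝ) : wtA b ≤ 1 := inv_le_one_of_one_le₀ (by nlinarith [sq_nonneg b])

theorem wtX_le_one (x : V) : wtX V x ≤ 1 :=
  inv_le_one_of_one_le₀ (one_le_pow₀ (by linarith [norm_nonneg x]))

theorem wtPair_le_one (a₀ : ℝ) (y : (ℝ × V) × (ℝ × V)) : wtPair a₀ y ≤ 1 := by
  refine mul_le_one₀ ?_ (mul_nonneg (wtA_nonneg _) (wtX_nonneg _)) ?_ <;>
    exact mul_le_one₀ (wtA_le_one _) (wtX_nonneg _) (wtX_le_one _)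

theorem one_add_sq_le_cosh (b : ℝ) : 1 + b ^ 2 ≤ Real.cosh (2 * b) := by
  have h1 := Real.cosh_two_mul b
  have h2 := Real.cosh_sq b
  have h3 : b ^ 2 ≤ Real.sinh b ^ 2 := sq_le_sq.2 (abs_le_abs_sinh b)
  nlinarith [sq_nonneg b]

/-- The decay of a Schwartz function at points whose last coordinate is `sinh (2b) / ħ`. -/
theorem schwartz_decay_sinh {ħ : ℝ} (hħ : 0 < ħ) (f : 𝓢(Coord V, ℂ)) :
    ∃ C : ℝ, 0 ≤ C ∧ ∀ (a : ℝ) (x : V) (b : ℝ),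
      ‖f (a, x, ħ⁻¹ * Real.sinh (2 * b))‖ * Real.cosh (2 * b) ^ (Module.finrank ℝ V + 1) ≤
        C * (wtA b * wtX V x) := by
  set d := Module.finrank ℝ V
  -- Of the `d + 2` powers of `cosh (2b)`, `d + 1` are kept to absorb the amplitude and one yields
  -- `1 + b²`. The other `d + 1` powers make the weight in `x` integrable on a space of dimension
  -- `d`.
  set K := 2 ^ (d + 2 + (d + 1)) * (Finset.Iic (d + 2 + (d + 1), 0)).sup
    (fun m => SchwartzMap.seminorm ℝ m.1 m.2) f with hK
  have hK0 : 0 ≤ K := by rw [hK]; positivity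
  refine ⟨(1 + ħ) ^ (d + 2) * K, by positivity, fun a x b => ?_⟩
  set q : Coord V := (a, x, ħ⁻¹ * Real.sinh (2 * b)) with hq
  have h0 := SchwartzMap.one_add_le_sup_seminorm_apply (𝕜 := ℝ) (m := (d + 2 + (d + 1), 0)) le_rfl
    le_rfl f q
  rw [norm_iteratedFDeriv_zero, ← hK] at h0
  have hx : ‖x‖ ≤ ‖q‖ := (norm_fst_le q.2).trans (norm_snd_le q)
  have hη : |ħ⁻¹ * Real.sinh (2 * b)| ≤ ‖q‖ := (norm_snd_le q.2).trans (norm_snd_le q)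
  rw [abs_mul, abs_inv, abs_of_pos hħ, inv_mul_le_iff₀ hħ] at hη
  have hc : Real.cosh (2 * b) ≤ (1 + ħ) * (1 + ‖q‖) := by
    have := cosh_le_one_add_abs_sinh (2 * b)
    nlinarith [norm_nonneg q]
  have hc0 := Real.cosh_pos (2 * b)
  have h1 : ‖f q‖ * Real.cosh (2 * b) ^ (d + 2) * (1 + ‖x‖) ^ (d + 1) ≤ (1 + ħ) ^ (d + 2) * K := by
    calc _ ≤ ‖f q‖ * ((1 + ħ) * (1 + ‖q‖)) ^ (d + 2) * (1 + ‖q‖) ^ (d + 1) := by gcongr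
      _ = (1 + ħ) ^ (d + 2) * ((1 + ‖q‖) ^ (d + 2 + (d + 1)) * ‖f q‖) := by
        rw [mul_pow, pow_add (1 + ‖q‖) (d + 2)]
        ring
      _ ≤ _ := by gcongr
  have h2 : ‖f q‖ * Real.cosh (2 * b) ^ (d + 1) * (1 + b ^ 2) * (1 + ‖x‖) ^ (d + 1) ≤
      (1 + ħ) ^ (d + 2) * K := by
    refine le_trans ?_ h1
    rw [pow_succ _ (d + 1), ← mul_assoc ‖f q‖]
    gcongr
    exact one_add_sq_le_cosh b
  rw [wtA, wtX, ← mul_inv, ← div_eq_mul_inv, le_div_iff₀ (by positivity), ← mul_assoc]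
  exact h2

theorem cosh_add_le (s t : ℝ) : Real.cosh (s + t) ≤ 2 * (Real.cosh s * Real.cosh t) := by
  have h1 := Real.cosh_add s t
  have h2 := Real.cosh_sub s t
  linarith [Real.cosh_pos (s - t)]

/-- Since `a₂ - a₁` is the sum of `a₂ - a₀` and `a₀ - a₁`, the amplitude is controlled by these two
differences, which are exactly the ones in which the transforms of `u` and `v` decay. -/
theorem cosh_amplitude_le (a₀ a₁ a₂ : ℝ) (d : ℕ) :
    Real.cosh (2 * (a₁ - a₂)) * (Real.cosh (a₂ - a₀) * Real.cosh (a₀ - a₁)) ^ d ≤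
      2 * (Real.cosh (2 * (a₂ - a₀)) ^ (d + 1) * Real.cosh (2 * (a₀ - a₁)) ^ (d + 1)) := by
  have h1 : Real.cosh (2 * (a₁ - a₂)) ≤
      2 * (Real.cosh (2 * (a₂ - a₀)) * Real.cosh (2 * (a₀ - a₁))) := by
    have := cosh_add_le (2 * (a₂ - a₀)) (2 * (a₀ - a₁))
    rwa [show 2 * (a₂ - a₀) + 2 * (a₀ - a₁) = -(2 * (a₁ - a₂)) by ring, Real.cosh_neg] at this
  have hh : ∀ t, Real.cosh t ≤ Real.cosh (2 * t) := by
    intro t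
    have := cosh_half_le_cosh (2 * t)
    rwa [mul_div_cancel_left₀ t two_ne_zero] at this
  have hp := fun t => Real.cosh_pos t
  calc _ ≤ 2 * (Real.cosh (2 * (a₂ - a₀)) * Real.cosh (2 * (a₀ - a₁))) *
        (Real.cosh (2 * (a₂ - a₀)) * Real.cosh (2 * (a₀ - a₁))) ^ d := by
        have p1 := (hp (a₂ - a₀)).le
        have p2 := (hp (a₀ - a₁)).le
        have p3 := (hp (2 * (a₂ - a₀))).le
        have p4 := (hp (2 * (a₀ - a₁))).le
        gcongr
        · exact hh _
        · exact hh _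
    _ = _ := by rw [mul_pow]; ring

variable (ωB : V →ₗ[ℝ] V →ₗ[ℝ] ℝ) (ħ : ℝ) (u v : 𝓢(Coord V, ℂ))

/-- The integrand of the Weyl product of `T_ħ u` and `T_ħ v` after integration over `z₁, z₂`. -/
def kerW (w : ℝ × V) (y : (ℝ × V) × (ℝ × V)) : ℂ :=
  ph (2 / ħ * S0 (fun x y => ωB x y) w.2 y.1.2 y.2.2) *
    (partialFourier u (phi ħ (y.1.1, y.1.2, 2 / ħ * (y.2.1 - w.1))) *
      partialFourier v (phi ħ (y.2.1, y.2.2, 2 / ħ * (w.1 - y.1.1))))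

/-- The function `kerW` after scaling `x₁` and `x₂`. -/
def kerS (w : ℝ × V) (y : (ℝ × V) × (ℝ × V)) : ℂ :=
  (((Real.cosh (y.2.1 - w.1) * Real.cosh (w.1 - y.1.1)) ^ Module.finrank ℝ V : ℝ) : ℂ) *
    (ph (2 / ħ * S0 (fun x y => ωB x y) w.2 (Real.cosh (y.2.1 - w.1) • y.1.2)
      (Real.cosh (w.1 - y.1.1) • y.2.2)) *
    (partialFourier u (y.1.1, y.1.2, ħ⁻¹ * Real.sinh (2 * (y.2.1 - w.1))) *
      partialFourier v (y.2.1, y.2.2, ħ⁻¹ * Real.sinh (2 * (w.1 - y.1.1)))))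

/-- The integrand of the deformed product after integration over `z₁, z₂`, up to a phase. -/
def kerG (w : ℝ × V) (y : (ℝ × V) × (ℝ × V)) : ℂ :=
  (Real.cosh (2 * (y.1.1 - y.2.1)) : ℂ) *
    kerS ωB ħ u v (w.1, Real.cosh (y.1.1 - y.2.1) • w.2) y

section Continuity

variable [FiniteDimensional ℝ V]

theorem continuous_S0 {Y : Type*} [TopologicalSpace Y] {f g h : Y → V} (hf : Continuous f)
    (hg : Continuous g) (hh : Continuous h) :
    Continuous fun y => S0 (fun x y => ωB x y) (f y) (g y) (h y) := by
  unfold S0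
  fun_prop

theorem continuous_kerS :
    Continuous fun r : (ℝ × V) × ((ℝ × V) × (ℝ × V)) => kerS ωB ħ u v r.1 r.2 := by
  have h1 := Real.continuous_cosh
  have h2 := Real.continuous_sinh
  have h3 := (partialFourier u).continuous
  have h4 := (partialFourier v).continuous
  unfold kerS
  refine Continuous.mul (by fun_prop) (Continuous.mul (continuous_ph.comp
    (continuous_const.mul (continuous_S0 ωB ?_ ?_ ?_))) ?_) <;> fun_prop

theorem continuous_phi : Continuous (phi ħ : Coord V → Coord V) := by
  have h2 := Real.continuous_sinh
  have h1 : Continuous fun q : Coord V => (Real.cosh (ħ / 2 * q.2.2))⁻¹ :=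
    (Real.continuous_cosh.comp (by fun_prop)).inv₀ fun q => (Real.cosh_pos _).ne'
  unfold phi
  fun_prop

theorem continuous_kerW :
    Continuous fun r : (ℝ × V) × ((ℝ × V) × (ℝ × V)) => kerW ωB ħ u v r.1 r.2 := by
  have h2 := continuous_phi ħ (V := V)
  have h3 := (partialFourier u).continuous
  have h4 := (partialFourier v).continuous
  unfold kerW
  refine Continuous.mul (continuous_ph.comp
    (continuous_const.mul (continuous_S0 ωB ?_ ?_ ?_))) ?_ <;> fun_prop

theorem continuous_kerG :
    Continuous fun r : (ℝ × V) × ((ℝ × V) × (ℝ × V)) => kerG ωB ħ u v r.1 r.2 := by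
  have h1 := Real.continuous_cosh
  have h2 : Continuous fun r : (ℝ × V) × ((ℝ × V) × (ℝ × V)) =>
      ((r.1.1, Real.cosh (r.2.1.1 - r.2.2.1) • r.1.2), r.2) := by fun_prop
  unfold kerG
  exact Continuous.mul (by fun_prop) ((continuous_kerS ωB ħ u v).comp h2)

end Continuity

/-- The extra factor `cosh (2(a₁ - a₂))` is included, and the bound does not involve the
`V`-component of `w`; so it also covers `kerG`, where that component is rescaled. -/
theorem exists_kerS_bound (hħ : 0 < ħ) : ∃ C : ℝ, 0 ≤ C ∧ ∀ w y,
    Real.cosh (2 * (y.1.1 - y.2.1)) * ‖kerS ωB ħ u v w y‖ ≤ C * wtPair w.1 y := by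
  obtain ⟨C, hC0, hC⟩ := schwartz_decay_sinh hħ (partialFourier u)
  obtain ⟨D, hD0, hD⟩ := schwartz_decay_sinh hħ (partialFourier v)
  refine ⟨2 * (C * D), by positivity, fun w y => ?_⟩
  have h1 := hC y.1.1 y.1.2 (y.2.1 - w.1)
  have h2 := hD y.2.1 y.2.2 (w.1 - y.1.1)
  have h3 := cosh_amplitude_le w.1 y.1.1 y.2.1 (Module.finrank ℝ V)
  have hp := fun t => (Real.cosh_pos t).le
  rw [kerS, norm_mul, norm_mul, norm_mul, norm_ph, one_mul, norm_real, Real.norm_of_nonneg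
    (pow_nonneg (mul_nonneg (hp _) (hp _)) _), ← mul_assoc]
  set U := ‖partialFourier u (y.1.1, y.1.2, ħ⁻¹ * Real.sinh (2 * (y.2.1 - w.1)))‖
  set U' := ‖partialFourier v (y.2.1, y.2.2, ħ⁻¹ * Real.sinh (2 * (w.1 - y.1.1)))‖
  refine (mul_le_mul_of_nonneg_right h3 (by positivity)).trans ?_
  calc _ = 2 * ((U * Real.cosh (2 * (y.2.1 - w.1)) ^ (Module.finrank ℝ V + 1)) *
        (U' * Real.cosh (2 * (w.1 - y.1.1)) ^ (Module.finrank ℝ V + 1))) := by ring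
    _ ≤ 2 * ((C * (wtA (y.2.1 - w.1) * wtX V y.1.2)) *
        (D * (wtA (w.1 - y.1.1) * wtX V y.2.2))) := by
      have := hp (2 * (w.1 - y.1.1))
      have := mul_nonneg (wtA_nonneg (y.2.1 - w.1)) (wtX_nonneg y.1.2)
      gcongr
    _ = _ := by rw [wtPair]; ring

theorem exists_kerS_kerG_bound (hħ : 0 < ħ) : ∃ C : ℝ, 0 ≤ C ∧ ∀ w y,
    ‖kerS ωB ħ u v w y‖ ≤ C * wtPair w.1 y ∧ ‖kerG ωB ħ u v w y‖ ≤ C * wtPair w.1 y := by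
  obtain ⟨C, hC0, hC⟩ := exists_kerS_bound ωB ħ u v hħ
  refine ⟨C, hC0, fun w y => ⟨le_trans ?_ (hC w y), ?_⟩⟩
  · exact le_mul_of_one_le_left (norm_nonneg _) (Real.one_le_cosh _)
  · rw [kerG, norm_mul, norm_real, Real.norm_of_nonneg (Real.cosh_pos _).le]
    exact hC _ y

end Kernel

/-! ### Integrability of the weights, and Fubini with a test function. -/

section Integrals

variable {V : Type} [NormedAddCommGroup V] [NormedSpace ℝ V] [MeasurableSpace V]
  [FiniteDimensional ℝ V] [BorelSpace V] (μ : Measure V) [μ.IsAddHaarMeasure]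

theorem integrable_wtX : Integrable (wtX V) μ := by
  have h : Integrable (fun x : V => (1 + ‖x‖) ^ (-((Module.finrank ℝ V + 1 : ℕ) : ℝ))) μ :=
    integrable_one_add_norm (by push_cast; linarith)
  refine h.congr (.of_forall fun x => ?_)
  simp only
  rw [Real.rpow_neg (by positivity), Real.rpow_natCast]
  rfl

theorem integrable_wtA : Integrable wtA := integrable_inv_one_add_sq

theorem integrable_wtPair (a₀ : ℝ) : Integrable (wtPair a₀)
    (((volume : Measure ℝ).prod μ).prod ((volume : Measure ℝ).prod μ)) :=
  ((integrable_wtA.comp_sub_left a₀).mul_prod (integrable_wtX μ)).mul_prod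
    ((integrable_wtA.comp_sub_right a₀).mul_prod (integrable_wtX μ))

theorem integral_wtPair (a₀ : ℝ) :
    ∫ y, wtPair a₀ y ∂(((volume : Measure ℝ).prod μ).prod ((volume : Measure ℝ).prod μ)) =
      ((∫ b, wtA b) * ∫ x, wtX V x ∂μ) * ((∫ b, wtA b) * ∫ x, wtX V x ∂μ) := by
  have h1 := integral_prod_mul (μ := (volume : Measure ℝ).prod μ)
    (ν := (volume : Measure ℝ).prod μ) (fun w : ℝ × V => wtA (a₀ - w.1) * wtX V w.2)
    (fun w : ℝ × V => wtA (w.1 - a₀) * wtX V w.2)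
  have h2 := integral_prod_mul (μ := (volume : Measure ℝ)) (ν := μ) (fun a => wtA (a₀ - a)) (wtX V)
  have h3 := integral_prod_mul (μ := (volume : Measure ℝ)) (ν := μ) (fun a => wtA (a - a₀)) (wtX V)
  rw [integral_sub_left_eq_self] at h2
  rw [integral_sub_right_eq_self] at h3
  rw [h2, h3] at h1
  exact h1

/-- Integrating out the last coordinate: a Fubini theorem. -/
theorem integral_mul_integral_pair (θ : 𝓢(Coord V, ℂ)) {β : (ℝ × V) × (ℝ × V) → ℝ}
    (hβ : Continuous β) {K : ℝ × V → (ℝ × V) × (ℝ × V) → ℂ}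
    (hK : Continuous fun r : (ℝ × V) × ((ℝ × V) × (ℝ × V)) => K r.1 r.2) {C : ℝ} (hC : 0 ≤ C)
    (hb : ∀ w y, ‖K w y‖ ≤ C * wtPair w.1 y) :
    ∫ p : Coord V, θ p * ∫ y, ph (pairAE (β y) p.2.2) * K (p.1, p.2.1) y
        ∂(((volume : Measure ℝ).prod μ).prod ((volume : Measure ℝ).prod μ)) ∂(coordMeasure μ) =
      Real.pi * ∫ y, ∫ w, partialFourierInv θ (w.1, w.2, β y) * K w y
        ∂((volume : Measure ℝ).prod μ)
        ∂(((volume : Measure ℝ).prod μ).prod ((volume : Measure ℝ).prod μ)) := by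
  set m := (volume : Measure ℝ).prod μ with hm
  have hcont : Continuous fun r : Coord V × ((ℝ × V) × (ℝ × V)) =>
      θ r.1 * (ph (pairAE (β r.2) r.1.2.2) * K (r.1.1, r.1.2.1) r.2) := by
    have h1 : Continuous fun r : Coord V × ((ℝ × V) × (ℝ × V)) => K (r.1.1, r.1.2.1) r.2 :=
      hK.comp (f := fun r : Coord V × ((ℝ × V) × (ℝ × V)) => ((r.1.1, r.1.2.1), r.2))
        (by fun_prop)
    have h2 := θ.continuous
    unfold pairAE
    fun_prop
  have hbd : ∀ (p : Coord V) y, ‖θ p * (ph (pairAE (β y) p.2.2) * K (p.1, p.2.1) y)‖ ≤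
      ‖θ p‖ * (C * wtPair p.1 y) := by
    intro p y
    rw [norm_mul, norm_mul, norm_ph, one_mul]
    exact mul_le_mul_of_nonneg_left (hb (p.1, p.2.1) y) (norm_nonneg _)
  have hslice : ∀ p : Coord V, Integrable (fun y =>
      θ p * (ph (pairAE (β y) p.2.2) * K (p.1, p.2.1) y)) (m.prod m) := by
    intro p
    refine (((integrable_wtPair μ p.1).const_mul C).const_mul ‖θ p‖).mono' ?_
      (.of_forall fun y => hbd p y)
    exact (hcont.comp (Continuous.prodMk_right p)).aestronglyMeasurable
  have h_int : Integrable (fun r : Coord V × ((ℝ × V) × (ℝ × V)) =>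
      θ r.1 * (ph (pairAE (β r.2) r.1.2.2) * K (r.1.1, r.1.2.1) r.2))
      ((coordMeasure μ).prod (m.prod m)) := by
    rw [integrable_prod_iff hcont.aestronglyMeasurable]
    refine ⟨.of_forall hslice, ?_⟩
    -- By translation invariance the total weight does not depend on `a₀`, so integrability of `θ`
    -- alone suffices in the outer variable.
    set M := ((∫ b, wtA b) * ∫ x, wtX V x ∂μ) * ((∫ b, wtA b) * ∫ x, wtX V x ∂μ)
    refine ((θ.integrable (μ := coordMeasure μ)).norm.mul_const (C * M)).mono' ?_
      (.of_forall fun p => ?_)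
    · exact hcont.aestronglyMeasurable.norm.integral_prod_right'
    · rw [Real.norm_of_nonneg (integral_nonneg fun y => norm_nonneg _)]
      calc _ ≤ ∫ y, ‖θ p‖ * (C * wtPair p.1 y) ∂(m.prod m) :=
            integral_mono (hslice p).norm
              (((integrable_wtPair μ p.1).const_mul C).const_mul ‖θ p‖) (hbd p)
        _ = _ := by rw [integral_const_mul, integral_const_mul, hm, integral_wtPair]
  simp only [← integral_const_mul]
  rw [integral_integral_swap h_int]
  refine integral_congr_ae (.of_forall fun y => ?_)
  have h_int2 : Integrable (fun p : Coord V =>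
      θ p * (ph (pairAE (β y) p.2.2) * K (p.1, p.2.1) y)) (coordMeasure μ) := by
    refine ((θ.integrable (μ := coordMeasure μ)).norm.mul_const C).mono' ?_
      (.of_forall fun p => (hbd p y).trans ?_)
    · exact (hcont.comp (Continuous.prodMk_left y)).aestronglyMeasurable
    · exact mul_le_mul_of_nonneg_left (mul_le_of_le_one_right hC (wtPair_le_one _ _))
        (norm_nonneg _)
  simp only
  rw [integral_coordMeasure, integral_prod _ ((integrable_coordMeasure_iff μ).1 h_int2)]
  refine integral_congr_ae (.of_forall fun w => ?_)
  simp only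
  have hpi : (Real.pi : ℂ) ≠ 0 := ofReal_ne_zero.2 Real.pi_ne_zero
  -- `K` does not depend on `z`, so the `z`-integral of `θ` against the phase is `π` times the
  -- inverse transform of `θ` at frequency `β y`.
  rw [partialFourierInv_apply, ← mul_assoc, mul_inv_cancel_left₀ hpi, ← integral_mul_const]
  refine integral_congr_ae (.of_forall fun z => ?_)
  simp only [ph, pairAE]
  rw [show 2 * z * β y = 2 * β y * z by ring]
  ring

end Integrals

end

end ANQuant

namespace ANQuant

/-! ### The deformed product as an oscillatory integral -/

noncomputable section

variable {V : Type} [NormedAddCommGroup V] [NormedSpace ℝ V]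

theorem slice_pair_integrable (u v : 𝓢(Coord V, ℂ)) (E : ℂ) (a₁ : ℝ) (x₁ : V) (ξ₁ a₂ : ℝ) (x₂ : V)
    (ξ₂ : ℝ) : Integrable fun s : ℝ × ℝ =>
      E * ((cexp (-(I * (pairAE ξ₁ s.1 : ℂ))) * u (a₁, x₁, s.1)) *
        (cexp (-(I * (pairAE ξ₂ s.2 : ℂ))) * v (a₂, x₂, s.2))) :=
  ((pf_integrable u (a₁, x₁, ξ₁)).mul_prod (pf_integrable v (a₂, x₂, ξ₂))).const_mul E

theorem slice_pair_integral (u v : 𝓢(Coord V, ℂ)) (E : ℂ) (a₁ : ℝ) (x₁ : V) (ξ₁ a₂ : ℝ) (x₂ : V)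
    (ξ₂ : ℝ) : ∫ s : ℝ × ℝ, E * ((cexp (-(I * (pairAE ξ₁ s.1 : ℂ))) * u (a₁, x₁, s.1)) *
        (cexp (-(I * (pairAE ξ₂ s.2 : ℂ))) * v (a₂, x₂, s.2))) =
      E * (partialFourier u (a₁, x₁, ξ₁) * partialFourier v (a₂, x₂, ξ₂)) := by
  rw [integral_const_mul, Measure.volume_eq_prod, integral_prod_mul
    (fun s => cexp (-(I * (pairAE ξ₁ s : ℂ))) * u (a₁, x₁, s))
    (fun s => cexp (-(I * (pairAE ξ₂ s : ℂ))) * v (a₂, x₂, s))]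
  rfl

/-! ### Integration over `z₁, z₂`. -/

section Kernel

variable (ωB : V →ₗ[ℝ] V →ₗ[ℝ] ℝ) (ħ : ℝ) (u v : 𝓢(Coord V, ℂ))

/-- The phase is affine in `z₁` and `z₂` separately and the amplitude does not involve them, so the
`z`-integrals are partial Fourier transforms at the frequencies displayed here. -/
theorem productIntegrand_eq (p : Coord V) (y : (ℝ × V) × (ℝ × V)) (s : ℝ × ℝ) :
    productIntegrand (fun x y => ωB x y) ħ u v p (y.1.1, y.1.2, s.1) (y.2.1, y.2.2, s.2) =
      (amplitude p (y.1.1, y.1.2, (0 : ℝ)) (y.2.1, y.2.2, (0 : ℝ)) *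
        (ph (2 / ħ * S0 (fun x y => ωB x y) (Real.cosh (y.1.1 - y.2.1) • p.2.1)
          (Real.cosh (y.2.1 - p.1) • y.1.2) (Real.cosh (p.1 - y.1.1) • y.2.2)) *
        ph (pairAE (ħ⁻¹ * Real.sinh (2 * (y.2.1 - y.1.1))) p.2.2))) *
      ((cexp (-(I * (pairAE (ħ⁻¹ * Real.sinh (2 * (y.2.1 - p.1))) s.1 : ℂ))) *
          u (y.1.1, y.1.2, s.1)) *
        (cexp (-(I * (pairAE (ħ⁻¹ * Real.sinh (2 * (p.1 - y.1.1))) s.2 : ℂ))) *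
          v (y.2.1, y.2.2, s.2))) := by
  have hs : Real.sinh (2 * (y.2.1 - y.1.1)) = -Real.sinh (2 * (y.1.1 - y.2.1)) := by
    rw [← Real.sinh_neg]; ring_nf
  have h : cexp (2 * I / ħ * (phase (fun x y => ωB x y) p (y.1.1, y.1.2, s.1)
      (y.2.1, y.2.2, s.2) : ℂ)) =
      ph (2 / ħ * S0 (fun x y => ωB x y) (Real.cosh (y.1.1 - y.2.1) • p.2.1)
          (Real.cosh (y.2.1 - p.1) • y.1.2) (Real.cosh (p.1 - y.1.1) • y.2.2)) *
        ph (pairAE (ħ⁻¹ * Real.sinh (2 * (y.2.1 - y.1.1))) p.2.2) *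
        cexp (-(I * (pairAE (ħ⁻¹ * Real.sinh (2 * (y.2.1 - p.1))) s.1 : ℂ))) *
        cexp (-(I * (pairAE (ħ⁻¹ * Real.sinh (2 * (p.1 - y.1.1))) s.2 : ℂ))) := by
    rw [ph, ph, ← Complex.exp_add, ← Complex.exp_add, ← Complex.exp_add, hs]
    congr 1
    simp only [phase, pairAE]
    generalize S0 (fun x y => ωB x y) (Real.cosh (y.1.1 - y.2.1) • p.2.1)
          (Real.cosh (y.2.1 - p.1) • y.1.2) (Real.cosh (p.1 - y.1.1) • y.2.2) = t
    generalize Real.sinh (2 * (y.1.1 - y.2.1)) = t₁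
    generalize Real.sinh (2 * (y.2.1 - p.1)) = t₂
    generalize Real.sinh (2 * (p.1 - y.1.1)) = t₃
    push_cast
    ring
  rw [productIntegrand, h]
  simp only [amplitude]
  ring

theorem innerIntegral_eq (p : Coord V) (y : (ℝ × V) × (ℝ × V)) :
    innerIntegral (fun x y => ωB x y) ħ u v p y =
      ph (pairAE (ħ⁻¹ * Real.sinh (2 * (y.2.1 - y.1.1))) p.2.2) *
        kerG ωB ħ u v (p.1, p.2.1) y := by
  rw [innerIntegral, integral_congr_ae (.of_forall fun s => productIntegrand_eq ωB ħ u v p y s),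
    slice_pair_integral]
  simp only [kerG, kerS, amplitude]
  push_cast
  ring

theorem productIntegrand_slice_integrable (p : Coord V) (y : (ℝ × V) × (ℝ × V)) :
    Integrable fun s : ℝ × ℝ =>
      productIntegrand (fun x y => ωB x y) ħ u v p (y.1.1, y.1.2, s.1) (y.2.1, y.2.2, s.2) :=
  (slice_pair_integrable u v _ _ _ _ _ _ _).congr
    (.of_forall fun s => (productIntegrand_eq ωB ħ u v p y s).symm)

theorem weylIntegrand_eq (f g : 𝓢(Coord V, ℂ)) (p : Coord V) (y : (ℝ × V) × (ℝ × V)) (s : ℝ × ℝ) :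
    weylIntegrand (fun x y => ωB x y) ħ f g p (y.1.1, y.1.2, s.1) (y.2.1, y.2.2, s.2) =
      (ph (pairAE (2 / ħ * (y.2.1 - y.1.1)) p.2.2) *
        ph (2 / ħ * S0 (fun x y => ωB x y) p.2.1 y.1.2 y.2.2)) *
      ((cexp (-(I * (pairAE (2 / ħ * (y.2.1 - p.1)) s.1 : ℂ))) * f (y.1.1, y.1.2, s.1)) *
        (cexp (-(I * (pairAE (2 / ħ * (p.1 - y.1.1)) s.2 : ℂ))) * g (y.2.1, y.2.2, s.2))) := by
  have h : cexp (2 * I / ħ * (S0 (omegaCoord (fun x y => ωB x y)) p (y.1.1, y.1.2, s.1)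
      (y.2.1, y.2.2, s.2) : ℂ)) =
      ph (pairAE (2 / ħ * (y.2.1 - y.1.1)) p.2.2) *
        ph (2 / ħ * S0 (fun x y => ωB x y) p.2.1 y.1.2 y.2.2) *
        cexp (-(I * (pairAE (2 / ħ * (y.2.1 - p.1)) s.1 : ℂ))) *
        cexp (-(I * (pairAE (2 / ħ * (p.1 - y.1.1)) s.2 : ℂ))) := by
    rw [ph, ph, ← Complex.exp_add, ← Complex.exp_add, ← Complex.exp_add]
    congr 1
    simp only [S0, omegaCoord, pairAE]
    push_cast
    ring
  rw [weylIntegrand, h]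
  ring

/-- The partial transform of `T_ħ u` is that of `u` composed with `φ_ħ`; hence no Fourier integral
remains in the kernel except those of `u` and `v`. -/
theorem weylIntegral_transport_slice (hħ : 0 < ħ) (p : Coord V) (y : (ℝ × V) × (ℝ × V)) :
    ∫ s : ℝ × ℝ, weylIntegrand (fun x y => ωB x y) ħ (transport hħ u) (transport hħ v) p
      (y.1.1, y.1.2, s.1) (y.2.1, y.2.2, s.2) =
      ph (pairAE (2 / ħ * (y.2.1 - y.1.1)) p.2.2) * kerW ωB ħ u v (p.1, p.2.1) y := by
  rw [integral_congr_ae (.of_forall fun s => weylIntegrand_eq ωB ħ _ _ p y s), slice_pair_integral]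
  simp only [partialFourier_transport, kerW]
  ring

/-- The source of the hyperbolic functions in the kernel: the Weyl frequencies have the form `2b/ħ`
with `b` a difference of two of the `a_i`. -/
theorem phi_scale {ħ : ℝ} (hħ : 0 < ħ) (a b : ℝ) (x : V) :
    phi ħ (a, Real.cosh b • x, 2 / ħ * b) = (a, x, ħ⁻¹ * Real.sinh (2 * b)) := by
  have h1 : ħ / 2 * (2 / ħ * b) = b := by field_simp
  have h2 : ħ * (2 / ħ * b) = 2 * b := by field_simp
  simp only [phi, h1, h2, smul_smul, inv_mul_cancel₀ (Real.cosh_pos b).ne', one_smul]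

/-! ### The remaining integral over `(a₁, x₁)` and `(a₂, x₂)`. -/

variable [MeasurableSpace V] [FiniteDimensional ℝ V] [BorelSpace V] (μ : Measure V)
  [μ.IsAddHaarMeasure]

theorem innerIntegral_integrable (hħ : 0 < ħ) (p : Coord V) :
    Integrable (innerIntegral (fun x y => ωB x y) ħ u v p)
      (((volume : Measure ℝ).prod μ).prod ((volume : Measure ℝ).prod μ)) := by
  obtain ⟨C, hC0, hC⟩ := exists_kerS_kerG_bound ωB ħ u v hħ
  have h1 : Integrable (kerG ωB ħ u v (p.1, p.2.1))
      (((volume : Measure ℝ).prod μ).prod ((volume : Measure ℝ).prod μ)) :=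
    ((integrable_wtPair μ p.1).const_mul C).mono'
      (((continuous_kerG ωB ħ u v).comp (Continuous.prodMk_right _)).aestronglyMeasurable)
      (.of_forall fun y => (hC (p.1, p.2.1) y).2)
  have h2 := Integrable.ph_mul (θ := fun y : (ℝ × V) × (ℝ × V) =>
    pairAE (ħ⁻¹ * Real.sinh (2 * (y.2.1 - y.1.1))) p.2.2) (by
      have := Real.continuous_sinh
      unfold pairAE
      fun_prop) h1
  exact h2.congr (.of_forall fun y => (innerIntegral_eq ωB ħ u v p y).symm)

theorem productFun_bounded (hħ : 0 < ħ) :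
    ∃ C : ℝ, ∀ p, ‖productFun (fun x y => ωB x y) μ ħ u v p‖ ≤ C := by
  obtain ⟨C, hC0, hC⟩ := exists_kerS_kerG_bound ωB ħ u v hħ
  refine ⟨‖((ħ ^ (Module.finrank ℝ V + 2) : ℝ) : ℂ)⁻¹‖ * (C * (((∫ b, wtA b) * ∫ x, wtX V x ∂μ) *
    ((∫ b, wtA b) * ∫ x, wtX V x ∂μ))), fun p => ?_⟩
  rw [productFun, norm_mul]
  gcongr
  rw [← integral_wtPair μ p.1, ← integral_const_mul]
  refine norm_integral_le_of_norm_le ((integrable_wtPair μ p.1).const_mul C)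
    (.of_forall fun y => ?_)
  rw [innerIntegral_eq, norm_mul, norm_ph, one_mul]
  exact (hC (p.1, p.2.1) y).2

theorem productFun_continuous (hħ : 0 < ħ) :
    Continuous (productFun (fun x y => ωB x y) μ ħ u v) := by
  obtain ⟨C, hC0, hC⟩ := exists_kerS_kerG_bound ωB ħ u v hħ
  have hsh := Real.continuous_sinh
  let m := ((volume : Measure ℝ).prod μ).prod ((volume : Measure ℝ).prod μ)
  have : m.IsAddHaarMeasure := Measure.prod.instIsAddHaarMeasure _ _
  -- Recentring `a₁, a₂` at `a₀` makes the dominating weight independent of `p`, as dominated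
  -- convergence requires.
  have h1 : productFun (fun x y => ωB x y) μ ħ u v = fun p =>
      ((ħ ^ (Module.finrank ℝ V + 2) : ℝ) : ℂ)⁻¹ *
        ∫ y, innerIntegral (fun x y => ωB x y) ħ u v p (((p.1, 0), (p.1, 0)) + y) ∂m := by
    ext p
    rw [productFun, integral_add_left_eq_self]
  rw [h1]
  refine continuous_const.mul (continuous_of_dominated
    (bound := fun y => C * wtPair 0 y) ?_ ?_ ?_ ?_)
  · intro p
    have := (innerIntegral_integrable ωB ħ u v μ hħ p).comp_add_left ((p.1, 0), (p.1, 0))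
    exact this.aestronglyMeasurable
  · refine fun p => .of_forall fun y => ?_
    rw [innerIntegral_eq, norm_mul, norm_ph, one_mul]
    refine ((hC (p.1, p.2.1) _).2).trans (le_of_eq ?_)
    simp [wtPair]
  · exact (integrable_wtPair μ 0).const_mul C
  · refine .of_forall fun y => ?_
    simp only [innerIntegral_eq]
    have h2 : Continuous fun p : Coord V => kerG ωB ħ u v (p.1, p.2.1) (((p.1, 0), (p.1, 0)) + y) :=
      (continuous_kerG ωB ħ u v).comp (f := fun p : Coord V =>
        ((p.1, p.2.1), ((p.1, 0), (p.1, 0)) + y)) (by fun_prop)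
    unfold pairAE
    fun_prop

/-- Scale `x₁` by `cosh (a₂ - a₀)` and `x₂` by `cosh (a₀ - a₁)`. Each factor depends only on the
other point and on `p`, so the two scalings can be done one after the other with the other point as
parameter. -/
theorem weylIntegral_transport (hħ : 0 < ħ) (p : Coord V)
    (h_int : Integrable (fun q : Coord V × Coord V => weylIntegrand (fun x y => ωB x y) ħ
      (transport hħ u) (transport hħ v) p q.1 q.2) ((coordMeasure μ).prod (coordMeasure μ))) :
    ∫ q : Coord V × Coord V, weylIntegrand (fun x y => ωB x y) ħ (transport hħ u) (transport hħ v)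
      p q.1 q.2 ∂((coordMeasure μ).prod (coordMeasure μ)) =
    ∫ y, ph (pairAE (2 / ħ * (y.2.1 - y.1.1)) p.2.2) * kerS ωB ħ u v (p.1, p.2.1) y
      ∂(((volume : Measure ℝ).prod μ).prod ((volume : Measure ℝ).prod μ)) := by
  have hcosh := Real.continuous_cosh
  have h_int' := (integrable_pair_iff μ).1 h_int
  rw [integral_pair, integral_prod _ h_int']
  have e1 : (fun y => ∫ s : ℝ × ℝ, weylIntegrand (fun x y => ωB x y) ħ (transport hħ u)
      (transport hħ v) p (pairHomeo (y, s)).1 (pairHomeo (y, s)).2) =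
      fun y => ph (pairAE (2 / ħ * (y.2.1 - y.1.1)) p.2.2) * kerW ωB ħ u v (p.1, p.2.1) y :=
    funext fun y => weylIntegral_transport_slice ωB ħ u v hħ p y
  have hi := h_int'.integral_prod_left
  rw [e1] at hi ⊢
  have hc : Continuous fun y : (ℝ × V) × (ℝ × V) =>
      ph (pairAE (2 / ħ * (y.2.1 - y.1.1)) p.2.2) * kerW ωB ħ u v (p.1, p.2.1) y := by
    have h1 := (continuous_kerW ωB ħ u v).comp (Continuous.prodMk_right (p.1, p.2.1))
    refine Continuous.mul ?_ h1
    unfold pairAE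
    fun_prop
  obtain ⟨i1, j1⟩ := integral_scale_param μ ((volume : Measure ℝ).prod μ)
    (c := fun w : ℝ × V => Real.cosh (w.1 - p.1)) (by fun_prop) (fun _ => Real.cosh_pos _) hc hi
  -- The swap exchanges the two points, so that `x₂` becomes the scaled variable of
  -- `integral_scale_param`.
  obtain ⟨-, j2⟩ := integral_scale_param μ ((volume : Measure ℝ).prod μ)
    (c := fun w : ℝ × V => Real.cosh (p.1 - w.1)) (by fun_prop) (fun _ => Real.cosh_pos _)
    (H := fun r => (fun r : (ℝ × V) × (ℝ × V) =>
      ((Real.cosh (r.2.1 - p.1) ^ Module.finrank ℝ V : ℝ) : ℂ) *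
        (ph (pairAE (2 / ħ * (r.2.1 - r.1.1)) p.2.2) * kerW ωB ħ u v (p.1, p.2.1)
          ((r.1.1, Real.cosh (r.2.1 - p.1) • r.1.2), r.2))) r.swap)
    (by
      have := hc.comp (f := fun r : (ℝ × V) × (ℝ × V) =>
        ((r.2.1, Real.cosh (r.1.1 - p.1) • r.2.2), r.1)) (by fun_prop)
      refine Continuous.mul ?_ this
      simp only [Prod.snd_swap]
      fun_prop)
    i1.swap
  rw [← j1, ← integral_prod_swap, ← j2, ← integral_prod_swap]
  refine integral_congr_ae (.of_forall fun y => ?_)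
  simp only [Prod.swap, kerW, kerS, phi_scale hħ, mul_pow]
  push_cast
  ring

/-- The product of two Schwartz functions, transported by `τ_ħ`, is an oscillatory integral. -/
theorem tau_weyl_transport (hħ : 0 < ħ) (h : 𝓢(Coord V, ℂ))
    (h_int : ∀ p, Integrable (fun q : Coord V × Coord V => weylIntegrand (fun x y => ωB x y) ħ
      (transport hħ u) (transport hħ v) p q.1 q.2) ((coordMeasure μ).prod (coordMeasure μ)))
    (hh : ∀ p, h p = ((ħ ^ (Module.finrank ℝ V + 2) : ℝ) : ℂ)⁻¹ * ∫ q : Coord V × Coord V,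
      weylIntegrand (fun x y => ωB x y) ħ (transport hħ u) (transport hħ v) p q.1 q.2
        ∂((coordMeasure μ).prod (coordMeasure μ))) (ψ : 𝓢(Coord V, ℂ)) :
    tau μ ħ h ψ = ∫ p, ψ p * productFun (fun x y => ωB x y) μ ħ u v p ∂(coordMeasure μ) := by
  obtain ⟨C, hC0, hC⟩ := exists_kerS_kerG_bound ωB ħ u v hħ
  have hsh := Real.continuous_sinh
  set k := ((ħ ^ (Module.finrank ℝ V + 2) : ℝ) : ℂ)⁻¹ with hk
  -- By duality `τ_ħ h` evaluated at `ψ` is the integral of `F χ` against `h`: the whole of `τ_ħ` is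
  -- moved onto the test function.
  set χ := pullbackPhi hħ (mulJac ħ (partialFourierInv ψ)) with hχ
  have hL := integral_mul_integral_pair μ (partialFourier χ)
    (β := fun y : (ℝ × V) × (ℝ × V) => 2 / ħ * (y.2.1 - y.1.1)) (by fun_prop)
    (continuous_kerS ωB ħ u v) hC0 fun w y => (hC w y).1
  have hR := integral_mul_integral_pair μ ψ
    (β := fun y : (ℝ × V) × (ℝ × V) => ħ⁻¹ * Real.sinh (2 * (y.2.1 - y.1.1))) (by fun_prop)
    (continuous_kerG ωB ħ u v) hC0 fun w y => (hC w y).2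
  rw [tau_apply, integral_mul_comp_phiInv μ hħ, ← hχ, ← integral_partialFourier_mul]
  have e1 : ∀ p, partialFourier χ p * h p = k * (partialFourier χ p *
      ∫ y, ph (pairAE (2 / ħ * (y.2.1 - y.1.1)) p.2.2) * kerS ωB ħ u v (p.1, p.2.1) y
        ∂(((volume : Measure ℝ).prod μ).prod ((volume : Measure ℝ).prod μ))) := by
    intro p
    rw [hh, weylIntegral_transport ωB ħ u v μ hħ p (h_int p)]
    ring
  have e2 : ∀ p, ψ p * productFun (fun x y => ωB x y) μ ħ u v p = k * (ψ p *
      ∫ y, ph (pairAE (ħ⁻¹ * Real.sinh (2 * (y.2.1 - y.1.1))) p.2.2) *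
        kerG ωB ħ u v (p.1, p.2.1) y
        ∂(((volume : Measure ℝ).prod μ).prod ((volume : Measure ℝ).prod μ))) := by
    intro p
    simp only [productFun, innerIntegral_eq]
    ring
  rw [integral_congr_ae (.of_forall e1), integral_congr_ae (.of_forall e2), integral_const_mul,
    integral_const_mul, hL, hR, partialFourierInv_partialFourier]
  congr 2
  refine integral_congr_ae (.of_forall fun y => ?_)
  simp only
  -- Scaling `x₀` by `cosh (a₂ - a₁)` brings `F⁻¹ ψ` to the last coordinate `sinh (2(a₂ - a₁)) / ħ`.
  -- The power of `cosh` from the scaling cancels the one in the Jacobian, leaving `cosh (2(a₁ -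
  -- a₂))`.
  rw [← integral_scale μ (Real.cosh_pos (y.2.1 - y.1.1)), ← integral_const_mul]
  refine integral_congr_ae (.of_forall fun w => ?_)
  have hb1 : ħ * (2 / ħ * (y.2.1 - y.1.1)) = 2 * (y.2.1 - y.1.1) := by field_simp
  have hb2 : ħ / 2 * (2 / ħ * (y.2.1 - y.1.1)) = y.2.1 - y.1.1 := by field_simp
  have hc : Real.cosh (y.1.1 - y.2.1) = Real.cosh (y.2.1 - y.1.1) := by
    rw [← Real.cosh_neg, neg_sub]
  have hc2 : Real.cosh (2 * (y.1.1 - y.2.1)) = Real.cosh (2 * (y.2.1 - y.1.1)) := by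
    rw [← Real.cosh_neg, ← mul_neg, neg_sub]
  have hne : (Real.cosh (y.2.1 - y.1.1) : ℂ) ≠ 0 := ofReal_ne_zero.2 (Real.cosh_pos _).ne'
  simp only [hχ, pullbackPhi_apply, mulJac_apply_phi hħ]
  simp only [phi_scale hħ, phiJac, hb1, hb2, kerG, hc, hc2, inv_pow]
  generalize Real.cosh (y.2.1 - y.1.1) = t at hne ⊢
  push_cast
  field_simp

end Kernel

end

end ANQuant

namespace ANQuant

/-! ### The deformed product on `𝓔_ħ` -/

noncomputable section

variable {V : Type} [NormedAddCommGroup V] [NormedSpace ℝ V]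

/-- The two-form on `𝔯` in coordinates, as a bilinear map. -/
def omegaLin (ωB : V →ₗ[ℝ] V →ₗ[ℝ] ℝ) : Coord V →ₗ[ℝ] Coord V →ₗ[ℝ] ℝ :=
  LinearMap.mk₂ ℝ (omegaCoord fun x y => ωB x y)
    (fun p p' q => by simp [omegaCoord, pairAE]; ring)
    (fun c p q => by simp [omegaCoord, pairAE]; ring)
    (fun p q q' => by simp [omegaCoord, pairAE]; ring)
    (fun c p q => by simp [omegaCoord, pairAE]; ring)

theorem omegaLin_apply (ωB : V →ₗ[ℝ] V →ₗ[ℝ] ℝ) (p q : Coord V) :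
    omegaLin ωB p q = omegaCoord (fun x y => ωB x y) p q := rfl

theorem omegaLin_injective {ωB : V →ₗ[ℝ] V →ₗ[ℝ] ℝ} (h : Function.Injective ωB) :
    Function.Injective (omegaLin ωB) := by
  rw [injective_iff_map_eq_zero] at h ⊢
  rintro ⟨a, x, z⟩ h0
  have h1 : a = 0 := by
    simpa [omegaLin_apply, omegaCoord, pairAE] using LinearMap.congr_fun h0 (0, 0, 1)
  have h2 : z = 0 := by
    simpa [omegaLin_apply, omegaCoord, pairAE] using LinearMap.congr_fun h0 (1, 0, 0)
  have h3 : x = 0 := h x <| LinearMap.ext fun y => by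
    simpa [omegaLin_apply, omegaCoord, pairAE] using LinearMap.congr_fun h0 (0, y, 0)
  rw [h1, h2, h3]
  rfl

theorem omegaLin_antisymm {ωB : V →ₗ[ℝ] V →ₗ[ℝ] ℝ} (h : ∀ x y, ωB x y = -ωB y x) (p q : Coord V) :
    omegaLin ωB p q = -omegaLin ωB q p := by
  simp only [omegaLin_apply, omegaCoord, h p.2.1 q.2.1]
  ring

theorem weylIntegrand_eq_ph (ωB : V →ₗ[ℝ] V →ₗ[ℝ] ℝ) (ħ : ℝ) (f g : Coord V → ℂ)
    (p₀ p₁ p₂ : Coord V) :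
    weylIntegrand (fun x y => ωB x y) ħ f g p₀ p₁ p₂ =
      ph (S0 (fun x y => ((2 / ħ) • omegaLin ωB) x y) p₀ p₁ p₂) * (f p₁ * g p₂) := by
  rw [weylIntegrand, ph, mul_assoc]
  congr 2
  simp only [S0, LinearMap.smul_apply, omegaLin_apply, smul_eq_mul]
  push_cast
  ring

variable [MeasurableSpace V] [FiniteDimensional ℝ V] [BorelSpace V] (μ : Measure V)
  [μ.IsAddHaarMeasure]

theorem productIntegrand_integrable (ωB : V →ₗ[ℝ] V →ₗ[ℝ] ℝ) (ħ : ℝ) {u v : 𝓢(Coord V, ℂ)}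
    (hu : HasCompactSupport u) (hv : HasCompactSupport v) (p : Coord V) :
    Integrable (fun q : Coord V × Coord V => productIntegrand (fun x y => ωB x y) ħ u v p q.1 q.2)
      ((coordMeasure μ).prod (coordMeasure μ)) := by
  have : ((coordMeasure μ).prod (coordMeasure μ)).IsAddHaarMeasure :=
    Measure.prod.instIsAddHaarMeasure _ _
  have hcosh := Real.continuous_cosh
  have hsinh := Real.continuous_sinh
  have h1 : Continuous fun q : Coord V × Coord V => amplitude p q.1 q.2 := by
    unfold amplitude
    fun_prop
  have h2 : Continuous fun q : Coord V × Coord V => phase (fun x y => ωB x y) p q.1 q.2 := by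
    unfold phase S0 pairAE
    fun_prop
  refine Continuous.integrable_of_hasCompactSupport ?_ ?_
  · have h3 := u.continuous
    have h4 := v.continuous
    unfold productIntegrand
    fun_prop
  · refine HasCompactSupport.intro (hu.isCompact.prod hv.isCompact) fun q hq => ?_
    rw [Set.mem_prod, not_and_or] at hq
    rcases hq with hq | hq
    · simp [productIntegrand, image_eq_zero_of_notMem_tsupport hq]
    · simp [productIntegrand, image_eq_zero_of_notMem_tsupport hq]

theorem productFun_eq_integral (ωB : V →ₗ[ℝ] V →ₗ[ℝ] ℝ) (ħ : ℝ) {u v : 𝓢(Coord V, ℂ)}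
    (hu : HasCompactSupport u) (hv : HasCompactSupport v) (p : Coord V) :
    productFun (fun x y => ωB x y) μ ħ u v p = ((ħ ^ (Module.finrank ℝ V + 2) : ℝ) : ℂ)⁻¹ *
      ∫ q : Coord V × Coord V, productIntegrand (fun x y => ωB x y) ħ u v p q.1 q.2
        ∂((coordMeasure μ).prod (coordMeasure μ)) := by
  rw [integral_pair, integral_prod _
    ((integrable_pair_iff μ).1 (productIntegrand_integrable μ ωB ħ hu hv p))]
  rfl

/-- The transport of the Weyl product to `𝓔_ħ`. -/
def deformedProduct {ħ : ℝ} (hħ : 0 < ħ)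
    (W : 𝓢(Coord V, ℂ) →ₗ[ℂ] 𝓢(Coord V, ℂ) →ₗ[ℂ] 𝓢(Coord V, ℂ)) :
    Espace μ ħ →ₗ[ℂ] Espace μ ħ →ₗ[ℂ] Espace μ ħ :=
  (W.compl₁₂ (tauInv μ hħ).toLinearMap (tauInv μ hħ).toLinearMap).compr₂
    (tauInv μ hħ).symm.toLinearMap

theorem deformedProduct_apply {ħ : ℝ} (hħ : 0 < ħ)
    (W : 𝓢(Coord V, ℂ) →ₗ[ℂ] 𝓢(Coord V, ℂ) →ₗ[ℂ] 𝓢(Coord V, ℂ)) (a b : Espace μ ħ) :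
    deformedProduct μ hħ W a b = tauE μ ħ (W (tauInv μ hħ a) (tauInv μ hħ b)) := rfl

/-- The deformed product for an arbitrary symplectic vector space `V`. -/
theorem exists_deformedProduct {ωB : V →ₗ[ℝ] V →ₗ[ℝ] ℝ} (hω : Function.Injective ωB)
    (hω' : ∀ x y, ωB x y = -ωB y x) {ω : V → V → ℝ} (hωB : ω = fun x y => ωB x y) {ħ : ℝ}
    (hħ : 0 < ħ) :
    ∃ (T : Espace μ ħ ≃ₗ[ℂ] 𝓢(Coord V, ℂ))
      (W : 𝓢(Coord V, ℂ) →ₗ[ℂ] 𝓢(Coord V, ℂ) →ₗ[ℂ] 𝓢(Coord V, ℂ))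
      (star : Espace μ ħ →ₗ[ℂ] Espace μ ħ →ₗ[ℂ] Espace μ ħ),
      (∀ u, T (tauE μ ħ u) = u) ∧
      (∀ u, ∃ hu : toDist μ u ∈ Espace μ ħ, ∀ p, T ⟨toDist μ u, hu⟩ p = transportFun ħ u p) ∧
      (∀ (f g : 𝓢(Coord V, ℂ)) (p : Coord V),
        Integrable (fun q : Coord V × Coord V => weylIntegrand ω ħ f g p q.1 q.2)
          ((coordMeasure μ).prod (coordMeasure μ)) ∧
        W f g p = ((ħ ^ (Module.finrank ℝ V + 2) : ℝ) : ℂ)⁻¹ *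
          ∫ q : Coord V × Coord V, weylIntegrand ω ħ f g p q.1 q.2
            ∂((coordMeasure μ).prod (coordMeasure μ))) ∧
      (∀ a b, star a b = tauE μ ħ (W (T a) (T b))) ∧
      (∀ a b c, star (star a b) c = star a (star b c)) ∧
      (∀ (u v : 𝓢(Coord V, ℂ)) (hu : toDist μ u ∈ Espace μ ħ) (hv : toDist μ v ∈ Espace μ ħ),
        (∀ p (y : (ℝ × V) × (ℝ × V)), Integrable (fun s : ℝ × ℝ => productIntegrand ω ħ u v p
          (y.1.1, y.1.2, s.1) (y.2.1, y.2.2, s.2))) ∧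
        (∀ p, Integrable (innerIntegral ω ħ u v p) ((volume.prod μ).prod (volume.prod μ))) ∧
        Continuous (productFun ω μ ħ u v) ∧
        (∃ C : ℝ, ∀ p, ‖productFun ω μ ħ u v p‖ ≤ C) ∧
        (∀ ψ : 𝓢(Coord V, ℂ),
          (star ⟨toDist μ u, hu⟩ ⟨toDist μ v, hv⟩ : 𝓢'(Coord V, ℂ)) ψ =
            ∫ p, ψ p * productFun ω μ ħ u v p ∂(coordMeasure μ)) ∧
        (HasCompactSupport u → HasCompactSupport v → ∀ p,
          Integrable (fun q : Coord V × Coord V => productIntegrand ω ħ u v p q.1 q.2)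
            ((coordMeasure μ).prod (coordMeasure μ)) ∧
          productFun ω μ ħ u v p = ((ħ ^ (Module.finrank ℝ V + 2) : ℝ) : ℂ)⁻¹ *
            ∫ q : Coord V × Coord V, productIntegrand ω ħ u v p q.1 q.2
              ∂((coordMeasure μ).prod (coordMeasure μ)))) := by
  subst hωB
  have hB : Function.Injective ((2 / ħ) • omegaLin ωB) := fun p q h =>
    omegaLin_injective hω (smul_right_injective _ (div_pos two_pos hħ).ne' h)
  have hB' : ∀ p q, ((2 / ħ) • omegaLin ωB) p q = -((2 / ħ) • omegaLin ωB) q p := fun p q => by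
    rw [LinearMap.smul_apply, LinearMap.smul_apply, omegaLin_antisymm hω', smul_neg]
    rfl
  let W := weylProduct (coordMeasure μ) _ hB hB' ((ħ ^ (Module.finrank ℝ V + 2) : ℝ) : ℂ)⁻¹
  have hW : ∀ (f g : 𝓢(Coord V, ℂ)) (p : Coord V),
      Integrable (fun q : Coord V × Coord V => weylIntegrand (fun x y => ωB x y) ħ f g p q.1 q.2)
        ((coordMeasure μ).prod (coordMeasure μ)) ∧
      W f g p = ((ħ ^ (Module.finrank ℝ V + 2) : ℝ) : ℂ)⁻¹ *
        ∫ q : Coord V × Coord V, weylIntegrand (fun x y => ωB x y) ħ f g p q.1 q.2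
          ∂((coordMeasure μ).prod (coordMeasure μ)) := by
    intro f g p
    simp only [weylIntegrand_eq_ph]
    exact ⟨weylIntegrand_integrable _ _ f g p, weylProduct_apply _ _ hB hB' _ f g p⟩
  refine ⟨tauInv μ hħ, W, deformedProduct μ hħ W, tauInv_tauE μ hħ, fun u =>
    ⟨toDist_mem_Espace μ hħ u, fun p => ?_⟩, hW, deformedProduct_apply μ hħ W, fun a b c => ?_,
    fun u v hu hv => ⟨productIntegrand_slice_integrable ωB ħ u v,
      innerIntegral_integrable ωB ħ u v μ hħ, productFun_continuous ωB ħ u v μ hħ,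
      productFun_bounded ωB ħ u v μ hħ, fun ψ => ?_, fun hu hv p =>
      ⟨productIntegrand_integrable μ ωB ħ hu hv p, productFun_eq_integral μ ωB ħ hu hv p⟩⟩⟩
  · rw [tauInv_toDist, transport_apply]
  · simp only [deformedProduct_apply, tauInv_tauE]
    rw [weylProduct_assoc]
  · rw [deformedProduct_apply, tauInv_toDist, tauInv_toDist]
    exact tau_weyl_transport ωB ħ u v μ hħ _ (fun p => (hW _ _ p).1) (fun p => (hW _ _ p).2) ψ

end

/-! ### Invariance of the three-point kernel -/

section Invariance

variable {V : Type} [NormedAddCommGroup V] [NormedSpace ℝ V]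

theorem amplitude_leftMul (ω : V → V → ℝ) (r p₀ p₁ p₂ : Coord V) :
    amplitude (leftMul ω r p₀) (leftMul ω r p₁) (leftMul ω r p₂) = amplitude p₀ p₁ p₂ := by
  simp only [amplitude, leftMul, add_sub_add_left_eq_sub]

/-- Differences of the `a_i` are unchanged. The translation by `z` contributes the cyclic sum of
`sinh (2(a₀ - a₁)) exp(-2a₂)`, which is zero, and the terms linear in the translating `x` cancel
between `S⁰` and the `sinh` terms. -/
theorem phase_leftMul {ωB : V →ₗ[ℝ] V →ₗ[ℝ] ℝ} (h : ∀ x y, ωB x y = -ωB y x) {ω : V → V → ℝ}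
    (hωB : ω = fun x y => ωB x y) (r p₀ p₁ p₂ : Coord V) :
    phase ω (leftMul ω r p₀) (leftMul ω r p₁) (leftMul ω r p₂) = phase ω p₀ p₁ p₂ := by
  subst hωB
  obtain ⟨a, x, z⟩ := r
  obtain ⟨a₀, x₀, z₀⟩ := p₀
  obtain ⟨a₁, x₁, z₁⟩ := p₁
  obtain ⟨a₂, x₂, z₂⟩ := p₂
  have h0 : ωB x x = 0 := by linarith [h x x]
  simp only [phase, S0, leftMul, pairAE, add_sub_add_left_eq_sub, map_add, map_smul,
    LinearMap.add_apply, LinearMap.smul_apply, smul_eq_mul, h0, h x₀ x, h x₁ x, h x₂ x,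
    Real.sinh_eq, Real.cosh_eq]
  -- Every exponent is split into copies of `±a_i`, so that only the `exp(a_i)` and their inverses
  -- remain. The negated arguments come first, since they contain the others as subterms.
  rw [show -(2 * (a₀ - a₁)) = a₁ + a₁ + -a₀ + -a₀ by ring,
    show -(2 * (a₁ - a₂)) = a₂ + a₂ + -a₁ + -a₁ by ring,
    show -(2 * (a₂ - a₀)) = a₀ + a₀ + -a₂ + -a₂ by ring,
    show 2 * (a₀ - a₁) = a₀ + a₀ + -a₁ + -a₁ by ring,
    show 2 * (a₁ - a₂) = a₁ + a₁ + -a₂ + -a₂ by ring,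
    show 2 * (a₂ - a₀) = a₂ + a₂ + -a₀ + -a₀ by ring,
    show -2 * a₀ = -a₀ + -a₀ by ring, show -2 * a₁ = -a₁ + -a₁ by ring,
    show -2 * a₂ = -a₂ + -a₂ by ring]
  simp only [sub_eq_add_neg, Real.exp_add, Real.exp_neg]
  have e0 := (Real.exp_pos a₀).ne'
  have e1 := (Real.exp_pos a₁).ne'
  have e2 := (Real.exp_pos a₂).ne'
  generalize Real.exp a₀ = t₀ at *
  generalize Real.exp a₁ = t₁ at *
  generalize Real.exp a₂ = t₂ at *
  field_simp
  ring

end Invariance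

end ANQuant

namespace ANQuant

/-! ### Eigenvectors of `[A, ·]` in an associative algebra -/

section WeightVectors

variable {R : Type*} [Ring R] [Algebra ℂ R] {A X Y : R} {c t : ℂ}

theorem mul_mul_eq_zero_of_anticomm {P : R} (hP : P * P = P) (hA : P * A + A * P = A) :
    P * A * P = 0 := by
  have := congrArg (P * ·) hA
  simp only [mul_add, ← mul_assoc, hP] at this
  simpa using this

/-- `A` exchanges the range and the kernel of `P`, so `A²` preserves the range and acts there as
`c`. Splitting `A = P A + A P` carries this over to `A³`. -/
theorem cube_of_anticomm {P : R} (hP : P * P = P) (hA : P * A + A * P = A)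
    (hc : P * (A * A) * P = c • P) :
    A * A * A = c • A ∧ A * A * P = c • P ∧ P * A * A = c • P := by
  have h0 := mul_mul_eq_zero_of_anticomm hP hA
  have h1 : A * A * P = c • P := by
    calc A * A * P = (P * A + A * P) * A * P := by rw [hA]
      _ = P * (A * A) * P + A * (P * A * P) := by noncomm_ring
      _ = _ := by rw [hc, h0, mul_zero, add_zero]
  have h2 : P * A * A = c • P := by
    calc P * A * A = P * A * (P * A + A * P) := by rw [hA]
      _ = P * (A * A) * P + P * A * P * A := by noncomm_ring
      _ = _ := by rw [hc, h0, zero_mul, add_zero]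
  refine ⟨?_, h1, h2⟩
  calc A * A * A = A * A * (P * A + A * P) := by rw [hA]
    _ = A * A * P * A + A * (A * A * P) := by noncomm_ring
    _ = c • (P * A + A * P) := by rw [h1, smul_mul_assoc, mul_smul_comm, smul_add]
    _ = _ := by rw [hA]

/-- A nonzero eigenvector of `[A, ·]`, for `A³ = c A`, has eigenvalue `±√c`, `±2√c` or `0`. -/
theorem weight_relations (hA : A * A * A = c • A) (hX : A * X = X * A + t • X) (ht : t ≠ 0) :
    (3 : ℂ) • (X * A * A) + (3 * t) • (X * A) + (t ^ 2 - c) • X = 0 ∧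
      (c - t ^ 2) • ((2 : ℂ) • (X * A) + t • X) = 0 := by
  have hA' : ∀ Y : R, Y * A * A * A = c • (Y * A) := fun Y => by
    rw [mul_assoc, mul_assoc, ← mul_assoc A, hA, mul_smul_comm]
  have h1 : A * A * X = X * A * A + (2 * t) • (X * A) + (t ^ 2) • X := by
    rw [mul_assoc, hX, mul_add, ← mul_assoc, hX, mul_smul_comm, hX, add_mul, smul_mul_assoc]
    module
  -- From `A X = X (A + t)` one gets `A³ X = X (A + t)³`; comparison with `A³ = c A` then gives a
  -- quadratic relation for `A` acting on `X` from the right.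
  have h2 : A * A * A * X = X * A * A * A + (3 * t) • (X * A * A) + (3 * t ^ 2) • (X * A) +
      (t ^ 3) • X := by
    rw [show A * A * A * X = A * (A * A * X) by noncomm_ring, h1, mul_add, mul_add, ← mul_assoc,
      ← mul_assoc, hX,
      mul_smul_comm, mul_smul_comm, ← mul_assoc, hX, add_mul, add_mul, smul_mul_assoc,
      smul_mul_assoc]
    module
  rw [hA, smul_mul_assoc, hX, hA'] at h2
  have h3 : (3 : ℂ) • (X * A * A) + (3 * t) • (X * A) + (t ^ 2 - c) • X = 0 := by
    have : t • ((3 : ℂ) • (X * A * A) + (3 * t) • (X * A) + (t ^ 2 - c) • X) = 0 := by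
      linear_combination (norm := module) (-1 : ℂ) • h2
    exact (smul_eq_zero.1 this).resolve_left ht
  refine ⟨h3, ?_⟩
  have h4 := congrArg (· * A) h3
  simp only [add_mul, smul_mul_assoc, hA', zero_mul] at h4
  linear_combination (norm := module) h4 - t • h3

/-- If `c ≠ t²`, then `A` acts on `X` from the right as the scalar `-t/2`, and the quadratic
relation becomes `t²/4 = c`. -/
theorem weight_eq (hA : A * A * A = c • A) (hX : A * X = X * A + t • X) (ht : t ≠ 0)
    (hX0 : X ≠ 0) : c = t ^ 2 ∨ 4 * c = t ^ 2 := by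
  obtain ⟨h1, h2⟩ := weight_relations hA hX ht
  rw [or_iff_not_imp_left]
  intro hc
  have h3 := (smul_eq_zero.1 h2).resolve_left (sub_ne_zero.2 hc)
  have h4 := congrArg (· * A) h3
  simp only [add_mul, smul_mul_assoc, zero_mul] at h4
  have h5 : (t ^ 2 - 4 * c) • X = 0 := by
    linear_combination (norm := module) (4 : ℂ) • h1 - (6 : ℂ) • h4 - (3 * t) • h3
  have := (smul_eq_zero.1 h5).resolve_right hX0
  linear_combination -this

/-- `A` has eigenvalues in `{-1, 0, 1}` and `X` raises them by one: it kills the eigenvalue `1` and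
has no component in `-1` in its image. -/
theorem weight_one_relations (hA : A * A * A = A) (hX : A * X = X * A + X) :
    X * A * A = -(X * A) ∧ A * A * X = A * X := by
  have h1 : (3 : ℂ) • (X * A * A) + (3 * 1 : ℂ) • (X * A) + (1 ^ 2 - 1 : ℂ) • X = 0 :=
    (weight_relations (c := 1) (by simpa using hA) (by simpa using hX) one_ne_zero).1
  have h2 : X * A * A = -(X * A) := by
    have : (3 : ℂ) • (X * A * A + X * A) = 0 := by linear_combination (norm := module) h1
    exact eq_neg_of_add_eq_zero_left ((smul_eq_zero.1 this).resolve_left three_ne_zero)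
  refine ⟨h2, ?_⟩
  rw [mul_assoc, hX, mul_add, ← mul_assoc, hX, add_mul, h2]
  abel

/-- Raising by two within `{-1, 0, 1}` is only possible from `-1` to `1`. -/
theorem weight_two_relations (hA : A * A * A = A) (hX : A * X = X * A + (2 : ℂ) • X) :
    X * A = -X ∧ A * X = X := by
  have h1 := (weight_relations (c := 1) (by simpa using hA) hX two_ne_zero).2
  have h2 : X * A = -X := by
    have h3 := (smul_eq_zero.1 h1).resolve_left (by norm_num)
    rw [← smul_add] at h3
    exact eq_neg_of_add_eq_zero_left ((smul_eq_zero.1 h3).resolve_left two_ne_zero)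
  exact ⟨h2, by rw [hX, h2]; module⟩

/-- An element that anticommutes with `2 P - 1` and commutes with `A` is a multiple of `A`. -/
theorem eq_smul_of_anticomm {P H : R} (hP : P * P = P) (hA : P * A + A * P = A)
    (hH : P * H + H * P = H) (hAH : A * H = H * A) (hAAP : A * A * P = P) (hPAA : P * A * A = P)
    (ht : P * (A * H) * P = t • P) : H = t • A := by
  have h0 := mul_mul_eq_zero_of_anticomm hP hA
  have h0' := mul_mul_eq_zero_of_anticomm hP hH
  have h1 : P * A * H = t • P := by
    calc P * A * H = P * A * (P * H + H * P) := by rw [hH]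
      _ = P * A * P * H + P * (A * H) * P := by noncomm_ring
      _ = _ := by rw [h0, zero_mul, zero_add, ht]
  have h2 : A * H * P = t • P := by
    calc A * H * P = (P * A + A * P) * H * P := by rw [hA]
      _ = A * (P * H * P) + P * (A * H) * P := by noncomm_ring
      _ = _ := by rw [h0', mul_zero, zero_add, ht]
  have h3 : P * A * (A * H) = P * A * H * A := by rw [hAH, ← mul_assoc]
  have h4 : H * (A * A * P) = A * (A * H * P) := by
    rw [← mul_assoc, ← mul_assoc, ← hAH, mul_assoc A H A, ← hAH, mul_assoc]
  calc H = P * A * A * H + H * (A * A * P) := by rw [hAAP, hPAA, hH]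
    _ = P * A * H * A + A * (A * H * P) := by rw [h4, ← h3, mul_assoc (P * A)]
    _ = t • (P * A + A * P) := by rw [h1, h2, smul_mul_assoc, mul_smul_comm, smul_add]
    _ = _ := by rw [hA]

/-- The commutator of `A` with an element that commutes with `P` and with `A P A`. -/
theorem lie_of_comm {P Z : R} {s l : ℂ} (hP : P * P = P) (hA : P * A + A * P = A)
    (hAAP : A * A * P = P) (hPAA : P * A * A = P) (hZ : P * Z = Z * P)
    (hZ' : Z * (A * P * A) = A * P * A * Z) (hs : P * Z * P = s • P)
    (hl : P * (A * Z * A) * P = l • P) :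
    A * Z - Z * A = (s - l) • (A * P - P * A) ∧
      Z * (A * P - P * A) - (A * P - P * A) * Z = (l - s) • A := by
  have h1 : P * Z = s • P := by rw [← hs, mul_assoc, ← hZ, ← mul_assoc, hP]
  have h2 : Z * P = s • P := by rw [← hZ, h1]
  have h3 : Z * (A * P) = l • (A * P) := by
    calc Z * (A * P) = Z * (A * P * (A * A * P)) := by rw [hAAP, mul_assoc A P P, hP]
      _ = Z * (A * P * A) * (A * P) := by noncomm_ring
      _ = A * (P * (A * Z * A) * P) := by rw [hZ']; noncomm_ring
      _ = _ := by rw [hl, mul_smul_comm]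
  have h4 : P * A * Z = l • (P * A) := by
    calc P * A * Z = P * A * A * (P * A * Z) := by rw [hPAA, ← mul_assoc, ← mul_assoc, hP]
      _ = P * A * (A * P * A * Z) := by noncomm_ring
      _ = P * (A * Z * A) * P * A := by rw [← hZ']; noncomm_ring
      _ = _ := by rw [hl, smul_mul_assoc]
  have h5 : A * P * Z = s • (A * P) := by rw [mul_assoc, h1, mul_smul_comm]
  have h6 : Z * (P * A) = s • (P * A) := by rw [← mul_assoc, h2, smul_mul_assoc]
  constructor
  · have h7 : A * Z = l • (P * A) + s • (A * P) := by rw [← h4, ← h5, ← add_mul, hA]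
    have h8 : Z * A = s • (P * A) + l • (A * P) := by rw [← h6, ← h3, ← mul_add, hA]
    rw [h7, h8]
    module
  · rw [mul_sub, sub_mul, h3, h4, h5, h6]
    linear_combination (norm := module) (l - s) • hA

/-- For a rank one projection `P`, the projection `(A² + A) / 2` has rank one as well. -/
theorem mul_mul_eq_smul_of_anticomm {P M : R} {f : R → ℂ} (hA : P * A + A * P = A)
    (hAAP : A * A * P = P) (hf : ∀ X, P * X * P = f X • P) (hM : A * M = M) (hM' : M * A = M) :
    M = ((1 / 4 : ℂ) * f ((1 + A) * M * (1 + A))) • (A * A + A) := by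
  -- Writing `A² + A` as a sandwich around `P` lets the rank one property collapse `(A² + A) M (A² +
  -- A)`, which is `4 M`, to a multiple of `A² + A`.
  have h1 : (1 + A) * P * (1 + A) = A * A + A := by
    calc (1 + A) * P * (1 + A) = P + A * P * A + (P * A + A * P) := by noncomm_ring
      _ = A * A * P + A * P * A + A := by rw [hAAP, hA]
      _ = A * (P * A + A * P) + A := by noncomm_ring
      _ = _ := by rw [hA]
  have h2 : (A * A + A) * M * (A * A + A) = (4 : ℂ) • M := by
    have e1 : (A * A + A) * M = (2 : ℂ) • M := by rw [add_mul, mul_assoc, hM, hM]; module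
    have e2 : M * (A * A + A) = (2 : ℂ) • M := by rw [mul_add, ← mul_assoc, hM', hM']; module
    rw [e1, smul_mul_assoc, e2]
    module
  have h3 : (A * A + A) * M * (A * A + A) = f ((1 + A) * M * (1 + A)) • (A * A + A) := by
    rw [← h1, ← smul_mul_assoc, ← mul_smul_comm, ← hf]
    noncomm_ring
  rw [mul_smul, ← h3, h2]
  module

/-! ### Products of vectors of weight one and two. -/

theorem weight_two_of_mul (hX : A * X = X * A + X) (hY : A * Y = Y * A + Y) :
    A * (X * Y) = X * Y * A + (2 : ℂ) • (X * Y) := by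
  rw [← mul_assoc, hX, add_mul, mul_assoc, hY, mul_add, ← mul_assoc]
  module

theorem eq_zero_of_eq_neg_self {X : R} (h : X = -X) : X = 0 := by
  have : (2 : ℂ) • X = 0 := by rw [two_smul]; nth_rewrite 1 [h]; exact neg_add_cancel X
  exact (smul_eq_zero.1 this).resolve_left two_ne_zero

/-- `Y` lands in the top eigenspace of `A`, which `X` kills. The next two lemmas rest on the same
ladder. -/
theorem mul_eq_zero_of_weight_one_two (hX : X * A * A = -(X * A)) (hY : A * Y = Y) :
    X * Y = 0 := by
  refine eq_zero_of_eq_neg_self ?_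
  calc X * Y = X * (A * (A * Y)) := by rw [hY, hY]
    _ = X * A * A * Y := by noncomm_ring
    _ = -(X * (A * Y)) := by rw [hX, neg_mul, mul_assoc]
    _ = _ := by rw [hY]

theorem mul_eq_zero_of_weight_two_one (hX : A * A * X = A * X) (hY : Y * A = -Y) :
    Y * X = 0 := by
  refine eq_zero_of_eq_neg_self ?_
  calc Y * X = Y * A * A * X := by rw [hY, neg_mul, hY, neg_neg]
    _ = Y * (A * A * X) := by noncomm_ring
    _ = Y * A * X := by rw [hX, mul_assoc]
    _ = _ := by rw [hY, neg_mul]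

theorem mul_eq_zero_of_weight_two {Y' : R} (hY : Y * A = -Y) (hY' : A * Y' = Y') :
    Y * Y' = 0 := by
  refine eq_zero_of_eq_neg_self ?_
  nth_rewrite 1 [← hY']
  rw [← mul_assoc, hY, neg_mul]

end WeightVectors

end ANQuant

namespace ANQuant

/-! ### The adjoint and the rank one projection attached to a Cartan involution -/

/-- The adjoint `X ↦ Xᵈ` of matrices with respect to the positive definite Hermitian form that a
Cartan involution `σ` defines, and the orthogonal projection `P` on the line of positive vectors
fixed by the maximal compact subgroup. In terms of `J = 2 P - 1`, one has `σ X = J X J`. -/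
structure CartanFrame {n : ℕ} (D : IwasawaData n) where
  P : Mat n
  dag : Mat n → Mat n
  P_mul_self : P * P = P
  P_mul_mul_P : ∀ X, P * X * P = (P * X).trace • P
  dag_add : ∀ X Y, dag (X + Y) = dag X + dag Y
  dag_smul : ∀ (c : ℂ) X, dag (c • X) = star c • dag X
  dag_mul : ∀ X Y, dag (X * Y) = dag Y * dag X
  dag_one : dag 1 = 1
  dag_P : dag P = P
  eq_zero_of_mul_dag : ∀ X, X * dag X = 0 → X = 0
  mem_su : ∀ X, X ∈ su n ↔
    dag X = -(((2 : ℂ) • P - 1) * X * ((2 : ℂ) • P - 1)) ∧ X.trace = 0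
  sigma_eq : ∀ X : su n, (D.σ X : Mat n) = ((2 : ℂ) • P - 1) * X * ((2 : ℂ) • P - 1)

theorem hermJ_eq (n : ℕ) : hermJ n = (2 : ℂ) • Matrix.single 0 0 1 - 1 := by
  ext i j
  rcases eq_or_ne i j with rfl | h
  · refine Fin.cases ?_ (fun i => ?_) i
    · simp [hermJ]
      norm_num
    · simp [hermJ, (Fin.succ_ne_zero i).symm]
  · simp [hermJ, h, Matrix.single_apply]
    rintro rfl rfl
    exact (h rfl).elim

theorem hermJ_mul_self (n : ℕ) : hermJ n * hermJ n = 1 := by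
  rw [hermJ, Matrix.diagonal_mul_diagonal, ← Matrix.diagonal_one]
  congr 1
  ext i
  refine Fin.cases ?_ (fun i => ?_) i <;> simp

-- The standard frame, the matrix unit `single 0 0 1` and the conjugate transpose, is conjugated by
-- the `g ∈ SU(1,n)` that defines the involution. As `g` preserves the Hermitian form, membership in
-- `su n` is compatible with the conjugation.
open scoped ComplexOrder in
theorem exists_cartanFrame {n : ℕ} (D : IwasawaData n) : Nonempty (CartanFrame D) := by
  obtain ⟨g, ⟨hg, -⟩, hσ⟩ := D.cartan
  set G : Mat n := (g : Mat n)
  set K : Mat n := ((g⁻¹ : GL (Fin (n + 1)) ℂ) : Mat n)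
  have hGK : G * K = 1 := by
    rw [← Units.val_mul, mul_inv_cancel, Units.val_one]
  have hKG : K * G = 1 := by
    rw [← Units.val_mul, inv_mul_cancel, Units.val_one]
  have hKG' : ∀ X, K * (G * X) = X := fun X => by rw [← mul_assoc, hKG, one_mul]
  have hGK' : ∀ X, G * (K * X) = X := fun X => by rw [← mul_assoc, hGK, one_mul]
  set e : Mat n := Matrix.single 0 0 1 with he
  have hJ : (2 : ℂ) • (G * e * K) - 1 = G * hermJ n * K := by
    rw [hermJ_eq, mul_sub, sub_mul, mul_one, hGK, mul_smul_comm, smul_mul_assoc]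
  have hJJ := hermJ_mul_self n
  have hKH : Kᴴ * Gᴴ = 1 := by rw [← conjTranspose_mul, hGK, conjTranspose_one]
  have hmem : ∀ X : Mat n, Xᴴ * hermJ n + hermJ n * X = 0 ↔
      (K * X * G)ᴴ = -(hermJ n * (K * X * G) * hermJ n) := by
    intro X
    have h1 : Gᴴ * (Xᴴ * hermJ n + hermJ n * X) * G =
        (K * X * G)ᴴ * hermJ n + hermJ n * (K * X * G) := by
      conv_rhs => rw [← hg]
      simp only [conjTranspose_mul, mul_add, add_mul, mul_assoc, hGK']
      rw [← mul_assoc Kᴴ, hKH, one_mul]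
    have h2 : Xᴴ * hermJ n + hermJ n * X = 0 ↔
        (K * X * G)ᴴ * hermJ n + hermJ n * (K * X * G) = 0 := by
      rw [← h1]
      refine ⟨fun h => by rw [h, mul_zero, zero_mul], fun h => ?_⟩
      have := congrArg (fun Y => Kᴴ * Y * K) h
      simp only [mul_zero, zero_mul, mul_assoc, hGK, mul_one] at this
      rwa [← mul_assoc, hKH, one_mul] at this
    rw [h2]
    refine ⟨fun h => ?_, fun h => ?_⟩
    · have := congrArg (· * hermJ n) (eq_neg_of_add_eq_zero_left h)
      simpa only [mul_assoc, hJJ, mul_one, neg_mul] using this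
    · rw [h, neg_mul, mul_assoc, hJJ, mul_one, neg_add_cancel]
  refine ⟨⟨G * e * K, fun X => G * (K * X * G)ᴴ * K, ?_, ?_, ?_, ?_, ?_, ?_, ?_, ?_, ?_, ?_⟩⟩
  · simp only [mul_assoc, hKG']
    rw [← mul_assoc e, he, Matrix.single_mul_single_same, one_mul]
  · intro X
    have h1 : e * (K * X * G) * e = (K * X * G) 0 0 • e := by
      simp [he, Matrix.single_mul_mul_single]
    have h2 : (G * e * K * X).trace = (K * X * G) 0 0 := by
      rw [show G * e * K * X = G * (e * (K * X)) by simp only [mul_assoc], Matrix.trace_mul_comm,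
        mul_assoc, he, Matrix.trace_single_mul]
      simp
    calc G * e * K * X * (G * e * K) = G * (e * (K * X * G) * e) * K := by simp only [mul_assoc]
      _ = _ := by rw [h1, h2, mul_smul_comm, smul_mul_assoc]
  · intro X Y
    simp only [mul_add, add_mul, conjTranspose_add]
  · intro c X
    simp only [mul_smul_comm, smul_mul_assoc, conjTranspose_smul]
  · intro X Y
    have : K * (X * Y) * G = (K * X * G) * (K * Y * G) := by simp only [mul_assoc, hGK']
    rw [this, conjTranspose_mul]
    simp only [mul_assoc, hKG']
  · simp [hKG, hGK]
  · have : K * (G * e * K) * G = e := by simp only [mul_assoc, hKG', hKG, mul_one]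
    rw [this]
    simp [he]
  · intro X hX
    have h1 : (K * X * G) * (K * X * G)ᴴ = 0 := by
      have := congrArg (fun Y => K * Y * G) hX
      simp only [mul_zero, zero_mul, mul_assoc, hKG, mul_one] at this
      simpa only [mul_assoc] using this
    rw [Matrix.self_mul_conjTranspose_eq_zero] at h1
    have := congrArg (fun Y => G * Y * K) h1
    simpa only [mul_zero, zero_mul, mul_assoc, hGK, mul_one, hGK'] using this
  · intro X
    rw [hJ]
    refine and_congr_left fun _ => ?_
    rw [hmem]
    have h1 : ∀ Y, K * (G * Y * K) * G = Y := fun Y => by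
      simp only [mul_assoc, hKG', hKG, mul_one]
    have h2 : -(G * hermJ n * K * X * (G * hermJ n * K)) =
        G * -(hermJ n * (K * X * G) * hermJ n) * K := by
      simp only [mul_assoc, mul_neg, neg_mul]
    rw [h2]
    refine ⟨fun h => by rw [h], fun h => ?_⟩
    have := congrArg (fun Y => K * Y * G) h
    simpa only [h1] using this
  · intro X
    rw [hσ, (hmem X).1 X.2.1, hJ]
    simp only [mul_assoc, neg_mul, mul_neg, neg_neg]

end ANQuant

namespace ANQuant

/-! ### The element `A` and its root vectors -/

theorem real_smul_mat {n : ℕ} (r : ℝ) (M : Mat n) : r • M = (r : ℂ) • M := by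
  ext i j
  simp

theorem su_coe_lie {n : ℕ} (X Y : su n) :
    ((⁅X, Y⁆ : su n) : Mat n) = (X : Mat n) * Y - (Y : Mat n) * X := by
  rw [LieSubalgebra.coe_bracket, Ring.lie_def]

theorem su_coe_smul {n : ℕ} (r : ℝ) (X : su n) :
    ((r • X : su n) : Mat n) = (r : ℂ) • (X : Mat n) := by
  rw [← real_smul_mat]
  rfl

theorem lie_eq_smul_iff {n : ℕ} (H X : su n) (t : ℝ) :
    ⁅H, X⁆ = t • X ↔ (H : Mat n) * X = X * H + (t : ℂ) • (X : Mat n) := by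
  rw [← Subtype.coe_inj, su_coe_lie, su_coe_smul, sub_eq_iff_eq_add']

namespace IwasawaData

variable {n : ℕ} (D : IwasawaData n)

/-- The element `A`, as a matrix. -/
def aMat : Mat n := ((D.A : su n) : Mat n)

theorem coe_A : ((D.A : su n) : Mat n) = D.aMat := rfl

theorem lie_of_mem_weightSpace {t : ℝ} {X : su n} (hX : X ∈ weightSpace D.𝔞 (t • D.α)) :
    ⁅(D.A : su n), X⁆ = t • X := by
  have := hX D.A
  rwa [LinearMap.smul_apply, D.α_A, smul_eq_mul, mul_one] at this

end IwasawaData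

namespace CartanFrame

variable {n : ℕ} {D : IwasawaData n} (F : CartanFrame D)

/-- The reflection `2 P - 1`. -/
def J : Mat n := (2 : ℂ) • F.P - 1

theorem J_eq : (2 : ℂ) • F.P - 1 = F.J := rfl

theorem J_mul_self : F.J * F.J = 1 := by
  rw [J, sub_mul, mul_sub, smul_mul_smul_comm, F.P_mul_self, one_mul, mul_one]
  module

theorem J_mul_J_mul (X : Mat n) : F.J * (F.J * X) = X := by
  rw [← mul_assoc, J_mul_self, one_mul]

theorem dag_J : F.dag F.J = F.J := by
  have h := F.dag_smul (-1) 1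
  rw [F.dag_one] at h
  rw [J, show (2 : ℂ) • F.P - 1 = (2 : ℂ) • F.P + (-1 : ℂ) • (1 : Mat n) by module, F.dag_add,
    F.dag_smul, F.dag_P, h]
  simp

theorem dag_eq (X : su n) : F.dag X = -(F.J * X * F.J) := ((F.mem_su X).1 X.2).1

theorem anticomm {X : su n} (h : D.σ X = -X) : F.P * X + X * F.P = (X : Mat n) := by
  have h1 := F.sigma_eq X
  rw [h] at h1
  have h2 := congrArg (· * F.J) h1
  have h3 : F.J * (X : Mat n) * F.J * F.J = F.J * X := by rw [mul_assoc, J_mul_self, mul_one]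
  simp only [J_eq, h3, NegMemClass.coe_neg, neg_mul] at h2
  simp only [J, mul_sub, sub_mul, mul_one, one_mul, mul_smul_comm, smul_mul_assoc] at h2
  linear_combination (norm := module) (-1 / 2 : ℂ) • h2

theorem comm {X : su n} (h : D.σ X = X) : F.P * X = X * F.P := by
  have h1 := F.sigma_eq X
  rw [h] at h1
  have h2 := congrArg (· * F.J) h1
  have h3 : F.J * (X : Mat n) * F.J * F.J = F.J * X := by rw [mul_assoc, J_mul_self, mul_one]
  simp only [J_eq, h3] at h2
  simp only [J, mul_sub, sub_mul, mul_one, one_mul, mul_smul_comm, smul_mul_assoc] at h2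
  linear_combination (norm := module) (-1 / 2 : ℂ) • h2

theorem anticomm_A : F.P * D.aMat + D.aMat * F.P = D.aMat := F.anticomm (D.a_le_p _ D.A.2)

theorem A_mul_J : D.aMat * F.J = -(F.J * D.aMat) := by
  have := F.anticomm_A
  simp only [J, mul_sub, sub_mul, mul_one, one_mul, mul_smul_comm, smul_mul_assoc]
  linear_combination (norm := module) (2 : ℂ) • this

theorem dag_A : F.dag D.aMat = D.aMat := by
  rw [← D.coe_A, dag_eq, D.coe_A, mul_assoc, A_mul_J, mul_neg, J_mul_J_mul, neg_neg]

end CartanFrame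

namespace IwasawaData

variable {n : ℕ} (D : IwasawaData n)

theorem mul_of_mem_weightSpace {t : ℝ} {X : su n} (hX : X ∈ weightSpace D.𝔞 (t • D.α)) :
    D.aMat * X = X * D.aMat + (t : ℂ) • (X : Mat n) :=
  (lie_eq_smul_iff _ X t).1 (D.lie_of_mem_weightSpace hX)

theorem aMat_ne_zero : D.aMat ≠ 0 := by
  intro h
  have h1 : D.A = 0 := Subtype.ext (Subtype.ext h)
  have := D.α_A
  rw [h1, map_zero] at this
  exact zero_ne_one this

end IwasawaData

namespace CartanFrame

variable {n : ℕ} {D : IwasawaData n} (F : CartanFrame D)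

/-- `A³ = cA` for some `c`. Weight 1 allows `c = 1` or `c = 1/4`, weight 2 allows `c = 4` or `c =
1`, so having both as roots forces `c = 1`. -/
theorem cube_relations : D.aMat * D.aMat * D.aMat = D.aMat ∧ D.aMat * D.aMat * F.P = F.P ∧
    F.P * D.aMat * D.aMat = F.P := by
  obtain ⟨X, hX, hX0⟩ := Submodule.exists_mem_ne_zero_of_ne_bot D.root_α
  obtain ⟨Y, hY, hY0⟩ := Submodule.exists_mem_ne_zero_of_ne_bot D.root_two_α
  have hA := cube_of_anticomm F.P_mul_self F.anticomm_A (F.P_mul_mul_P _)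
  have h1 := weight_eq hA.1 (D.mul_of_mem_weightSpace (t := 1) (by simpa using hX)) (by simp)
    (by simpa using hX0)
  have h2 := weight_eq hA.1 (D.mul_of_mem_weightSpace hY) (by simp) (by simpa using hY0)
  generalize (F.P * (D.aMat * D.aMat)).trace = c at hA h1 h2
  have : c = 1 := by
    rcases h1 with h1 | h1
    · simpa using h1
    · rcases h2 with h2 | h2
      · rw [h2] at h1
        norm_num at h1
      · rw [h2] at h1
        norm_num at h1
  simpa only [this, one_smul] using hA

end CartanFrame

/-! ### The line `𝔞`, the positive weights and the bracket `[A, Z]`. -/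

namespace IwasawaData

variable {n : ℕ} (D : IwasawaData n)

theorem aMat_cube : D.aMat * D.aMat * D.aMat = D.aMat := by
  obtain ⟨F⟩ := exists_cartanFrame D
  exact F.cube_relations.1

/-- `H` is odd for `J` and commutes with `A`, so it is determined by the compression of `A H` to the
range of `P`, a single scalar. Hence `H = t A`, and `t` is real because `A` is nonzero and
self-adjoint for `dag` while `H` lies in the real form. -/
theorem eq_smul_A (H : D.𝔞) : (H : su n) = D.α H • (D.A : su n) := by
  obtain ⟨F⟩ := exists_cartanFrame D
  obtain ⟨-, h1, h2⟩ := F.cube_relations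
  have hp := F.anticomm (D.a_le_p H H.2)
  have hcomm : D.aMat * (H : su n) = (H : su n) * D.aMat := by
    have := congrArg (Subtype.val : su n → Mat n) (D.a_abelian _ D.A.2 H H.2)
    rwa [su_coe_lie, ZeroMemClass.coe_zero, sub_eq_zero] at this
  have h := eq_smul_of_anticomm F.P_mul_self F.anticomm_A hp hcomm h1 h2 (F.P_mul_mul_P _)
  generalize (F.P * (D.aMat * ((H : su n) : Mat n))).trace = t at h
  have ht : star t = t := by
    have h3 := F.dag_eq (H : su n)
    have h4 := F.dag_eq (D.A : su n)
    rw [D.coe_A, F.dag_A] at h4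
    rw [h, F.dag_smul, F.dag_A, mul_smul_comm, smul_mul_assoc, ← smul_neg, ← h4] at h3
    exact smul_left_injective ℂ D.aMat_ne_zero h3
  have hH : (H : su n) = t.re • (D.A : su n) := by
    apply Subtype.ext
    rw [su_coe_smul, h, D.coe_A, Complex.conj_eq_iff_re.1 ht]
  have hH' : H = t.re • D.A := Subtype.ext hH
  rw [hH', map_smul, D.α_A, smul_eq_mul, mul_one]
  rfl

theorem mem_weightSpace_iff {t : ℝ} {X : su n} :
    X ∈ weightSpace D.𝔞 (t • D.α) ↔ D.aMat * X = X * D.aMat + (t : ℂ) • (X : Mat n) := by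
  refine ⟨D.mul_of_mem_weightSpace, fun h H => ?_⟩
  rw [D.eq_smul_A H, smul_lie, (lie_eq_smul_iff _ X t).2 h, smul_smul, LinearMap.smul_apply,
    smul_eq_mul, mul_comm]

theorem mem_weightSpace_iff_lie {t : ℝ} {X : su n} :
    X ∈ weightSpace D.𝔞 (t • D.α) ↔ ⁅(D.A : su n), X⁆ = t • X := by
  rw [mem_weightSpace_iff, lie_eq_smul_iff]
  rfl

theorem weightSpace_eq_bot {t : ℝ} (ht : 0 < t) (h1 : t ≠ 1) (h2 : t ≠ 2) :
    weightSpace D.𝔞 (t • D.α) = ⊥ := by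
  rw [Submodule.eq_bot_iff]
  intro X hX
  by_contra hX0
  have := weight_eq (c := 1) (by simpa using D.aMat_cube) (D.mul_of_mem_weightSpace hX)
    (by exact_mod_cast ht.ne') (by simpa using hX0)
  have hc : (1 : ℝ) = t ^ 2 ∨ 4 * 1 = t ^ 2 := by exact_mod_cast this
  rcases hc with h | h
  · exact h1 (by nlinarith)
  · exact h2 (by nlinarith)

theorem n_eq : D.𝔫 = weightSpace D.𝔞 D.α ⊔ weightSpace D.𝔞 ((2 : ℝ) • D.α) := by
  apply le_antisymm
  · refine iSup_le fun ⟨t, ht⟩ => ?_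
    by_cases h1 : t = 1
    · subst h1
      simp
    · by_cases h2 : t = 2
      · subst h2
        exact le_sup_right
      · rw [D.weightSpace_eq_bot ht h1 h2]
        exact bot_le
  · refine sup_le ?_ (le_iSup (fun t : {t : ℝ // 0 < t} => weightSpace D.𝔞 ((t : ℝ) • D.α))
      ⟨2, two_pos⟩)
    have := le_iSup (fun t : {t : ℝ // 0 < t} => weightSpace D.𝔞 ((t : ℝ) • D.α)) ⟨1, one_pos⟩
    simp only [one_smul] at this
    exact this

/-- Since `i A² J` lies in `𝔨`, the central `Z` commutes with it, hence with `A P A`, besides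
commuting with `P`. So `Z` acts by scalars `s` and `l` on the ranges of `P` and `A P A`, which `A`
exchanges. Then `κ = s - l`, and `(ad Z)² A = -A` forces `κ² = -1`. -/
theorem lie_A_Z : ∃ (F : CartanFrame D) (κ : ℂ), κ ^ 2 = -1 ∧
    ((⁅(D.A : su n), D.Z⁆ : su n) : Mat n) = κ • (D.aMat * F.J) := by
  obtain ⟨F⟩ := exists_cartanFrame D
  obtain ⟨-, h1, h2⟩ := F.cube_relations
  have hAJ := F.A_mul_J
  have hAAJ : D.aMat * D.aMat * F.J = F.J * D.aMat * D.aMat := by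
    rw [mul_assoc, hAJ, mul_neg, ← mul_assoc, hAJ, neg_mul, neg_neg]
  have hmem : (I : ℂ) • (D.aMat * D.aMat * F.J) ∈ su n := by
    rw [F.mem_su]
    constructor
    · rw [F.dag_smul, F.dag_mul, F.dag_mul, F.dag_A, F.dag_J, F.J_eq, mul_smul_comm,
        smul_mul_assoc, mul_assoc F.J, mul_assoc _ F.J, F.J_mul_self, mul_one]
      simp
    · have : (D.aMat * D.aMat * F.J).trace = -(D.aMat * D.aMat * F.J).trace := by
        conv_lhs => rw [mul_assoc, hAJ, mul_neg, trace_neg, ← mul_assoc, Matrix.trace_mul_comm,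
          ← mul_assoc]
      rw [trace_smul, CharZero.eq_neg_self_iff.1 this, smul_zero]
  have hZP := F.comm D.Z_mem_k
  have hZ : (D.Z : Mat n) * (D.aMat * D.aMat * F.J) = D.aMat * D.aMat * F.J * D.Z := by
    have hk : D.σ ⟨_, hmem⟩ = ⟨_, hmem⟩ := by
      apply Subtype.ext
      rw [F.sigma_eq, F.J_eq, mul_smul_comm, smul_mul_assoc, mul_assoc F.J, mul_assoc _ F.J,
        F.J_mul_self, mul_one, ← mul_assoc, ← hAAJ]
    have := congrArg (Subtype.val : su n → Mat n) (D.Z_central _ hk)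
    rw [su_coe_lie, ZeroMemClass.coe_zero, sub_eq_zero, mul_smul_comm, smul_mul_assoc] at this
    exact smul_right_injective _ I_ne_zero this
  have hAAJ' : D.aMat * D.aMat * F.J = (2 : ℂ) • F.P - D.aMat * D.aMat := by
    rw [← F.J_eq, mul_sub, mul_smul_comm, h1, mul_one]
  have hAPA : D.aMat * F.P * D.aMat = D.aMat * D.aMat - F.P := by
    have := congrArg (D.aMat * ·) F.anticomm_A
    simp only [mul_add, ← mul_assoc, h1] at this
    rw [← this, add_sub_cancel_right]
  have hZ' : (D.Z : Mat n) * (D.aMat * F.P * D.aMat) = D.aMat * F.P * D.aMat * D.Z := by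
    rw [hAAJ', mul_sub, sub_mul, mul_smul_comm, smul_mul_assoc, hZP] at hZ
    rw [hAPA, mul_sub, sub_mul, sub_right_injective hZ, hZP]
  obtain ⟨h3, h4⟩ := lie_of_comm F.P_mul_self F.anticomm_A h1 h2 hZP hZ' (F.P_mul_mul_P _)
    (F.P_mul_mul_P _)
  generalize (F.P * (D.Z : Mat n)).trace = s at h3 h4
  generalize (F.P * (D.aMat * D.Z * D.aMat)).trace = l at h3 h4
  have hJ : D.aMat * F.P - F.P * D.aMat = D.aMat * F.J := by
    rw [← F.J_eq, mul_sub, mul_smul_comm, mul_one]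
    nth_rewrite 4 [← F.anticomm_A]
    module
  rw [hJ] at h3 h4
  refine ⟨F, s - l, ?_, by rw [su_coe_lie, D.coe_A, h3]⟩
  have h5 := congrArg (Subtype.val : su n → Mat n) (D.Z_complex _ (D.a_le_p _ D.A.2))
  have h6 : ((⁅D.Z, (D.A : su n)⁆ : su n) : Mat n) = (l - s) • (D.aMat * F.J) := by
    rw [su_coe_lie, D.coe_A, ← neg_sub, h3, ← neg_smul, neg_sub]
  rw [su_coe_lie, h6, mul_smul_comm, smul_mul_assoc, ← smul_sub, h4, smul_smul] at h5
  have h7 : ((l - s) * (l - s)) • D.aMat = (-1 : ℂ) • D.aMat := by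
    rw [h5, neg_one_smul]
    rfl
  rw [← smul_left_injective ℂ D.aMat_ne_zero h7]
  ring

end IwasawaData

end ANQuant

namespace ANQuant

/-! ### The root space `𝔤_{2α}` and the Killing form -/

/-- The square of an endomorphism with eigenvalues in `{0, ±1, ±2}` has nonzero trace. -/
theorem trace_mul_self_ne_zero {M : Type*} [AddCommGroup M] [Module ℝ M] [FiniteDimensional ℝ M]
    {T : Module.End ℝ M} (hT : T ^ 5 = (5 : ℝ) • T ^ 3 - (4 : ℝ) • T) (hT0 : T ^ 2 ≠ 0) :
    LinearMap.trace ℝ M (T * T) ≠ 0 := by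
  have h6 : T ^ 6 = (5 : ℝ) • T ^ 4 - (4 : ℝ) • T ^ 2 := by
    rw [pow_succ, hT, sub_mul, smul_mul_assoc, smul_mul_assoc, ← pow_succ, ← pow_two]
  have h8 : T ^ 8 = (21 : ℝ) • T ^ 4 - (20 : ℝ) • T ^ 2 := by
    rw [show T ^ 8 = T ^ 6 * T ^ 2 by rw [← pow_add], h6, sub_mul, smul_mul_assoc, smul_mul_assoc,
      ← pow_add, ← pow_add, h6]
    module
  -- `p` and `q` are the spectral projections of `T²` for the eigenvalues 1 and 4. Hence the trace
  -- of `T²` is the rank of `p` plus four times the rank of `q`, which vanishes only if `T² = 0`.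
  let p := (4 / 3 : ℝ) • T ^ 2 - (1 / 3 : ℝ) • T ^ 4
  let q := (1 / 12 : ℝ) • T ^ 4 - (1 / 12 : ℝ) • T ^ 2
  have hp : IsIdempotentElem p := by
    simp only [IsIdempotentElem, p, sub_mul, mul_sub, smul_mul_smul_comm, ← pow_add]
    rw [show T ^ (2 + 2) = T ^ 4 from rfl, show T ^ (2 + 4) = T ^ 6 from rfl, h6,
      show T ^ (4 + 4) = T ^ 8 from rfl, h8]
    module
  have hq : IsIdempotentElem q := by
    simp only [IsIdempotentElem, q, sub_mul, mul_sub, smul_mul_smul_comm, ← pow_add]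
    rw [show T ^ (2 + 2) = T ^ 4 from rfl, show T ^ (2 + 4) = T ^ 6 from rfl, h6,
      show T ^ (4 + 4) = T ^ 8 from rfl, h8]
    module
  have hpq : T * T = p + (4 : ℝ) • q := by
    simp only [p, q, ← pow_two]
    module
  have hp' := (LinearMap.IsIdempotentElem.isProj_range p hp).trace
  have hq' := (LinearMap.IsIdempotentElem.isProj_range q hq).trace
  intro h0
  rw [hpq, map_add, map_smul, hp', hq', smul_eq_mul] at h0
  have hp0 : (Module.finrank ℝ (LinearMap.range p) : ℝ) = 0 := by
    have h1 : (0 : ℝ) ≤ Module.finrank ℝ (LinearMap.range p) := by positivity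
    have h2 : (0 : ℝ) ≤ Module.finrank ℝ (LinearMap.range q) := by positivity
    linarith
  have hq0 : (Module.finrank ℝ (LinearMap.range q) : ℝ) = 0 := by linarith
  have hp1 := (LinearMap.IsIdempotentElem.trace_eq_zero_iff hp).1 (by rw [hp', hp0])
  have hq1 := (LinearMap.IsIdempotentElem.trace_eq_zero_iff hq).1 (by rw [hq', hq0])
  apply hT0
  rw [pow_two, hpq, hp1, hq1, smul_zero, add_zero]

theorem killingForm_su_lie {n : ℕ} (X Y U : su n) :
    killingForm ℝ (su n) ⁅X, Y⁆ U = killingForm ℝ (su n) X ⁅Y, U⁆ :=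
  LieModule.traceForm_apply_lie_apply ℝ (su n) (su n) X Y U

theorem killingForm_su_comm {n : ℕ} (X Y : su n) :
    killingForm ℝ (su n) X Y = killingForm ℝ (su n) Y X :=
  LieModule.traceForm_comm ℝ (su n) (su n) X Y

namespace IwasawaData

variable {n : ℕ} (D : IwasawaData n)

/-- The vector `[A, Z]` of `𝔭`. -/
noncomputable def wVec : su n := ⁅(D.A : su n), D.Z⁆

/-- A root vector of weight `2α`. -/
noncomputable def eVec : su n := D.wVec + (1 / 2 : ℝ) • ⁅(D.A : su n), D.wVec⁆

theorem exists_coe_wVec : ∃ (F : CartanFrame D) (κ : ℂ), κ ^ 2 = -1 ∧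
    (D.wVec : Mat n) = κ • (D.aMat * F.J) ∧
    (D.eVec : Mat n) = κ • ((D.aMat * D.aMat + D.aMat) * F.J) := by
  obtain ⟨F, κ, hκ, h⟩ := D.lie_A_Z
  refine ⟨F, κ, hκ, h, ?_⟩
  have hW : (D.wVec : Mat n) = κ • (D.aMat * F.J) := h
  have h1 : D.aMat * F.J * D.aMat = -(D.aMat * D.aMat * F.J) := by
    rw [mul_assoc, mul_assoc, F.A_mul_J, mul_neg, neg_neg]
  have h2 : (D.eVec : Mat n) = D.wVec + (((1 / 2 : ℝ) • ⁅(D.A : su n), D.wVec⁆ : su n) : Mat n) :=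
    rfl
  rw [h2, su_coe_smul, su_coe_lie, hW, D.coe_A, mul_smul_comm, smul_mul_assoc, h1, add_mul,
    ← mul_assoc]
  push_cast
  module

/-- `[A, Z]` is a multiple of `A J` and anticommutes with `A`, so it has components in the weights
`±2α` only; `eVec` is twice the component in `2α`. -/
theorem lie_A_lie_A_wVec : ⁅(D.A : su n), ⁅(D.A : su n), D.wVec⁆⁆ = (4 : ℝ) • D.wVec := by
  obtain ⟨F, κ, hκ, hW, -⟩ := D.exists_coe_wVec
  apply Subtype.ext
  have h1 : D.aMat * F.J * D.aMat = -(D.aMat * D.aMat * F.J) := by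
    rw [mul_assoc, mul_assoc, F.A_mul_J, mul_neg, neg_neg]
  have h2 : D.aMat * (D.aMat * D.aMat * F.J) = D.aMat * F.J := by
    rw [← mul_assoc, ← mul_assoc, D.aMat_cube]
  have h3 : D.aMat * D.aMat * F.J * D.aMat = -(D.aMat * F.J) := by
    rw [mul_assoc (D.aMat), mul_assoc (D.aMat), h1, mul_neg, h2]
  rw [su_coe_smul, su_coe_lie, su_coe_lie, hW, D.coe_A]
  simp only [mul_smul_comm, smul_mul_assoc, mul_sub, sub_mul, h1, h3, mul_neg, neg_mul,
    ← mul_assoc, D.aMat_cube]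
  push_cast
  module

theorem eVec_mem : D.eVec ∈ weightSpace D.𝔞 ((2 : ℝ) • D.α) := by
  rw [mem_weightSpace_iff_lie, eVec, lie_add, lie_smul, lie_A_lie_A_wVec]
  module

/-- For `X` of weight two, `X J` is fixed by `A` on both sides, hence a multiple of `A² + A` by rank
one. The coefficients of `X` and of `eVec` are both purely imaginary by the reality condition of `su
n`, so their ratio is real. -/
theorem mem_weightSpace_two_iff {X : su n} :
    X ∈ weightSpace D.𝔞 ((2 : ℝ) • D.α) ↔ ∃ r : ℝ, X = r • D.eVec := by
  refine ⟨fun hX => ?_, ?_⟩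
  · obtain ⟨F, κ, hκ, -, hE⟩ := D.exists_coe_wVec
    obtain ⟨-, h1, -⟩ := F.cube_relations
    by_cases hX0 : X = 0
    · exact ⟨0, by rw [hX0, zero_smul]⟩
    have hX1 := D.mul_of_mem_weightSpace hX
    push_cast at hX1
    obtain ⟨h2, h3⟩ := weight_two_relations D.aMat_cube hX1
    have h4 := mul_mul_eq_smul_of_anticomm (f := fun Y => (F.P * Y).trace) (M := X * F.J)
      F.anticomm_A h1 F.P_mul_mul_P (by rw [← mul_assoc, h3])
      (by rw [mul_assoc, ← neg_eq_iff_eq_neg.2 F.A_mul_J, mul_neg, ← mul_assoc, h2, neg_mul,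
        neg_neg])
    generalize (1 / 4 : ℂ) * _ = q at h4
    have h5 : (X : Mat n) = q • ((D.aMat * D.aMat + D.aMat) * F.J) := by
      rw [← smul_mul_assoc, ← h4, mul_assoc, F.J_mul_self, mul_one]
    have hN : F.J * (D.aMat * D.aMat + D.aMat) ≠ 0 := by
      intro h
      have h6 : D.aMat * D.aMat + D.aMat = 0 := by rw [← F.J_mul_J_mul (_ + _), h, mul_zero]
      rw [h6, zero_mul, smul_zero] at h5
      exact hX0 (Subtype.ext h5)
    have hq : star q = -q := by
      have h6 := F.dag_eq X
      rw [h5, F.dag_smul, F.dag_mul, F.dag_J, F.dag_add, F.dag_mul, F.dag_A, mul_smul_comm,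
        smul_mul_assoc, mul_assoc F.J, mul_assoc _ F.J, F.J_mul_self, mul_one, ← neg_smul] at h6
      exact smul_left_injective ℂ hN h6
    have hκ' : star κ = -κ := by
      have : (κ - I) * (κ + I) = 0 := by
        linear_combination hκ - I_mul_I
      rcases mul_eq_zero.1 this with h | h
      · rw [sub_eq_zero.1 h]
        exact conj_I
      · rw [eq_neg_of_add_eq_zero_left h, star_neg]
        exact congrArg _ conj_I
    have hκ0 : κ ≠ 0 := by
      rintro rfl
      norm_num at hκ
    have hr : star (q / κ) = q / κ := by rw [star_div₀, hq, hκ', neg_div_neg_eq]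
    refine ⟨(q / κ).re, Subtype.ext ?_⟩
    rw [su_coe_smul, Complex.conj_eq_iff_re.1 hr, hE, smul_smul, div_mul_cancel₀ _ hκ0, h5]
  · rintro ⟨r, rfl⟩
    exact Submodule.smul_mem _ _ D.eVec_mem

theorem eVec_ne_zero : D.eVec ≠ 0 := by
  obtain ⟨X, hX, hX0⟩ := Submodule.exists_mem_ne_zero_of_ne_bot D.root_two_α
  obtain ⟨r, rfl⟩ := D.mem_weightSpace_two_iff.1 hX
  exact right_ne_zero_of_smul hX0

/-- `A³ = A` makes `ad A` a root of `x(x² - 1)(x² - 4)`, and its square is nonzero on `eVec`. -/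
theorem killingForm_A_A : killingForm ℝ (su n) (D.A : su n) (D.A : su n) ≠ 0 := by
  rw [LieModule.traceForm_apply_apply]
  set T := LieModule.toEnd ℝ (su n) (su n) (D.A : su n)
  have hT1 : ∀ X : su n, T X = ⁅(D.A : su n), X⁆ := fun X => rfl
  have h3 : D.aMat * (D.aMat * D.aMat) = D.aMat := by rw [← mul_assoc, D.aMat_cube]
  have h3' : ∀ Y, D.aMat * (D.aMat * (D.aMat * Y)) = D.aMat * Y := fun Y => by
    rw [← mul_assoc, ← mul_assoc, D.aMat_cube]
  refine trace_mul_self_ne_zero (T := T) ?_ ?_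
  · ext X : 2
    have e : ∀ Y : su n, ((⁅(D.A : su n), Y⁆ : su n) : Mat n) = D.aMat * Y - Y * D.aMat := fun Y =>
      su_coe_lie _ _
    simp only [pow_succ, pow_zero, one_mul, Module.End.mul_apply, LinearMap.sub_apply,
      LinearMap.smul_apply, hT1, AddSubgroupClass.coe_sub, su_coe_smul, e, mul_sub, sub_mul,
      mul_assoc, h3, h3']
    push_cast
    module
  · intro h0
    have := LinearMap.congr_fun h0 D.eVec
    have h2 := D.mem_weightSpace_iff_lie.1 D.eVec_mem
    rw [pow_two, Module.End.mul_apply, hT1, hT1, h2, lie_smul, h2, LinearMap.zero_apply,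
      smul_smul] at this
    exact smul_ne_zero (by norm_num) D.eVec_ne_zero this

theorem killingForm_Z_lie_A (X : su n) :
    killingForm ℝ (su n) D.Z ⁅(D.A : su n), X⁆ = -killingForm ℝ (su n) D.wVec X := by
  rw [← killingForm_su_lie, ← lie_skew, map_neg, LinearMap.neg_apply, wVec]

/-- With `W = [A, Z]`, invariance gives `B(Z, X) = -B(W, X)`. Moving `(ad A)²` from `W` to `X` gives
`4 B(W, X) = B(W, X)`. -/
theorem killingForm_Z_eq_zero {X : su n} (hX : ⁅(D.A : su n), X⁆ = X) :
    killingForm ℝ (su n) D.Z X = 0 := by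
  have h1 : ∀ Y, killingForm ℝ (su n) ⁅(D.A : su n), Y⁆ X = -killingForm ℝ (su n) Y X := by
    intro Y
    rw [← lie_skew, map_neg, LinearMap.neg_apply, killingForm_su_lie, hX]
  have h2 := congrArg (fun Y => killingForm ℝ (su n) Y X) D.lie_A_lie_A_wVec
  simp only [h1, map_smul, LinearMap.smul_apply, smul_eq_mul] at h2
  rw [← hX, killingForm_Z_lie_A]
  linarith

/-- By invariance `2 B(Z, e) = -B(W, e) = -B(W, W)` for `e = eVec` and `W = [A, Z]`, and `(ad Z)² A
= -A` turns `B(W, W)` into `B(A, A)`. -/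
theorem killingForm_Z_eVec : killingForm ℝ (su n) D.Z D.eVec ≠ 0 := by
  have h1 : killingForm ℝ (su n) D.wVec ⁅(D.A : su n), D.wVec⁆ = 0 := by
    have h := killingForm_su_lie D.wVec (D.A : su n) D.wVec
    rw [← lie_skew, map_neg, LinearMap.neg_apply, killingForm_su_comm _ D.wVec] at h
    linarith
  have h2 : killingForm ℝ (su n) D.wVec D.wVec =
      killingForm ℝ (su n) (D.A : su n) (D.A : su n) := by
    conv_lhs => rw [wVec, killingForm_su_lie, ← lie_skew (D.A : su n) D.Z, lie_neg,
      D.Z_complex _ (D.a_le_p _ D.A.2), neg_neg]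
  have h3 := D.killingForm_Z_lie_A D.eVec
  rw [D.mem_weightSpace_iff_lie.1 D.eVec_mem, map_smul, smul_eq_mul] at h3
  have h4 : killingForm ℝ (su n) D.wVec D.eVec =
      killingForm ℝ (su n) (D.A : su n) (D.A : su n) := by
    rw [eVec, map_add, map_smul, h1, smul_zero, add_zero, h2]
  intro h0
  rw [h0, h4] at h3
  exact D.killingForm_A_A (by linarith)

end IwasawaData

end ANQuant

namespace ANQuant

/-! ### The symplectic form of `𝔯` and the generator `E` -/

namespace IwasawaData

variable {n : ℕ} (D : IwasawaData n)

theorem lie_A_incl (x : D.gα) : ⁅(D.A : su n), D.incl x⁆ = D.incl x := by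
  have h : D.incl x ∈ weightSpace D.𝔞 D.α := x.2
  have := D.mem_weightSpace_iff_lie (t := 1) (X := D.incl x)
  rw [one_smul, one_smul] at this
  exact this.1 h

theorem exists_incl {X : su n} (h : ⁅(D.A : su n), X⁆ = X) : ∃ x : D.gα, D.incl x = X := by
  have := D.mem_weightSpace_iff_lie (t := 1) (X := X)
  rw [one_smul, one_smul] at this
  exact ⟨⟨X, this.2 h⟩, rfl⟩

theorem incl_injective : Function.Injective D.incl := Subtype.val_injective

theorem inclMat_apply (x : D.gα) : D.inclMat x = (D.incl x : Mat n) := rfl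

theorem mul_inclMat (x : D.gα) : D.aMat * D.inclMat x = D.inclMat x * D.aMat + D.inclMat x := by
  have := (lie_eq_smul_iff (D.A : su n) (D.incl x) 1).1 (by rw [one_smul, lie_A_incl])
  rw [ofReal_one, one_smul] at this
  exact this

theorem mul_weight_two {X : su n} (hX : X ∈ weightSpace D.𝔞 ((2 : ℝ) • D.α)) :
    (X : Mat n) * D.aMat = -(X : Mat n) ∧ D.aMat * X = (X : Mat n) := by
  have h := D.mul_of_mem_weightSpace hX
  push_cast at h
  exact weight_two_relations D.aMat_cube h

theorem lie_incl_incl_mem (x y : D.gα) :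
    ⁅D.incl x, D.incl y⁆ ∈ weightSpace D.𝔞 ((2 : ℝ) • D.α) := by
  rw [mem_weightSpace_iff_lie, leibniz_lie, lie_A_incl, lie_A_incl, two_smul]

theorem mem_n_iff {X : su n} : X ∈ D.𝔫 ↔
    ∃ (x : D.gα) (U : su n), U ∈ weightSpace D.𝔞 ((2 : ℝ) • D.α) ∧ X = D.incl x + U := by
  rw [n_eq, Submodule.mem_sup]
  constructor
  · rintro ⟨x, hx, U, hU, rfl⟩
    exact ⟨⟨x, hx⟩, U, hU, rfl⟩
  · rintro ⟨x, U, hU, rfl⟩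
    exact ⟨D.incl x, x.2, U, hU, rfl⟩

theorem lie_incl_weight_two (x : D.gα) {U : su n} (hU : U ∈ weightSpace D.𝔞 ((2 : ℝ) • D.α)) :
    ⁅D.incl x, U⁆ = 0 := by
  obtain ⟨h1, h2⟩ := D.mul_weight_two hU
  obtain ⟨h3, h4⟩ := weight_one_relations D.aMat_cube (D.mul_inclMat x)
  apply Subtype.ext
  rw [su_coe_lie, ← D.inclMat_apply, mul_eq_zero_of_weight_one_two h3 h2,
    mul_eq_zero_of_weight_two_one h4 h1, sub_zero]
  rfl

theorem lie_weight_two {U U' : su n} (hU : U ∈ weightSpace D.𝔞 ((2 : ℝ) • D.α))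
    (hU' : U' ∈ weightSpace D.𝔞 ((2 : ℝ) • D.α)) : ⁅U, U'⁆ = 0 := by
  obtain ⟨h1, h2⟩ := D.mul_weight_two hU
  obtain ⟨h1', h2'⟩ := D.mul_weight_two hU'
  apply Subtype.ext
  rw [su_coe_lie, mul_eq_zero_of_weight_two h1 h2', mul_eq_zero_of_weight_two h1' h2, sub_zero]
  rfl

theorem lie_mem_of_mem_n {X Y : su n} (hX : X ∈ D.𝔫) (hY : Y ∈ D.𝔫) :
    ⁅X, Y⁆ ∈ weightSpace D.𝔞 ((2 : ℝ) • D.α) := by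
  obtain ⟨x, U, hU, rfl⟩ := D.mem_n_iff.1 hX
  obtain ⟨y, U', hU', rfl⟩ := D.mem_n_iff.1 hY
  rw [lie_add, add_lie, add_lie, D.lie_incl_weight_two x hU', D.lie_weight_two hU hU',
    ← lie_skew U, D.lie_incl_weight_two y hU, neg_zero, add_zero, add_zero, add_zero]
  exact D.lie_incl_incl_mem x y

theorem incl_mem_n (x : D.gα) : D.incl x ∈ D.𝔫 :=
  D.mem_n_iff.2 ⟨x, 0, Submodule.zero_mem _, (add_zero _).symm⟩

/-- The form `ω`, as a bilinear map. -/
noncomputable def omegaB : D.gα →ₗ[ℝ] D.gα →ₗ[ℝ] ℝ :=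
  LinearMap.mk₂ ℝ D.ω
    (fun x x' y => by simp [ω, Ω])
    (fun c x y => by simp [ω, Ω])
    (fun x y y' => by simp [ω, Ω])
    (fun c x y => by simp [ω, Ω])

theorem omega_eq : D.ω = fun x y => D.omegaB x y := rfl

theorem omegaB_antisymm (x y : D.gα) : D.omegaB x y = -D.omegaB y x := by
  change D.ω x y = -D.ω y x
  rw [ω, ω, Ω, Ω, ← lie_skew, map_neg]

/-- Take `y = -i (X A + A X)`: it has weight one, lies in `su n`, and satisfies `[X, y] = 2i X²`. If
`Ω(x, y) = 0`, then `X² = 0`, and positivity of the adjoint kills `A X` and then `X A`, hence also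
`X = A X - X A`. -/
theorem exists_omega_ne_zero {x : D.gα} (hx : x ≠ 0) : ∃ y, D.ω x y ≠ 0 := by
  obtain ⟨F⟩ := exists_cartanFrame D
  set X := D.inclMat x with hX
  have hX0 : X ≠ 0 := fun h => hx (D.inclMat_injective (by rw [← hX, h, map_zero]))
  have hXA := D.mul_inclMat x
  rw [← hX] at hXA
  obtain ⟨h1, h2⟩ := weight_one_relations D.aMat_cube hXA
  have h3 : D.aMat * X * D.aMat = 0 := by rw [hXA, add_mul, h1, neg_add_cancel]
  have hdX : F.dag X = -(F.J * X * F.J) := F.dag_eq (D.incl x)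
  have hAJ : F.J * D.aMat = -(D.aMat * F.J) := by rw [F.A_mul_J, neg_neg]
  have hmem : (-I : ℂ) • (X * D.aMat + D.aMat * X) ∈ su n := by
    rw [F.mem_su, F.J_eq]
    constructor
    · rw [F.dag_smul, F.dag_add, F.dag_mul, F.dag_mul, F.dag_A, hdX, mul_neg, neg_mul]
      have e1 : D.aMat * (F.J * X * F.J) = -(F.J * (D.aMat * X) * F.J) := by
        rw [← mul_assoc, ← mul_assoc, F.A_mul_J, neg_mul, neg_mul, ← mul_assoc]
      have e2 : F.J * X * F.J * D.aMat = -(F.J * (X * D.aMat) * F.J) := by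
        rw [mul_assoc, hAJ, mul_neg, ← mul_assoc, ← mul_assoc]
      rw [e1, e2, mul_smul_comm, smul_mul_assoc, mul_add, add_mul]
      simp
    · have e1 : (D.aMat * X).trace = 0 := by
        rw [← h2, mul_assoc, Matrix.trace_mul_comm, h3, trace_zero]
      rw [trace_smul, trace_add, Matrix.trace_mul_comm, e1, add_zero, smul_zero]
  have hY : ⁅(D.A : su n), (⟨_, hmem⟩ : su n)⁆ = ⟨_, hmem⟩ := by
    apply Subtype.ext
    rw [su_coe_lie, D.coe_A]
    simp only [mul_smul_comm, smul_mul_assoc, mul_add, add_mul, h1, h2, h3, ← mul_assoc]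
    rw [hXA]
    module
  obtain ⟨y, hy⟩ := D.exists_incl hY
  refine ⟨y, ?_⟩
  have hXX := weight_two_of_mul hXA hXA
  obtain ⟨h4, h5⟩ := weight_two_relations D.aMat_cube hXX
  obtain ⟨r, hr⟩ := D.mem_weightSpace_two_iff.1 (D.lie_incl_incl_mem x y)
  have hlie : ((⁅D.incl x, D.incl y⁆ : su n) : Mat n) = (2 * I) • (X * X) := by
    rw [su_coe_lie, hy, ← D.inclMat_apply, ← hX, mul_smul_comm, smul_mul_assoc, mul_add,
      add_mul, mul_assoc D.aMat, h5, ← mul_assoc, h4, ← mul_assoc X D.aMat X]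
    module
  rw [ω, Ω, hr, map_smul, smul_eq_mul]
  refine mul_ne_zero ?_ D.killingForm_Z_eVec
  rintro rfl
  rw [hr, zero_smul, eq_comm, ZeroMemClass.coe_zero] at hlie
  have h6 : X * X = 0 := (smul_eq_zero.1 hlie).resolve_left (by simp)
  -- `A X` vanishes on the range of `A²`, which contains the range of `P`; so it sees only the part
  -- on which `J` is `-1`.
  have h7 : D.aMat * X * F.J = -(D.aMat * X) := by
    have e1 : D.aMat * X * (D.aMat * D.aMat) = 0 := by rw [← mul_assoc, h3, zero_mul]
    have e2 : (1 - D.aMat * D.aMat) * F.J = -(1 - D.aMat * D.aMat) := by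
      rw [← F.J_eq, mul_sub, mul_smul_comm, sub_mul, F.cube_relations.2.1, one_mul, sub_self,
        smul_zero, mul_one, zero_sub]
    have e3 : D.aMat * X * (1 - D.aMat * D.aMat) = D.aMat * X := by
      rw [mul_sub, e1, mul_one, sub_zero]
    rw [← e3, mul_assoc, e2, mul_neg]
  have h8 : D.aMat * X = 0 := by
    apply F.eq_zero_of_mul_dag
    rw [F.dag_mul, hdX, F.dag_A, neg_mul, mul_neg, ← mul_assoc, ← mul_assoc, ← mul_assoc, h7,
      neg_mul, mul_assoc D.aMat X X, h6, mul_zero, neg_zero, zero_mul, zero_mul, neg_zero]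
  have h9 : X * D.aMat = 0 := by
    apply F.eq_zero_of_mul_dag
    rw [F.dag_mul, hdX, F.dag_A, mul_neg, ← mul_assoc, ← mul_assoc, F.A_mul_J, neg_mul,
      mul_assoc F.J, h8, mul_zero, neg_zero, zero_mul, neg_zero, mul_zero]
  rw [h8, h9, zero_add] at hXA
  exact hX0 hXA.symm

theorem omegaB_injective : Function.Injective D.omegaB := by
  rw [injective_iff_map_eq_zero]
  intro x hx
  by_contra h
  obtain ⟨y, hy⟩ := D.exists_omega_ne_zero h
  exact hy (LinearMap.congr_fun hx y)

theorem exists_pair : ∃ x y : D.gα, D.ω x y ≠ 0 := by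
  obtain ⟨X, hX, hX0⟩ := Submodule.exists_mem_ne_zero_of_ne_bot D.root_α
  have : (⟨X, hX⟩ : D.gα) ≠ 0 := fun h => hX0 (congrArg D.incl h)
  obtain ⟨y, hy⟩ := D.exists_omega_ne_zero this
  exact ⟨_, y, hy⟩

/-- Brackets of `𝔫` lie on the line of `eVec`, so the normalization `B(Z, E) = 1` makes the
coefficient of `E` equal to `Ω`. Uniqueness needs one pair with nonzero `Ω`. -/
theorem existsUnique_generator : ∃! E : su n, D.IsGenerator E := by
  refine ⟨(killingForm ℝ (su n) D.Z D.eVec)⁻¹ • D.eVec,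
    ⟨Submodule.smul_mem _ _ D.eVec_mem, fun X hX Y hY => ?_⟩, fun E hE => ?_⟩
  · obtain ⟨r, hr⟩ := D.mem_weightSpace_two_iff.1 (D.lie_mem_of_mem_n hX hY)
    rw [Ω, hr, map_smul, smul_eq_mul, smul_smul, mul_assoc,
      mul_inv_cancel₀ D.killingForm_Z_eVec, mul_one]
  · obtain ⟨r, rfl⟩ := D.mem_weightSpace_two_iff.1 hE.1
    obtain ⟨x, y, hxy⟩ := D.exists_pair
    have h1 := hE.2 _ (D.incl_mem_n x) _ (D.incl_mem_n y)
    have h2 := congrArg (killingForm ℝ (su n) D.Z) h1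
    rw [map_smul, map_smul, smul_eq_mul, smul_eq_mul] at h2
    have h3 : D.ω x y = D.ω x y * (r * killingForm ℝ (su n) D.Z D.eVec) := h2
    have h4 : r * killingForm ℝ (su n) D.Z D.eVec = 1 := by
      have : D.ω x y * (r * killingForm ℝ (su n) D.Z D.eVec) = D.ω x y * 1 := by
        rw [← h3, mul_one]
      exact mul_left_cancel₀ hxy this
    rw [eq_inv_of_mul_eq_one_left h4]

variable {D}

theorem IsGenerator.killingForm_eq_one {E : su n} (hE : D.IsGenerator E) :
    killingForm ℝ (su n) D.Z E = 1 := by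
  obtain ⟨x, y, hxy⟩ := D.exists_pair
  have h1 := hE.2 _ (D.incl_mem_n x) _ (D.incl_mem_n y)
  have h2 := congrArg (killingForm ℝ (su n) D.Z) h1
  rw [map_smul, smul_eq_mul] at h2
  have h3 : D.ω x y * 1 = D.ω x y * killingForm ℝ (su n) D.Z E := by rw [mul_one]; exact h2
  exact (mul_left_cancel₀ hxy h3).symm

theorem IsGenerator.ne_zero {E : su n} (hE : D.IsGenerator E) : E ≠ 0 := by
  rintro rfl
  have := hE.killingForm_eq_one
  rw [map_zero] at this
  exact zero_ne_one this

theorem IsGenerator.lie_A {E : su n} (hE : D.IsGenerator E) : ⁅(D.A : su n), E⁆ = (2 : ℝ) • E :=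
  D.mem_weightSpace_iff_lie.1 hE.1

theorem IsGenerator.exists_smul {E : su n} (hE : D.IsGenerator E) {X : su n}
    (hX : X ∈ weightSpace D.𝔞 ((2 : ℝ) • D.α)) : ∃ z : ℝ, X = z • E := by
  obtain ⟨s, rfl⟩ := D.mem_weightSpace_two_iff.1 hE.1
  obtain ⟨r, rfl⟩ := D.mem_weightSpace_two_iff.1 hX
  have hs : s ≠ 0 := left_ne_zero_of_smul hE.ne_zero
  exact ⟨r / s, by rw [smul_smul, div_mul_cancel₀ _ hs]⟩

theorem IsGenerator.mem_n_iff {E : su n} (hE : D.IsGenerator E) {X : su n} :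
    X ∈ D.𝔫 ↔ ∃ (x : D.gα) (z : ℝ), X = D.incl x + z • E := by
  rw [D.mem_n_iff]
  constructor
  · rintro ⟨x, U, hU, rfl⟩
    obtain ⟨z, rfl⟩ := hE.exists_smul hU
    exact ⟨x, z, rfl⟩
  · rintro ⟨x, z, rfl⟩
    exact ⟨x, z • E, Submodule.smul_mem _ _ hE.1, rfl⟩

theorem IsGenerator.eq_zero_of_add {E : su n} (hE : D.IsGenerator E) {x : D.gα} {z : ℝ}
    (h : D.incl x + z • E = 0) : x = 0 ∧ z = 0 := by
  have h1 := congrArg (fun X => ⁅(D.A : su n), X⁆) h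
  simp only [lie_add, lie_smul, D.lie_A_incl, hE.lie_A, lie_zero] at h1
  have h2 : z • E = 0 := by linear_combination (norm := module) h1 - h
  have hz : z = 0 := (smul_eq_zero.1 h2).resolve_right hE.ne_zero
  rw [hz, zero_smul, add_zero] at h
  exact ⟨D.incl_injective (by rw [h, map_zero]), hz⟩

theorem IsGenerator.vec_bijOn {E : su n} (hE : D.IsGenerator E) :
    Set.BijOn (D.vec E) Set.univ ((D.𝔞 ⊔ D.𝔫 : Submodule ℝ (su n)) : Set (su n)) := by
  refine ⟨fun p _ => ?_, fun p _ q _ h => ?_, fun X hX => ?_⟩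
  · rw [vec, add_assoc]
    exact Submodule.add_mem_sup (Submodule.smul_mem _ _ D.A.2) (hE.mem_n_iff.2 ⟨_, _, rfl⟩)
  · obtain ⟨a, x, z⟩ := p
    obtain ⟨a', x', z'⟩ := q
    simp only [vec] at h
    -- Bracketing with `A` removes the component in `𝔞` and multiplies the other two by 1 and 2.
    have h1 := congrArg (fun X => ⁅(D.A : su n), X⁆) h
    simp only [lie_add, lie_smul, D.lie_A_incl, hE.lie_A, lie_self, smul_zero, zero_add] at h1
    have h2 : D.incl (x - x') + (2 * (z - z')) • E = 0 := by
      rw [map_sub]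
      linear_combination (norm := module) h1
    obtain ⟨h3, h4⟩ := hE.eq_zero_of_add h2
    have hx : x = x' := sub_eq_zero.1 h3
    have hz : z = z' := by linarith
    subst hx hz
    have h5 : a • (D.A : su n) = a' • (D.A : su n) := by simpa using h
    have hA : (D.A : su n) ≠ 0 := fun h => D.aMat_ne_zero (congrArg Subtype.val h)
    rw [smul_left_injective ℝ hA h5]
  · obtain ⟨H, hH, N, hN, rfl⟩ := Submodule.mem_sup.1 hX
    obtain ⟨x, z, rfl⟩ := hE.mem_n_iff.1 hN
    refine ⟨(D.α ⟨H, hH⟩, x, z), trivial, ?_⟩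
    rw [vec, ← D.eq_smul_A ⟨H, hH⟩, add_assoc]

theorem IsGenerator.omega_vec {E : su n} (hE : D.IsGenerator E) (p q : Coord D.gα) :
    D.Ω (D.vec E p) (D.vec E q) = omegaCoord D.ω p q := by
  obtain ⟨a, x, z⟩ := p
  obtain ⟨a', x', z'⟩ := q
  have h1 : ∀ y : D.gα, ⁅D.incl y, (D.A : su n)⁆ = -D.incl y := fun y => by
    rw [← lie_skew, D.lie_A_incl]
  have h2 : ⁅E, (D.A : su n)⁆ = -((2 : ℝ) • E) := by rw [← lie_skew, hE.lie_A]
  have h3 : ∀ y : D.gα, ⁅E, D.incl y⁆ = 0 := fun y => by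
    rw [← lie_skew, D.lie_incl_weight_two y hE.1, neg_zero]
  simp only [Ω, vec, lie_add, add_lie, lie_smul, smul_lie, lie_self, D.lie_A_incl, hE.lie_A, h1,
    h2, h3, D.lie_incl_weight_two _ hE.1, map_add, map_smul, map_neg, map_zero, smul_zero,
    D.killingForm_Z_eq_zero (D.lie_A_incl _), hE.killingForm_eq_one, omegaCoord, pairAE, ω,
    smul_eq_mul]
  ring

end IwasawaData

end ANQuant

namespace ANQuant

/-! ### Exponentials and the group law of `R` -/

section Exp

theorem semiconjBy_exp {R : Type*} [NormedRing R] [NormedAlgebra ℂ R] [FiniteDimensional ℂ R]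
    {X A B : R} (h : SemiconjBy X A B) :
    SemiconjBy X (NormedSpace.exp A) (NormedSpace.exp B) := by
  have : CompleteSpace R := FiniteDimensional.complete ℂ R
  let _ : NormedAlgebra ℚ R := NormedAlgebra.restrictScalars ℚ ℂ R
  exact h.exp_right

variable {n : ℕ}

theorem exp_add_smul_one (A : Mat n) (t : ℂ) :
    NormedSpace.exp (A + t • (1 : Mat n)) = cexp t • NormedSpace.exp A := by
  have h1 : Commute A (t • (1 : Mat n)) := (Commute.one_right A).smul_right t
  have h2 : NormedSpace.exp (t • (1 : Mat n)) = cexp t • (1 : Mat n) := by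
    rw [smul_one_eq_diagonal, Matrix.exp_diagonal, smul_one_eq_diagonal]
    congr 1
    ext i
    rw [Pi.coe_exp, Complex.exp_eq_exp_ℂ]
  rw [Matrix.exp_add_of_commute _ _ h1, h2, mul_smul_comm, mul_one]

/-- `X` intertwines `A + t` with `A`, hence also their exponentials. -/
theorem exp_mul_of_weight {A X : Mat n} {t : ℂ} (h : A * X = X * A + t • X) :
    NormedSpace.exp A * X = cexp t • (X * NormedSpace.exp A) := by
  have h1 : SemiconjBy X (A + t • (1 : Mat n)) A := by
    rw [SemiconjBy, h, mul_add, mul_smul_comm, mul_one]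
  have h2 : SemiconjBy X (NormedSpace.exp (A + t • (1 : Mat n))) (NormedSpace.exp A) := by
    -- The exponential depends on the topology only, so any submultiplicative norm will do.
    let _ : NormedRing (Mat n) := Matrix.linftyOpNormedRing
    let _ : NormedAlgebra ℂ (Mat n) := Matrix.linftyOpNormedAlgebra
    exact semiconjBy_exp h1
  rw [← h2.eq, exp_add_smul_one, mul_smul_comm]

theorem mul_exp_smul_of_weight {A X : Mat n} {t : ℝ} (h : A * X = X * A + (t : ℂ) • X) (a : ℝ) :
    X * NormedSpace.exp ((a : ℂ) • A) =
      NormedSpace.exp ((a : ℂ) • A) * ((Real.exp (-(t * a)) : ℂ) • X) := by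
  have h1 : ((a : ℂ) • A) * X = X * ((a : ℂ) • A) + ((t * a : ℝ) : ℂ) • X := by
    rw [smul_mul_assoc, h, mul_smul_comm]
    push_cast
    module
  rw [mul_smul_comm, exp_mul_of_weight h1, smul_smul, ← ofReal_exp, ← ofReal_mul, ← Real.exp_add,
    neg_add_cancel, Real.exp_zero, ofReal_one, one_smul]

theorem exp_of_cube_eq_zero {N : Mat n} (h : N * N * N = 0) :
    NormedSpace.exp N = 1 + N + (1 / 2 : ℂ) • (N * N) := by
  rw [NormedSpace.exp_eq_tsum ℂ]
  have h3 : N ^ 3 = 0 := by rw [pow_succ, pow_two, h]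
  have h0 : ∀ k ∉ Finset.range 3, ((k.factorial : ℂ)⁻¹) • N ^ k = 0 := by
    intro k hk
    rw [Finset.mem_range, not_lt] at hk
    rw [pow_eq_zero_of_le hk h3, smul_zero]
  simp only
  rw [tsum_eq_sum h0]
  simp [Finset.sum_range_succ, pow_two]

theorem coe_expGL (X : su n) :
    ((expGL X : GL (Fin (n + 1)) ℂ) : Mat n) = NormedSpace.exp (X : Mat n) :=
  rfl

end Exp

/-! ### The group law and the Iwasawa coordinates of `R`. -/

namespace IwasawaData

variable {n : ℕ} {D : IwasawaData n}

variable (D) in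
/-- The element `x + z E` of `𝔫`, as a matrix. -/
noncomputable def nMat (E : su n) (x : D.gα) (z : ℝ) : Mat n :=
  D.inclMat x + (z : ℂ) • (E : Mat n)

theorem coe_incl_add_smul (E : su n) (x : D.gα) (z : ℝ) :
    ((D.incl x + z • E : su n) : Mat n) = D.nMat E x z := by
  rw [nMat, ← su_coe_smul]
  rfl

theorem weight_two_inclMat_mul (x y : D.gα) :
    D.aMat * (D.inclMat x * D.inclMat y) =
      D.inclMat x * D.inclMat y * D.aMat + (2 : ℂ) • (D.inclMat x * D.inclMat y) :=
  weight_two_of_mul (D.mul_inclMat x) (D.mul_inclMat y)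

theorem inclMat_mul_weight_two (x : D.gα) {Y : Mat n}
    (hY : D.aMat * Y = Y * D.aMat + (2 : ℂ) • Y) :
    D.inclMat x * Y = 0 ∧ Y * D.inclMat x = 0 := by
  obtain ⟨h1, h2⟩ := weight_two_relations D.aMat_cube hY
  obtain ⟨h3, h4⟩ := weight_one_relations D.aMat_cube (D.mul_inclMat x)
  exact ⟨mul_eq_zero_of_weight_one_two h3 h2, mul_eq_zero_of_weight_two_one h4 h1⟩

theorem IsGenerator.mul_weight {E : su n} (hE : D.IsGenerator E) :
    D.aMat * E = E * D.aMat + ((2 : ℝ) : ℂ) • (E : Mat n) :=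
  D.mul_of_mem_weightSpace hE.1

theorem IsGenerator.weight_two_mul {E : su n} (hE : D.IsGenerator E) {Y : Mat n}
    (hY : D.aMat * Y = Y * D.aMat + (2 : ℂ) • Y) : (E : Mat n) * Y = 0 ∧ Y * E = 0 := by
  obtain ⟨h1, h2⟩ := weight_two_relations D.aMat_cube hY
  obtain ⟨h3, h4⟩ := D.mul_weight_two hE.1
  exact ⟨mul_eq_zero_of_weight_two h3 h2, mul_eq_zero_of_weight_two h1 h4⟩

/-- Only products of two vectors of weight one survive the ladder of eigenvalues of `A`; every
product with `E` would raise by at least three steps. -/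
theorem IsGenerator.nMat_mul_nMat {E : su n} (hE : D.IsGenerator E) (x y : D.gα) (z w : ℝ) :
    D.nMat E x z * D.nMat E y w = D.inclMat x * D.inclMat y := by
  have h := hE.mul_weight
  push_cast at h
  rw [nMat, nMat, mul_add, add_mul, add_mul, smul_mul_assoc, mul_smul_comm, mul_smul_comm,
    smul_mul_assoc, (inclMat_mul_weight_two x h).1, (inclMat_mul_weight_two y h).2,
    (hE.weight_two_mul h).1]
  simp

theorem IsGenerator.exp_nMat {E : su n} (hE : D.IsGenerator E) (x : D.gα) (z : ℝ) :
    NormedSpace.exp (D.nMat E x z) =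
      1 + D.nMat E x z + (1 / 2 : ℂ) • (D.inclMat x * D.inclMat x) := by
  have h1 := D.weight_two_inclMat_mul x x
  rw [exp_of_cube_eq_zero, hE.nMat_mul_nMat]
  rw [hE.nMat_mul_nMat, nMat, mul_add, mul_smul_comm, (inclMat_mul_weight_two x h1).2,
    (hE.weight_two_mul h1).2, smul_zero, add_zero]

theorem IsGenerator.inclMat_mul_sub {E : su n} (hE : D.IsGenerator E) (x y : D.gα) :
    D.inclMat x * D.inclMat y - D.inclMat y * D.inclMat x = (D.ω x y : ℂ) • (E : Mat n) := by
  have := congrArg (Subtype.val : su n → Mat n) (hE.2 _ (D.incl_mem_n x) _ (D.incl_mem_n y))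
  rw [su_coe_lie, su_coe_smul] at this
  exact this

/-- The Baker-Campbell-Hausdorff formula for the two-step nilpotent algebra `𝔫`. -/
theorem IsGenerator.exp_nMat_mul {E : su n} (hE : D.IsGenerator E) (x y : D.gα) (z w : ℝ) :
    NormedSpace.exp (D.nMat E x z) * NormedSpace.exp (D.nMat E y w) =
      NormedSpace.exp (D.nMat E (x + y) (z + w + 1 / 2 * D.ω x y)) := by
  have hxx := D.weight_two_inclMat_mul x x
  have hyy := D.weight_two_inclMat_mul y y
  have e1 : D.nMat E x z * (D.inclMat y * D.inclMat y) = 0 := by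
    rw [nMat, add_mul, smul_mul_assoc, (inclMat_mul_weight_two x hyy).1, (hE.weight_two_mul hyy).1,
      smul_zero, add_zero]
  have e2 : D.inclMat x * D.inclMat x * D.nMat E y w = 0 := by
    rw [nMat, mul_add, mul_smul_comm, (inclMat_mul_weight_two y hxx).2, (hE.weight_two_mul hxx).2,
      smul_zero, add_zero]
  have e3 : D.inclMat x * D.inclMat x * (D.inclMat y * D.inclMat y) = 0 := by
    rw [mul_assoc, (inclMat_mul_weight_two x hyy).1, mul_zero]
  have e4 := hE.inclMat_mul_sub x y
  rw [hE.exp_nMat, hE.exp_nMat, hE.exp_nMat]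
  simp only [add_mul, mul_add, one_mul, mul_one, smul_mul_assoc, mul_smul_comm, e1, e2, e3,
    hE.nMat_mul_nMat, smul_zero, add_zero, map_add]
  simp only [nMat, map_add]
  push_cast
  linear_combination (norm := module) (1 / 2 : ℂ) • e4

theorem IsGenerator.exp_nMat_mul_exp {E : su n} (hE : D.IsGenerator E) (x : D.gα) (z a : ℝ) :
    NormedSpace.exp (D.nMat E x z) * NormedSpace.exp ((a : ℂ) • D.aMat) =
      NormedSpace.exp ((a : ℂ) • D.aMat) *
        NormedSpace.exp (D.nMat E (Real.exp (-a) • x) (Real.exp (-2 * a) * z)) := by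
  have h1 := mul_exp_smul_of_weight (t := 1) (by simpa using D.mul_inclMat x) a
  have h2 := mul_exp_smul_of_weight hE.mul_weight a
  have h3 := mul_exp_smul_of_weight (t := 2) (by simpa using D.weight_two_inclMat_mul x x) a
  have e1 : Real.exp (-(1 * a)) = Real.exp (-a) := by rw [one_mul]
  have e2 : Real.exp (-(2 * a)) = Real.exp (-2 * a) := by rw [neg_mul]
  have e3 : Real.exp (-2 * a) = Real.exp (-a) * Real.exp (-a) := by
    rw [← Real.exp_add]; ring_nf
  rw [e1] at h1
  rw [e2] at h2 h3
  rw [hE.exp_nMat, hE.exp_nMat, nMat, nMat, map_smul, real_smul_mat]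
  simp only [add_mul, mul_add, one_mul, mul_one, smul_mul_assoc, mul_smul_comm, h1, h2, h3, e3]
  push_cast
  module

theorem coe_iw (E : su n) (p : Coord D.gα) : ((D.iw E p : GL (Fin (n + 1)) ℂ) : Mat n) =
    NormedSpace.exp ((p.1 : ℂ) • D.aMat) * NormedSpace.exp (D.nMat E p.2.1 p.2.2) := by
  rw [iw, Units.val_mul, coe_expGL, coe_expGL, coe_incl_add_smul, su_coe_smul, coe_A]

theorem IsGenerator.iw_mul_iw {E : su n} (hE : D.IsGenerator E) (p q : Coord D.gα) :
    D.iw E p * D.iw E q = D.iw E (leftMul D.ω p q) := by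
  apply Units.ext
  rw [Units.val_mul, coe_iw, coe_iw, coe_iw, mul_assoc,
    ← mul_assoc (NormedSpace.exp (D.nMat _ _ _)),
    hE.exp_nMat_mul_exp, mul_assoc, hE.exp_nMat_mul, ← mul_assoc, ← Matrix.exp_add_of_commute]
  · simp only [leftMul]
    congr 2
    · push_cast
      module
    · congr 1
      rw [D.omega_eq]
      simp only [map_smul, LinearMap.smul_apply, smul_eq_mul]
      ring
  · exact (Commute.refl _).smul_left _ |>.smul_right _

theorem iw_zero (E : su n) : D.iw E 0 = 1 := by
  apply Units.ext
  rw [coe_iw]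
  simp [nMat, NormedSpace.exp_zero]

/-- The factor in `N` is inverse to an exponential of `A`, so it commutes with `A`. Bracketing its
quadratic expression once and twice with `A` separates weight one from weight two and gives `x = 0`,
then `z = 0`. Finally `exp(aA) = 1` fixes `E`, while conjugation by it rescales `E` by `exp(2a)`. -/
theorem IsGenerator.eq_zero_of_iw_eq_one {E : su n} (hE : D.IsGenerator E) {p : Coord D.gα}
    (h : D.iw E p = 1) : p = 0 := by
  obtain ⟨a, x, z⟩ := p
  have h1 := congrArg (Units.val : GL (Fin (n + 1)) ℂ → Mat n) h
  rw [coe_iw, Units.val_one] at h1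
  simp only at h1
  set G := NormedSpace.exp ((a : ℂ) • D.aMat)
  set N := NormedSpace.exp (D.nMat E x z) with hN
  have hAG : D.aMat * G = G * D.aMat := ((Commute.refl _).smul_right _).exp_right.eq
  have hAN : D.aMat * N = N * D.aMat := by
    calc D.aMat * N = N * (G * D.aMat) * N := by
          rw [← mul_assoc N, mul_eq_one_comm.1 h1, one_mul]
      _ = N * D.aMat * (G * N) := by rw [← hAG]; simp only [mul_assoc]
      _ = _ := by rw [h1, mul_one]
  have hE2 := hE.mul_weight
  push_cast at hE2
  have h2 := D.mul_inclMat x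
  have h3 := D.weight_two_inclMat_mul x x
  rw [hN, hE.exp_nMat, nMat] at hAN
  simp only [mul_add, add_mul, mul_one, one_mul, mul_smul_comm, smul_mul_assoc, h2, h3, hE2] at hAN
  have h4 : D.inclMat x + ((2 * z : ℂ) • (E : Mat n) + D.inclMat x * D.inclMat x) = 0 := by
    linear_combination (norm := module) hAN
  have h5 := congrArg (fun Y => D.aMat * Y - Y * D.aMat) h4
  simp only [mul_add, add_mul, mul_smul_comm, smul_mul_assoc, h2, h3, hE2, mul_zero, zero_mul,
    sub_zero] at h5
  have h6 : D.inclMat x = 0 := by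
    linear_combination (norm := module) (2 : ℂ) • h4 - h5
  have hx : x = 0 := D.inclMat_injective (by rw [h6, map_zero])
  have hE0 : (E : Mat n) ≠ 0 := fun h => hE.ne_zero (Subtype.ext h)
  rw [h6, zero_add, mul_zero, add_zero] at h4
  have hz : z = 0 := by
    have := (smul_eq_zero.1 h4).resolve_right hE0
    simpa using this
  rw [hN, hx, hz] at h1
  have hG : G = 1 := by simpa [nMat, NormedSpace.exp_zero] using h1
  have h7 := mul_exp_smul_of_weight hE.mul_weight a
  change _ * G = G * _ at h7
  rw [hG, mul_one, one_mul] at h7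
  have h8 : (1 : ℂ) • (E : Mat n) = (Real.exp (-(2 * a)) : ℂ) • (E : Mat n) := by
    rw [one_smul, ← h7]
  have h9 := smul_left_injective ℂ hE0 h8
  have h10 : Real.exp (-(2 * a)) = 1 := by exact_mod_cast h9.symm
  rw [Real.exp_eq_one_iff] at h10
  have ha : a = 0 := by linarith
  rw [ha, hx, hz]
  rfl

/-- The inverse in Iwasawa coordinates. -/
noncomputable def coordInv {V : Type} [NormedAddCommGroup V] [NormedSpace ℝ V] (p : Coord V) :
    Coord V :=
  (-p.1, -(Real.exp p.1 • p.2.1), -(Real.exp (2 * p.1) * p.2.2))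

theorem leftMul_coordInv (p q : Coord D.gα) (h : leftMul D.ω (coordInv p) q = 0) : p = q := by
  obtain ⟨a, x, z⟩ := p
  obtain ⟨a', x', z'⟩ := q
  simp only [leftMul, coordInv, Prod.mk_eq_zero] at h
  obtain ⟨h1, h2, h3⟩ := h
  have ha : a' = a := by linarith
  subst ha
  rw [smul_neg, smul_smul, ← Real.exp_add, neg_add_cancel, Real.exp_zero, one_smul,
    neg_add_eq_zero] at h2
  subst h2
  have hω : D.ω (-(Real.exp a' • x)) x = 0 := by
    have h0 : D.omegaB x x = 0 := by linarith [D.omegaB_antisymm x x]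
    rw [D.omega_eq]
    simp only [map_neg, map_smul, LinearMap.neg_apply, LinearMap.smul_apply, h0, smul_zero,
      neg_zero]
  rw [hω, mul_neg, ← mul_assoc, ← Real.exp_add, neg_mul, neg_add_cancel, Real.exp_zero] at h3
  have hz : z = z' := by linarith
  rw [hz]

theorem leftMul_coordInv_self (p : Coord D.gα) : leftMul D.ω (coordInv p) p = 0 := by
  obtain ⟨a, x, z⟩ := p
  have h0 : D.omegaB x x = 0 := by linarith [D.omegaB_antisymm x x]
  simp only [leftMul, coordInv, Prod.mk_eq_zero]
  refine ⟨by ring, ?_, ?_⟩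
  · rw [smul_neg, smul_smul, ← Real.exp_add, neg_add_cancel, Real.exp_zero, one_smul,
      neg_add_cancel]
  · rw [D.omega_eq]
    simp only [map_neg, map_smul, LinearMap.neg_apply, LinearMap.smul_apply, h0, smul_zero,
      neg_zero]
    rw [mul_neg, ← mul_assoc, ← Real.exp_add, neg_mul, neg_add_cancel, Real.exp_zero]
    ring

theorem IsGenerator.iw_bijOn {E : su n} (hE : D.IsGenerator E) :
    Set.BijOn (D.iw E) Set.univ (D.R : Set (GL (Fin (n + 1)) ℂ)) := by
  have hinv : ∀ p, D.iw E (coordInv p) * D.iw E p = 1 := fun p => by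
    rw [hE.iw_mul_iw, leftMul_coordInv_self, iw_zero]
  refine ⟨fun p _ => ?_, fun p _ q _ h => ?_, ?_⟩
  · refine Subgroup.mul_mem _ ?_ ?_
    · exact Subgroup.mem_sup_left (Subgroup.subset_closure
        (Set.mem_image_of_mem _ (Submodule.smul_mem _ _ D.A.2)))
    · exact Subgroup.mem_sup_right (Subgroup.subset_closure
        (Set.mem_image_of_mem _ (hE.mem_n_iff.2 ⟨_, _, rfl⟩)))
  · refine leftMul_coordInv p q (hE.eq_zero_of_iw_eq_one ?_)
    rw [← hE.iw_mul_iw, ← h, hinv]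
  -- The image of the coordinates is itself a subgroup, by the group law; containing the generators
  -- of `R`, it contains `R`.
  · let K : Subgroup (GL (Fin (n + 1)) ℂ) :=
      { carrier := Set.range (D.iw E)
        mul_mem' := by
          rintro _ _ ⟨p, rfl⟩ ⟨q, rfl⟩
          exact ⟨_, (hE.iw_mul_iw p q).symm⟩
        one_mem' := ⟨0, iw_zero E⟩
        inv_mem' := by
          rintro _ ⟨p, rfl⟩
          exact ⟨coordInv p, eq_inv_of_mul_eq_one_left (hinv p)⟩ }
    have hK : D.R ≤ K := by
      refine sup_le ((Subgroup.closure_le _).2 ?_) ((Subgroup.closure_le _).2 ?_)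
      · rintro _ ⟨H, hH, rfl⟩
        refine ⟨(D.α ⟨H, hH⟩, 0, 0), Units.ext ?_⟩
        have h := congrArg (Subtype.val : su n → Mat n) (D.eq_smul_A ⟨H, hH⟩)
        rw [su_coe_smul] at h
        simp only at h
        rw [coe_iw, coe_expGL, h]
        simp [nMat, NormedSpace.exp_zero, coe_A]
      · rintro _ ⟨N, hN, rfl⟩
        obtain ⟨x, z, rfl⟩ := hE.mem_n_iff.1 hN
        refine ⟨(0, x, z), Units.ext ?_⟩
        rw [coe_iw, coe_expGL, coe_incl_add_smul]
        simp [NormedSpace.exp_zero]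
    intro g hg
    obtain ⟨p, hp⟩ := hK hg
    exact ⟨p, trivial, hp⟩

end IwasawaData

end ANQuant

/-! ### The theorem, from the analysis on `Coord V` and the structure of `𝔯` and `R`. -/

theorem theorem1 (n : ℕ) (hn : 2 ≤ n) (D : IwasawaData n) :
    (∃! E : su n, D.IsGenerator E) ∧
    ∀ E : su n, D.IsGenerator E →
      -- `(a, x, z) ↦ a A + x + z E` identifies the coordinate space with `𝔯 = 𝔞 ⊕ 𝔫`, and
      -- `omegaCoord` with the symplectic form of `𝔯`
      Set.BijOn (D.vec E) Set.univ ((D.𝔞 ⊔ D.𝔫 : Submodule ℝ (su n)) : Set (su n)) ∧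
      (∀ p q : Coord D.gα, D.Ω (D.vec E p) (D.vec E q) = omegaCoord D.ω p q) ∧
      (∀ (μ : Measure D.gα) [μ.IsAddHaarMeasure] (ħ : ℝ), 0 < ħ →
        ∃ (T : Espace μ ħ ≃ₗ[ℂ] 𝓢(Coord D.gα, ℂ))
          (W : 𝓢(Coord D.gα, ℂ) →ₗ[ℂ] 𝓢(Coord D.gα, ℂ) →ₗ[ℂ] 𝓢(Coord D.gα, ℂ))
          (star : Espace μ ħ →ₗ[ℂ] Espace μ ħ →ₗ[ℂ] Espace μ ħ),
          -- `T` is the inverse of `τ_ħ` and extends `F⁻¹ ∘ φ_ħ^* ∘ F` from Schwartz functions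
          (∀ u, T (tauE μ ħ u) = u) ∧
          (∀ u, ∃ hu : toDist μ u ∈ Espace μ ħ, ∀ p, T ⟨toDist μ u, hu⟩ p = transportFun ħ u p) ∧
          -- `W` is the Weyl product
          (∀ (f g : 𝓢(Coord D.gα, ℂ)) (p : Coord D.gα),
            Integrable (fun q : Coord D.gα × Coord D.gα => weylIntegrand D.ω ħ f g p q.1 q.2)
              ((coordMeasure μ).prod (coordMeasure μ)) ∧
            W f g p = ((ħ ^ (Module.finrank ℝ D.gα + 2) : ℝ) : ℂ)⁻¹ *
              ∫ q : Coord D.gα × Coord D.gα, weylIntegrand D.ω ħ f g p q.1 q.2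
                ∂((coordMeasure μ).prod (coordMeasure μ))) ∧
          -- (i)
          (∀ a b, star a b = tauE μ ħ (W (T a) (T b))) ∧
          (∀ a b c, star (star a b) c = star a (star b c)) ∧
          -- (ii)
          (∀ (u v : 𝓢(Coord D.gα, ℂ)) (hu : toDist μ u ∈ Espace μ ħ)
              (hv : toDist μ v ∈ Espace μ ħ),
            (∀ p (y : (ℝ × D.gα) × (ℝ × D.gα)), Integrable (fun s : ℝ × ℝ => productIntegrand D.ω ħ u v p
              (y.1.1, y.1.2, s.1) (y.2.1, y.2.2, s.2))) ∧
            (∀ p, Integrable (innerIntegral D.ω ħ u v p)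
              ((volume.prod μ).prod (volume.prod μ))) ∧
            Continuous (productFun D.ω μ ħ u v) ∧
            (∃ C : ℝ, ∀ p, ‖productFun D.ω μ ħ u v p‖ ≤ C) ∧
            (∀ ψ : 𝓢(Coord D.gα, ℂ),
              (star ⟨toDist μ u, hu⟩ ⟨toDist μ v, hv⟩ : 𝓢'(Coord D.gα, ℂ)) ψ =
                ∫ p, ψ p * productFun D.ω μ ħ u v p ∂(coordMeasure μ)) ∧
            (HasCompactSupport u → HasCompactSupport v → ∀ p,
              Integrable (fun q : Coord D.gα × Coord D.gα =>
                productIntegrand D.ω ħ u v p q.1 q.2)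
                ((coordMeasure μ).prod (coordMeasure μ)) ∧
              productFun D.ω μ ħ u v p = ((ħ ^ (Module.finrank ℝ D.gα + 2) : ℝ) : ℂ)⁻¹ *
                ∫ q : Coord D.gα × Coord D.gα, productIntegrand D.ω ħ u v p q.1 q.2
                  ∂((coordMeasure μ).prod (coordMeasure μ))))) ∧
      -- (iii)
      Set.BijOn (D.iw E) Set.univ (D.R : Set (GL (Fin (n + 1)) ℂ)) ∧
      (∀ p q : Coord D.gα, D.iw E p * D.iw E q = D.iw E (leftMul D.ω p q)) ∧
      (∀ r p₀ p₁ p₂ : Coord D.gα,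
        phase D.ω (leftMul D.ω r p₀) (leftMul D.ω r p₁) (leftMul D.ω r p₂) =
          phase D.ω p₀ p₁ p₂ ∧
        amplitude (leftMul D.ω r p₀) (leftMul D.ω r p₁) (leftMul D.ω r p₂) =
          amplitude p₀ p₁ p₂) := by
  refine ⟨D.existsUnique_generator, fun E hE => ⟨hE.vec_bijOn, hE.omega_vec, fun μ _ ħ hħ =>
    exists_deformedProduct μ D.omegaB_injective D.omegaB_antisymm D.omega_eq hħ, hE.iw_bijOn,
    hE.iw_mul_iw, fun r p₀ p₁ p₂ => ⟨phase_leftMul D.omegaB_antisymm D.omega_eq r p₀ p₁ p₂,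
      amplitude_leftMul D.ω r p₀ p₁ p₂⟩⟩⟩
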